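/- Let $k$ be a field and let $\Lambda$ be a connected finite-dimensional $k$-algebra (its only central idempotents are $0\neq 1$) which is a Nakayama algebra, i.e. every indecomposable module is serial (has a unique composition series). All modules are finite-dimensional left modules, $\operatorname{mod}\Lambda$ is the category of these modules, all subcategories are full, and equivalences of categories are $k$-linear. Let $s$ be the number of isomorphism classes of simple $\Lambda$-modules, and let $M$ be an indecomposable $\Lambda$-module of length $t\ge s$ with top $S=M/\operatorname{rad}M$. Put $e=\lceil t/s\rceil$ and $\Gamma(M)=\operatorname{End}_\Lambda(M)^{\mathrm{op}}$. Let $\operatorname{stat}M$ be the subcategory of all modules $N$ for which the evaluation map $M\otimes_{\Gamma(M)}\operatorname{Hom}_\Lambda(M,N)\to N$ is an isomorphism. Let $\operatorname{ab}M$ be the intersection of all subcategories of $\operatorname{mod}\Lambda$ that contain $M$ and are closed under kernels, cokernels and finite direct sums. For $1\le i\le t$ there is, up to isomorphism, exactly one indecomposable $\Lambda$-module of length $i$ with top $S$; it is denoted by $[i]S$. Then $\Gamma(M)$ is a local Nakayama algebra of length $e$ (as a left module over itself), and the following hold. (a) If $s\mid t$, then $\operatorname{stat}M=\operatorname{ab}M$,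 this category is equivalent to $\operatorname{mod}\Gamma(M)$, and its indecomposable modules are, up to isomorphism, the modules $[is]S$ with $1\le i\le e$. If $s\nmid t$, write $t=(e-1)s+s_1$ with $1\le s_1<s$. Then $\operatorname{ab}M$ is equivalent to the module category of a Nakayama algebra with exactly two simple modules. Every module in $\operatorname{ab}M$ has a filtration with factors isomorphic to $B_1=[s_1]S$ or to $B_2$, the kernel of an epimorphism $[s]S\to[s_1]S$. Moreover $\operatorname{stat}M\subseteq\operatorname{ab}M$, and an indecomposable module belongs to $\operatorname{stat}M$ if and only if it is isomorphic to $M$ or to $[is]S$ for some $1\le i<e$. (b) In all cases there are a Nakayama algebra $\Gamma'$ with at most two simple modules and an equivalence $\eta:\operatorname{ab}M\to\operatorname{mod}\Gamma'$ such that $\eta(M)$ is, up to isomorphism, the unique indecomposable $\Gamma'$-module which is both projective and injective. (c) The category $\operatorname{stat}M$ is always abelian, and the embedding $\operatorname{stat}M\to\operatorname{mod}\Lambda$ is right exact. This embedding is exact if and only if $s\mid t$. -/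

import Mathlib

open CategoryTheory CategoryTheory.Limits

open scoped TensorProduct

universe w u

noncomputable section

/-- A module is indecomposable if it is nonzero and has no nontrivial direct sum decomposition. -/
def IsIndecomposableModule (R : Type u) [Ring R] (N : Type u) [AddCommGroup N] [Module R N] :
    Prop :=
  Nontrivial N ∧ ∀ U V : Submodule R N, IsCompl U V → U = ⊥ ∨ V = ⊥

/-- A module is serial if it has a unique composition series. -/
def IsSerialModule (R : Type u) [Ring R] (N : Type u) [AddCommGroup N] [Module R N] : Prop :=
  ∃! c : CompositionSeries (Submodule R N), c.head = ⊥ ∧ c.last = ⊤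

/-- A Nakayama algebra over `k`: a finite-dimensional `k`-algebra such that every indecomposable
finite-dimensional (equivalently, finitely generated) left module is serial. -/
structure IsNakayamaAlgebra (k : Type w) [Field k] (R : Type u) [Ring R] [Algebra k R] :
    Prop where
  finite : Module.Finite k R
  serial : ∀ (N : Type u) [AddCommGroup N] [Module R N] [Module.Finite R N],
    IsIndecomposableModule R N → IsSerialModule R N

/-- A ring is connected (indecomposable as a ring) if it is nonzero and its only central
idempotents are `0` and `1`. -/
def IsConnectedRing (R : Type u) [Ring R] : Prop :=
  Nontrivial R ∧ ∀ c ∈ Subring.center R, IsIdempotentElem c → c = 0 ∨ c = 1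

/-- Isomorphism of simple modules. -/
def simpleModuleSetoid (R : Type u) [Ring R] :
    Setoid {N : ModuleCat.{u} R // IsSimpleModule R N} where
  r X Y := Nonempty (X.1 ≃ₗ[R] Y.1)
  iseqv :=
    { refl := fun X => ⟨LinearEquiv.refl R X.1⟩
      symm := fun ⟨f⟩ => ⟨f.symm⟩
      trans := fun ⟨f⟩ ⟨g⟩ => ⟨f.trans g⟩ }

/-- The number of isomorphism classes of simple modules (finite for finite-dimensional
algebras). -/
def numSimples (R : Type u) [Ring R] : ℕ :=
  Nat.card (Quotient (simpleModuleSetoid R))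

/-- The top `N / rad N` of a module. -/
abbrev ModuleTop (R : Type u) [Ring R] (N : Type u) [AddCommGroup N] [Module R N] : Type u :=
  N ⧸ Module.jacobson R N

/-- `N` is (a copy of) the module `[i]S`: it is indecomposable, of length `i`, with top `S`. -/
structure IsBracket (R : Type u) [Ring R] (S : Type u) [AddCommGroup S] [Module R S] (i : ℕ)
    (N : Type u) [AddCommGroup N] [Module R N] : Prop where
  indecomposable : IsIndecomposableModule R N
  length_eq : Module.length R N = i
  top_iso : Nonempty (ModuleTop R N ≃ₗ[R] S)

/-- `N` has a finite filtration all of whose factors are isomorphic to `B₁` or to `B₂`. -/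
def HasFiltration (R : Type u) [Ring R] (B₁ B₂ : Type u) [AddCommGroup B₁] [Module R B₁]
    [AddCommGroup B₂] [Module R B₂] (N : Type u) [AddCommGroup N] [Module R N] : Prop :=
  ∃ (n : ℕ) (F : Fin (n + 1) → Submodule R N), F 0 = ⊥ ∧ F (Fin.last n) = ⊤ ∧
    ∀ i : Fin n, F i.castSucc ≤ F i.succ ∧
      (Nonempty ((F i.succ ⧸ (F i.castSucc).submoduleOf (F i.succ)) ≃ₗ[R] B₁) ∨
       Nonempty ((F i.succ ⧸ (F i.castSucc).submoduleOf (F i.succ)) ≃ₗ[R] B₂))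

/-- `Γ(M) = End(M)ᵒᵖ`. -/
abbrev GammaRing (R : Type u) [Ring R] (M : Type u) [AddCommGroup M] [Module R M] : Type u :=
  (Module.End R M)ᵐᵒᵖ

section Static

variable (R : Type u) [Ring R] (M N : Type u) [AddCommGroup M] [Module R M]
  [AddCommGroup N] [Module R N]

/-- The relations that turn `M ⊗_ℤ Hom(M, N)` into `M ⊗_{Γ(M)} Hom(M, N)`. The right action of
`Γ(M)` on `M` is `m · γ = γ m`, the left action on `Hom(M, N)` is `γ · h = h ∘ γ`. -/
def balancingRelations : AddSubgroup (M ⊗[ℤ] (M →ₗ[R] N)) :=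
  AddSubgroup.closure {z | ∃ (m : M) (γ : Module.End R M) (h : M →ₗ[R] N),
    z = γ m ⊗ₜ[ℤ] h - m ⊗ₜ[ℤ] (h ∘ₗ γ)}

/-- The tensor product `M ⊗_{Γ(M)} Hom(M, N)` (as an abelian group). -/
abbrev TensorHom : Type u := (M ⊗[ℤ] (M →ₗ[R] N)) ⧸ balancingRelations R M N

/-- The evaluation map `M ⊗_ℤ Hom(M, N) → N`, `m ⊗ h ↦ h m`. -/
def evalTensor : M ⊗[ℤ] (M →ₗ[R] N) →+ N :=
  (TensorProduct.lift (LinearMap.mk₂ ℤ (fun (m : M) (h : M →ₗ[R] N) => h m)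
    (fun m₁ m₂ h => map_add h m₁ m₂) (fun c m h => map_zsmul h c m)
    (fun _ _ _ => rfl) (fun _ _ _ => rfl))).toAddMonoidHom

/-- The canonical map `μ_N : M ⊗_{Γ(M)} Hom(M, N) → N`, `m ⊗ h ↦ h m`. -/
def counitMap : TensorHom R M N →+ N :=
  QuotientAddGroup.lift (balancingRelations R M N) (evalTensor R M N) (by
    rw [balancingRelations, AddSubgroup.closure_le]
    rintro _ ⟨m, γ, h, rfl⟩
    simp [evalTensor])

/-- `N` is `M`-static: `μ_N` is an isomorphism (`μ_N` is always `R`-linear, so this means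
bijective). -/
def IsStatic : Prop := Function.Bijective (counitMap R M N)

end Static

section Subcategories

variable (R : Type u) [Ring R] (M : Type u) [AddCommGroup M] [Module R M]

/-- `stat M`, as a (full) subcategory of `mod R`. -/
def statCat : ObjectProperty (FGModuleCat.{u} R) := fun N => IsStatic R M N

/-- An exact abelian subcategory of `mod R` (`R` left noetherian): a full subcategory closed
under kernels, cokernels and finite direct sums. -/
structure IsExactAbelianSubcategory (P : ObjectProperty (FGModuleCat.{u} R)) : Prop where
  kernels : P.IsClosedUnderKernels
  cokernels : P.IsClosedUnderCokernels
  directSums : P.IsClosedUnderFiniteProducts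

variable [Module.Finite R M]

/-- `ab M`: the intersection of all exact abelian subcategories of `mod R` containing `M`. -/
def abCat : ObjectProperty (FGModuleCat.{u} R) := fun N =>
  ∀ P : ObjectProperty (FGModuleCat.{u} R), IsExactAbelianSubcategory R P →
    P (FGModuleCat.of R M) → P N

/-- `M` as an object of `ab M`. -/
def abCatSelf : (abCat R M).FullSubcategory :=
  ⟨FGModuleCat.of R M, fun _ _ hM => hM⟩

end Subcategories

/-- Two `k`-linear categories are equivalent, as `k`-linear categories. -/
def LinearlyEquivalent (k : Type w) [Field k] (C : Type*) [Category* C] [Preadditive C]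
    [Linear k C] (D : Type*) [Category* D] [Preadditive D] [Linear k D] : Prop :=
  ∃ η : C ≌ D, η.functor.Additive ∧ η.functor.Linear k

end

/-!
Throughout, `M` is uniserial of length `t ≥ s`. Its Loewy series `W 0 = M > W 1 > ⋯ > W t = 0` is
the list of all submodules of `M`.

**Periodicity.** Over an algebra whose indecomposables are uniserial, a simple module has at most
one successor and at most one predecessor in uniserial modules of length two. By connectedness the
simples of the Loewy series up to its first repetition are all the simples, so the factors of the
series are periodic with period `s`, and isomorphic exactly when their indices agree modulo `s`
(`IndecomposablesUniserial.isPeriodicLoewySeries`). Among the modules annihilated by the annihilator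
of `M`, the terms `W i` with `i < s` are therefore projective, and `M` is injective
(`IsPeriodicLoewySeries.isAnnProjective`, `IsPeriodicLoewySeries.exists_extension`).

**The category `ab M`.** Put `s₁ = t % s`. The modules annihilated by the annihilator of `M` which
are `Hom`- and `Ext¹`-perpendicular to the simple tops of `W i`, for those `i < s` with
`i ≠ s - 1` and `i ≠ s₁ - 1`, are closed under kernels, cokernels and products and contain `M`
(`IsPerpendicular`). The tops of such modules involve only the tops of `W 0` and `W s₁`, so
`Q = M × W s₁` is a projective generator of this category, and so is `Q = M` when `s ∣ t`
(`IsPerpGenerator.isPerpendicular_iff`). As `W s₁` is the kernel of an endomorphism of `M`, the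
category is `ab M` (`IsPeriodicLoewySeries.abCat_iff`). When `s ∤ t`, a minimal nonzero submodule in
it of any of its modules is `M / W s₁` or `W s₁ / W s`, which yields the filtrations and the two
simple `Γ(Q)`-modules.

**Modules over `Γ(Q)`.** If maps from `Q` lift along epimorphisms from finite powers of `Q`, then
static modules are the cokernels of maps between powers of `Q` (`isStatic_iff_isPresentedBy`), and
`Hom(Q, -)` is an equivalence from these modules to `mod Γ(Q)` (`homFunctor_isEquivalence`) under
which uniserial modules go to uniserial modules. With `Q` a generator as above this gives
`ab M ≌ mod Γ(Q)`, and there `Hom(Q, M)` is the only projective-injective indecomposable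
(`IsPerpGenerator.projective_injective_iff`); with `Q = M` it gives `stat M ≌ mod Γ(M)`, hence
`stat M` is abelian. An indecomposable static module is a quotient `M / W l` with `W l` generated
by `M`, which means `l = t` or `s ∣ l` (`IsPeriodicLoewySeries.isPresentedBy_iff`). When `s ∤ t` the
module `W s`, the kernel of `M → M / W s`, is not of this form, and left exactness fails.
-/

noncomputable section

/-! ### Modules generated and presented by a fixed module -/

section Generation

variable {R : Type u} [Ring R] {Q N N' : Type u} [AddCommGroup Q] [Module R Q]
  [AddCommGroup N] [Module R N] [AddCommGroup N'] [Module R N']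

/-- The trace of `Q` in the submodule `K`: the sum of the images of all maps from `Q` to `K`,
written as maps to the ambient module with values in `K`. -/
def homTrace (Q : Type u) [AddCommGroup Q] [Module R Q] (K : Submodule R N) : Submodule R N :=
  ⨆ h : {h : Q →ₗ[R] N // LinearMap.range h ≤ K}, LinearMap.range h.1

/-- The submodule `K` is a sum of images of maps from `Q`. -/
def IsGeneratedBy (Q : Type u) [AddCommGroup Q] [Module R Q] (K : Submodule R N) : Prop :=
  K ≤ homTrace Q K

lemma apply_mem_homTrace {K : Submodule R N} (h : Q →ₗ[R] N) (hK : ∀ y, h y ∈ K) (y : Q) :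
    h y ∈ homTrace Q K :=
  (le_iSup (fun h : {h : Q →ₗ[R] N // LinearMap.range h ≤ K} => LinearMap.range h.1)
    ⟨h, by rintro _ ⟨y, rfl⟩; exact hK y⟩) ⟨y, rfl⟩

lemma homTrace_induction {K : Submodule R N} {p : N → Prop} {x : N} (hx : x ∈ homTrace Q K)
    (mem : ∀ (h : Q →ₗ[R] N) (y : Q), (∀ z, h z ∈ K) → p (h y)) (zero : p 0)
    (add : ∀ x y, p x → p y → p (x + y)) : p x := by
  refine Submodule.iSup_induction _ (motive := p) hx ?_ zero add
  rintro ⟨h, hK⟩ _ ⟨y, rfl⟩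
  exact mem h y fun z => hK ⟨z, rfl⟩

lemma homTrace_mono {K L : Submodule R N} (h : K ≤ L) : homTrace Q K ≤ homTrace Q L := fun _ hx =>
  homTrace_induction hx (fun f y hf => apply_mem_homTrace f (fun z => h (hf z)) y)
    (zero_mem _) (fun _ _ => add_mem)

lemma IsGeneratedBy.map {K : Submodule R N} (hK : IsGeneratedBy Q K) (f : N →ₗ[R] N') :
    IsGeneratedBy Q (K.map f) := by
  rintro _ ⟨x, hx, rfl⟩
  refine homTrace_induction (hK hx) (p := fun x => f x ∈ homTrace Q (K.map f)) ?_ ?_ ?_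
  · intro h y hh
    exact apply_mem_homTrace (K := K.map f) (f ∘ₗ h) (fun z => Submodule.mem_map_of_mem (hh z)) y
  · simp
  · intro x y hx hy
    simpa using add_mem hx hy

lemma isGeneratedBy_pi (n : ℕ) : IsGeneratedBy Q (⊤ : Submodule R (Fin n → Q)) := fun x _ => by
  rw [← Finset.univ_sum_single x]
  exact sum_mem fun i _ =>
    apply_mem_homTrace (LinearMap.single R (fun _ => Q) i) (fun _ => Submodule.mem_top) (x i)

lemma isGeneratedBy_range {n : ℕ} (p : (Fin n → Q) →ₗ[R] N) :
    IsGeneratedBy Q (LinearMap.range p) := by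
  rw [LinearMap.range_eq_map]
  exact (isGeneratedBy_pi n).map p

lemma isGeneratedBy_range_one (p : Q →ₗ[R] N) : IsGeneratedBy Q (LinearMap.range p) := by
  rintro _ ⟨x, rfl⟩
  exact apply_mem_homTrace (K := LinearMap.range p) p (fun z => LinearMap.mem_range_self p z) x

lemma isGeneratedBy_bot : IsGeneratedBy Q (⊥ : Submodule R N) := bot_le

lemma IsGeneratedBy.sup {K L : Submodule R N} (hK : IsGeneratedBy Q K) (hL : IsGeneratedBy Q L) :
    IsGeneratedBy Q (K ⊔ L) :=
  sup_le (hK.trans (homTrace_mono le_sup_left)) (hL.trans (homTrace_mono le_sup_right))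

lemma exists_range_eq_sup {n m : ℕ} (p : (Fin n → Q) →ₗ[R] N) (q : (Fin m → Q) →ₗ[R] N) :
    ∃ e : (Fin (n + m) → Q) →ₗ[R] N,
      LinearMap.range e = LinearMap.range p ⊔ LinearMap.range q := by
  let a : (Fin (n + m) → Q) →ₗ[R] (Fin n → Q) := LinearMap.funLeft R Q (Fin.castAdd m)
  let b : (Fin (n + m) → Q) →ₗ[R] (Fin m → Q) := LinearMap.funLeft R Q (Fin.natAdd n)
  have ha : ∀ x y, a (Fin.append x y) = x := by
    intro x y; ext i; simp [a, LinearMap.funLeft]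
  have hb : ∀ x y, b (Fin.append x y) = y := by
    intro x y; ext i; simp [b, LinearMap.funLeft]
  refine ⟨p ∘ₗ a + q ∘ₗ b, le_antisymm ?_ (sup_le ?_ ?_)⟩
  · rintro _ ⟨z, rfl⟩
    exact Submodule.add_mem_sup ⟨a z, rfl⟩ ⟨b z, rfl⟩
  · rintro _ ⟨x, rfl⟩
    exact ⟨Fin.append x 0, by simp [ha, hb]⟩
  · rintro _ ⟨x, rfl⟩
    exact ⟨Fin.append 0 x, by simp [ha, hb]⟩

/-- A finitely generated submodule generated by `Q` is an image of a finite power of `Q`. -/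
lemma IsGeneratedBy.exists_range_eq {K : Submodule R N} (hK : IsGeneratedBy Q K) (hfg : K.FG) :
    ∃ (n : ℕ) (p : (Fin n → Q) →ₗ[R] N), LinearMap.range p = K := by
  have key : ∀ x ∈ K, ∃ (n : ℕ) (p : (Fin n → Q) →ₗ[R] N), LinearMap.range p ≤ K ∧
      x ∈ LinearMap.range p := by
    intro x hx
    refine homTrace_induction (hK hx) (p := fun x => ∃ (n : ℕ) (p : (Fin n → Q) →ₗ[R] N),
      LinearMap.range p ≤ K ∧ x ∈ LinearMap.range p) ?_ ?_ ?_
    · intro h y hh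
      refine ⟨1, h ∘ₗ LinearMap.proj 0, ?_, ⟨fun _ => y, rfl⟩⟩
      rintro _ ⟨z, rfl⟩
      exact hh _
    · exact ⟨0, 0, by simp, zero_mem _⟩
    · rintro x y ⟨n, p, hp, hx⟩ ⟨m, q, hq, hy⟩
      obtain ⟨e, he⟩ := exists_range_eq_sup p q
      exact ⟨n + m, e, he ▸ sup_le hp hq, he ▸ Submodule.add_mem_sup hx hy⟩
  obtain ⟨S, hS⟩ := hfg
  have key2 : ∀ T : Finset N, (T : Set N) ⊆ K → ∃ (n : ℕ) (p : (Fin n → Q) →ₗ[R] N),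
      LinearMap.range p ≤ K ∧ (T : Set N) ⊆ LinearMap.range p := by
    classical
    intro T
    induction T using Finset.induction_on with
    | empty => exact fun _ => ⟨0, 0, by simp, by simp⟩
    | insert x T _ ih =>
      intro hT
      rw [Finset.coe_insert, Set.insert_subset_iff] at hT
      obtain ⟨n, p, hp, hTp⟩ := ih hT.2
      obtain ⟨m, q, hq, hx⟩ := key x hT.1
      obtain ⟨e, he⟩ := exists_range_eq_sup p q
      refine ⟨n + m, e, he ▸ sup_le hp hq, ?_⟩
      rw [Finset.coe_insert, Set.insert_subset_iff, he]
      exact ⟨(le_sup_right : _ ≤ LinearMap.range p ⊔ _) hx,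
        hTp.trans (le_sup_left : _ ≤ _ ⊔ LinearMap.range q)⟩
  obtain ⟨n, p, hp, hSp⟩ := key2 S (by rw [← hS]; exact Submodule.subset_span)
  exact ⟨n, p, le_antisymm hp (by rw [← hS]; exact Submodule.span_le.2 hSp)⟩

/-- `N` is the cokernel of a map into a finite power of `Q` whose image is generated by `Q`. -/
def IsPresentedBy (Q : Type u) [AddCommGroup Q] [Module R Q] (N : Type u) [AddCommGroup N]
    [Module R N] : Prop :=
  ∃ (n : ℕ) (p : (Fin n → Q) →ₗ[R] N), Function.Surjective p ∧ IsGeneratedBy Q (LinearMap.ker p)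

variable (R Q) in
/-- Maps from `Q` lift along epimorphisms from finite powers of `Q`. -/
def IsQuasiProjective : Prop :=
  ∀ (N : Type u) [AddCommGroup N] [Module R N] (n : ℕ) (p : (Fin n → Q) →ₗ[R] N),
    Function.Surjective p → ∀ g : Q →ₗ[R] N, ∃ h : Q →ₗ[R] (Fin n → Q), p ∘ₗ h = g

lemma IsQuasiProjective.lift_pi (hQ : IsQuasiProjective R Q) {n m : ℕ}
    (p : (Fin n → Q) →ₗ[R] N) (hp : Function.Surjective p) (g : (Fin m → Q) →ₗ[R] N) :
    ∃ h : (Fin m → Q) →ₗ[R] (Fin n → Q), p ∘ₗ h = g := by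
  choose h hh using fun i => hQ N n p hp (g ∘ₗ LinearMap.single R (fun _ => Q) i)
  refine ⟨LinearMap.lsum R (fun _ => Q) ℕ h, LinearMap.pi_ext' fun i => ?_⟩
  rw [← hh i, LinearMap.comp_assoc]
  congr 1
  ext x : 1
  simp [LinearMap.lsum_apply, Pi.single_apply, apply_ite (h _)]

/-- Maps into an image of a finite power of `Q` lift. -/
lemma IsQuasiProjective.lift_range (hQ : IsQuasiProjective R Q) {n : ℕ}
    (p : (Fin n → Q) →ₗ[R] N) (g : Q →ₗ[R] N) (hg : ∀ x, g x ∈ LinearMap.range p) :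
    ∃ h : Q →ₗ[R] (Fin n → Q), p ∘ₗ h = g := by
  obtain ⟨h, hh⟩ := hQ _ n p.rangeRestrict p.surjective_rangeRestrict (g.codRestrict _ hg)
  refine ⟨h, ?_⟩
  ext x
  exact congrArg Subtype.val (LinearMap.congr_fun hh x)

lemma IsPresentedBy.congr (hN : IsPresentedBy (R := R) Q N) (e : N ≃ₗ[R] N') :
    IsPresentedBy (R := R) Q N' := by
  obtain ⟨n, p, hp, hK⟩ := hN
  refine ⟨n, e.toLinearMap ∘ₗ p, e.surjective.comp hp, ?_⟩
  rwa [LinearMap.ker_comp, LinearEquiv.ker, ← LinearMap.ker]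

lemma isPresentedBy_of_surjective {n : ℕ} (p : (Fin n → Q) →ₗ[R] N) (hp : Function.Surjective p)
    (hK : IsGeneratedBy Q (LinearMap.ker p)) : IsPresentedBy (R := R) Q N := ⟨n, p, hp, hK⟩

lemma isPresentedBy_of_surjective_one (p : Q →ₗ[R] N) (hp : Function.Surjective p)
    (hK : IsGeneratedBy Q (LinearMap.ker p)) : IsPresentedBy (R := R) Q N := by
  refine ⟨1, p ∘ₗ LinearMap.proj 0, hp.comp fun x => ⟨fun _ => x, rfl⟩, ?_⟩
  rintro x hx
  have h1 : x = LinearMap.single R (fun _ : Fin 1 => Q) 0 (x 0) := by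
    ext i; fin_cases i; simp
  rw [h1]
  refine homTrace_mono ?_ ((hK.map (LinearMap.single R (fun _ : Fin 1 => Q) 0)) ⟨x 0, hx, rfl⟩)
  rintro _ ⟨y, hy, rfl⟩
  simpa using hy

lemma isPresentedBy_self : IsPresentedBy (R := R) Q Q :=
  isPresentedBy_of_surjective_one LinearMap.id Function.surjective_id
    (by rw [LinearMap.ker_id]; exact isGeneratedBy_bot)

/-- Cokernels of maps between presented modules are presented. -/
lemma IsQuasiProjective.isPresentedBy_coker (hQ : IsQuasiProjective R Q)
    {C : Type u} [AddCommGroup C] [Module R C]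
    (hN : IsPresentedBy (R := R) Q N) (hN' : IsPresentedBy (R := R) Q N') (f : N →ₗ[R] N')
    (c : N' →ₗ[R] C) (hc : Function.Surjective c) (hfc : LinearMap.range f = LinearMap.ker c) :
    IsPresentedBy (R := R) Q C := by
  obtain ⟨n, p, hp, -⟩ := hN
  obtain ⟨m, q, hq, hK⟩ := hN'
  obtain ⟨u, hu⟩ := hQ.lift_pi q hq (f ∘ₗ p)
  refine ⟨m, c ∘ₗ q, hc.comp hq, ?_⟩
  have : LinearMap.ker (c ∘ₗ q) = LinearMap.ker q ⊔ LinearMap.range u := by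
    apply le_antisymm
    · intro x hx
      have : q x ∈ LinearMap.range f := by rw [hfc]; exact hx
      obtain ⟨y, hy⟩ := this
      obtain ⟨z, rfl⟩ := hp y
      have h2 : q (u z) = q x := (LinearMap.congr_fun hu z).trans hy
      rw [← sub_add_cancel x (u z)]
      exact Submodule.add_mem_sup (by simp [h2]) ⟨z, rfl⟩
    · refine sup_le (LinearMap.ker_le_ker_comp _ _) ?_
      rintro _ ⟨z, rfl⟩
      have h2 : q (u z) = f (p z) := LinearMap.congr_fun hu z
      rw [LinearMap.mem_ker, LinearMap.comp_apply, h2, ← LinearMap.mem_ker, ← hfc]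
      exact ⟨_, rfl⟩
  rw [this]
  exact hK.sup (isGeneratedBy_range u)

end Generation

/-! ### Static modules are the presented modules -/

section StaticPresented

variable {R : Type u} [Ring R] {Q N : Type u} [AddCommGroup Q] [Module R Q]
  [AddCommGroup N] [Module R N]

@[simp] lemma evalTensor_tmul (m : Q) (h : Q →ₗ[R] N) :
    evalTensor R Q N (m ⊗ₜ[ℤ] h) = h m := rfl

lemma counitMap_mk (z : Q ⊗[ℤ] (Q →ₗ[R] N)) :
    counitMap R Q N (QuotientAddGroup.mk z) = evalTensor R Q N z := rfl

/-- For a static module the kernel of any epimorphism from a finite power of `Q` is generated by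
`Q`: a relation between generators can be moved into the tensor product, where it vanishes. -/
lemma IsStatic.isGeneratedBy_ker (hQ : IsQuasiProjective R Q) (hN : IsStatic R Q N) {n : ℕ}
    (p : (Fin n → Q) →ₗ[R] N) (hp : Function.Surjective p) :
    IsGeneratedBy Q (LinearMap.ker p) := by
  choose L hL using fun h => hQ N n p hp h
  let T := homTrace Q (LinearMap.ker p)
  have key : ∀ (a b : Q →ₗ[R] (Fin n → Q)), p ∘ₗ a = p ∘ₗ b → ∀ m,
      T.mkQ (a m) = T.mkQ (b m) := by
    intro a b hab m
    rw [← sub_eq_zero, ← map_sub, ← LinearMap.sub_apply, Submodule.mkQ_apply,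
      Submodule.Quotient.mk_eq_zero]
    refine apply_mem_homTrace _ (fun z => ?_) m
    have := LinearMap.congr_fun hab z
    simp only [LinearMap.comp_apply] at this
    simp [this]
  let F : Q →+ (Q →ₗ[R] N) →+ ((Fin n → Q) ⧸ T) :=
    AddMonoidHom.flip (AddMonoidHom.mk' (fun h => (T.mkQ ∘ₗ L h).toAddMonoidHom) (fun h h' => by
      ext m
      have := key (L (h + h')) (L h + L h') (by rw [LinearMap.comp_add, hL, hL, hL]) m
      simpa using this))
  let Φ : Q ⊗[ℤ] (Q →ₗ[R] N) →+ ((Fin n → Q) ⧸ T) :=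
    TensorProduct.liftAddHom F (fun r m h => by rw [map_zsmul, map_zsmul]; rfl)
  have hΦ : ∀ m h, Φ (m ⊗ₜ h) = T.mkQ (L h m) := fun m h => rfl
  have hbal : balancingRelations R Q N ≤ Φ.ker := by
    rw [balancingRelations, AddSubgroup.closure_le]
    rintro _ ⟨m, γ, h, rfl⟩
    have := key (L h ∘ₗ γ) (L (h ∘ₗ γ)) (by rw [← LinearMap.comp_assoc, hL, hL]) m
    simp only [SetLike.mem_coe, AddMonoidHom.mem_ker, map_sub, hΦ]
    rw [← this]; simp
  intro x hx
  let z : Q ⊗[ℤ] (Q →ₗ[R] N) := ∑ i, x i ⊗ₜ[ℤ] (p ∘ₗ LinearMap.single R (fun _ => Q) i)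
  have hz : evalTensor R Q N z = p x := by
    conv_rhs => rw [← Finset.univ_sum_single x]
    simp [z]
  have hz0 : (QuotientAddGroup.mk z : TensorHom R Q N) = 0 := by
    apply hN.1
    rw [counitMap_mk, hz, map_zero]
    exact hx
  rw [QuotientAddGroup.eq_zero_iff] at hz0
  have h1 : Φ z = 0 := hbal hz0
  have h2 : Φ z = T.mkQ x := by
    conv_rhs => rw [← Finset.univ_sum_single x]
    simp only [z, map_sum, hΦ]
    refine Finset.sum_congr rfl fun i _ => ?_
    exact key (L _) (LinearMap.single R (fun _ => Q) i) (hL _) (x i)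
  rw [h1] at h2
  exact (Submodule.Quotient.mk_eq_zero _).1 h2.symm

lemma IsStatic.isPresentedBy [Module.Finite R N] (hQ : IsQuasiProjective R Q)
    (hN : IsStatic R Q N) : IsPresentedBy (R := R) Q N := by
  have htop : IsGeneratedBy Q (⊤ : Submodule R N) := by
    intro x _
    obtain ⟨z, rfl⟩ := hN.2 x
    obtain ⟨z, rfl⟩ := QuotientAddGroup.mk_surjective z
    rw [counitMap_mk]
    induction z using TensorProduct.induction_on with
    | zero => simp
    | tmul m h => exact apply_mem_homTrace h (fun _ => Submodule.mem_top) m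
    | add a b ha hb => rw [map_add]; exact add_mem (ha trivial) (hb trivial)
  obtain ⟨n, p, hp⟩ := htop.exists_range_eq Module.Finite.fg_top
  have hp' := LinearMap.range_eq_top.1 hp
  exact ⟨n, p, hp', hN.isGeneratedBy_ker hQ p hp'⟩

lemma IsPresentedBy.isStatic (hQ : IsQuasiProjective R Q) (hN : IsPresentedBy (R := R) Q N) :
    IsStatic R Q N := by
  obtain ⟨n, p, hp, hK⟩ := hN
  let q : Fin n → (Q →ₗ[R] N) := fun i => p ∘ₗ LinearMap.single R (fun _ => Q) i
  let σ : (Fin n → Q) →+ TensorHom R Q N :=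
    { toFun := fun x => QuotientAddGroup.mk (∑ i, x i ⊗ₜ[ℤ] q i)
      map_zero' := by simp
      map_add' := fun x y => by
        rw [← QuotientAddGroup.mk_add, ← Finset.sum_add_distrib]
        simp [TensorProduct.add_tmul] }
  have hσ : ∀ x, σ x = QuotientAddGroup.mk (∑ i, x i ⊗ₜ[ℤ] q i) := fun _ => rfl
  have bal : ∀ (m : Q) (γ : Module.End R Q) (h : Q →ₗ[R] N),
      (QuotientAddGroup.mk (γ m ⊗ₜ[ℤ] h) : TensorHom R Q N) =
        QuotientAddGroup.mk (m ⊗ₜ[ℤ] (h ∘ₗ γ)) := by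
    intro m γ h
    rw [← sub_eq_zero, ← QuotientAddGroup.mk_sub, QuotientAddGroup.eq_zero_iff]
    exact AddSubgroup.subset_closure ⟨m, γ, h, rfl⟩
  have hσu : ∀ (u : Q →ₗ[R] (Fin n → Q)) (y : Q),
      σ (u y) = QuotientAddGroup.mk (y ⊗ₜ[ℤ] (p ∘ₗ u)) := by
    intro u y
    have hu : p ∘ₗ u = ∑ i, q i ∘ₗ (LinearMap.proj i ∘ₗ u) := by
      ext y
      simp only [LinearMap.comp_apply, LinearMap.sum_apply, q, LinearMap.proj_apply]
      rw [← map_sum]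
      exact congrArg p (Finset.univ_sum_single (u y)).symm
    rw [hσ, hu, TensorProduct.tmul_sum, QuotientAddGroup.mk_sum, QuotientAddGroup.mk_sum]
    refine Finset.sum_congr rfl fun i _ => ?_
    exact bal y (LinearMap.proj i ∘ₗ u) (q i)
  have hσsurj : Function.Surjective σ := by
    intro z
    obtain ⟨z, rfl⟩ := QuotientAddGroup.mk_surjective z
    induction z using TensorProduct.induction_on with
    | zero => exact ⟨0, by simp⟩
    | tmul m h =>
      obtain ⟨u, hu⟩ := hQ N n p hp h
      exact ⟨u m, by rw [hσu, hu]⟩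
    | add a b ha hb =>
      obtain ⟨x, hx⟩ := ha
      obtain ⟨y, hy⟩ := hb
      exact ⟨x + y, by rw [map_add, hx, hy, QuotientAddGroup.mk_add]⟩
  have hev : ∀ x, counitMap R Q N (σ x) = p x := by
    intro x
    rw [hσ, counitMap_mk]
    conv_rhs => rw [← Finset.univ_sum_single x]
    simp [q]
  constructor
  · rw [injective_iff_map_eq_zero]
    intro z hz
    obtain ⟨x, rfl⟩ := hσsurj z
    rw [hev] at hz
    refine homTrace_induction (hK hz) (p := fun x => σ x = 0) ?_ (map_zero _) ?_
    · intro u y hu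
      have : p ∘ₗ u = 0 := by ext z; exact hu z
      rw [hσu, this, TensorProduct.tmul_zero, QuotientAddGroup.mk_zero]
    · intro x y hx hy
      rw [map_add, hx, hy, add_zero]
  · intro x
    obtain ⟨y, rfl⟩ := hp x
    exact ⟨σ y, hev y⟩

lemma isStatic_iff_isPresentedBy [Module.Finite R N] (hQ : IsQuasiProjective R Q) :
    IsStatic R Q N ↔ IsPresentedBy (R := R) Q N :=
  ⟨fun h => h.isPresentedBy hQ, fun h => h.isStatic hQ⟩

/-- If `N` is presented by the quasi-projective module `Q`, the kernel of any epimorphism from a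
finite power of `Q` to `N` is generated by `Q`. -/
lemma IsPresentedBy.isGeneratedBy_ker (hQ : IsQuasiProjective R Q)
    (hN : IsPresentedBy (R := R) Q N) {n : ℕ} (p : (Fin n → Q) →ₗ[R] N)
    (hp : Function.Surjective p) : IsGeneratedBy Q (LinearMap.ker p) :=
  (hN.isStatic hQ).isGeneratedBy_ker hQ p hp

lemma IsPresentedBy.isGeneratedBy_ker_one (hQ : IsQuasiProjective R Q)
    (hN : IsPresentedBy (R := R) Q N) (p : Q →ₗ[R] N)
    (hp : Function.Surjective p) : IsGeneratedBy Q (LinearMap.ker p) := by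
  have h := hN.isGeneratedBy_ker hQ (p ∘ₗ LinearMap.proj (R := R) (φ := fun _ : Fin 1 => Q) 0)
    (hp.comp fun x => ⟨fun _ => x, rfl⟩)
  have h2 := h.map (LinearMap.proj (R := R) (φ := fun _ : Fin 1 => Q) 0)
  rwa [LinearMap.ker_comp, Submodule.map_comap_eq_of_surjective] at h2
  exact fun x => ⟨fun _ => x, rfl⟩

end StaticPresented

/-! ### The functor `Hom(Q, -)` on modules presented by `Q` -/

section HomModule

variable (R : Type u) [Ring R] (Q N N' : Type u) [AddCommGroup Q] [Module R Q]
  [AddCommGroup N] [Module R N] [AddCommGroup N'] [Module R N']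

/-- `Hom(Q, N)`, regarded as a left module over `Γ(Q) = End(Q)ᵒᵖ`. -/
abbrev HomModule : Type u := Q →ₗ[R] N

/-- `Γ(Q)` acts on `Hom(Q, N)` by precomposition. -/
instance homModuleModule : Module (GammaRing R Q) (Q →ₗ[R] N) where
  smul γ h := h ∘ₗ γ.unop
  one_smul h := LinearMap.comp_id h
  mul_smul _ _ _ := rfl
  smul_zero _ := LinearMap.zero_comp _
  smul_add _ _ _ := LinearMap.add_comp _ _ _
  add_smul _ _ _ := LinearMap.comp_add _ _ _
  zero_smul h := LinearMap.comp_zero h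

variable {R Q N N'}

/-- Postcomposition with `f`, as a `Γ(Q)`-linear map. -/
def HomModule.map (f : N →ₗ[R] N') : HomModule R Q N →ₗ[GammaRing R Q] HomModule R Q N' where
  toFun h := f ∘ₗ (h : Q →ₗ[R] N)
  map_add' _ _ := LinearMap.comp_add _ _ _
  map_smul' _ _ := (LinearMap.comp_assoc _ _ _).symm

lemma HomModule.map_apply (f : N →ₗ[R] N') (h : Q →ₗ[R] N) :
    HomModule.map f (h : HomModule R Q N) = (f ∘ₗ h : Q →ₗ[R] N') := rfl

/-- The map `(h i) ↦ ∑ h i ∘ γ i` in coordinates. -/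
lemma HomModule.sum_smul_eq {n : ℕ} (c : Fin n → GammaRing R Q) (q : Fin n → HomModule R Q N) :
    ∑ i, c i • q i = ((LinearMap.lsum R (fun _ : Fin n => Q) ℕ (fun i => (q i : Q →ₗ[R] N))) ∘ₗ
      LinearMap.pi (fun i => ((c i).unop : Q →ₗ[R] Q)) : Q →ₗ[R] N) := by
  have : (LinearMap.lsum R (fun _ : Fin n => Q) ℕ (fun i => (q i : Q →ₗ[R] N))) ∘ₗ
      LinearMap.pi (fun i => ((c i).unop : Q →ₗ[R] Q)) =
      ∑ i, (q i : Q →ₗ[R] N) ∘ₗ ((c i).unop : Q →ₗ[R] Q) := by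
    ext x
    simp [LinearMap.lsum_apply]
  rw [this]
  rfl

lemma lsum_comp_single {n : ℕ} (p : (Fin n → Q) →ₗ[R] N) :
    LinearMap.lsum R (fun _ : Fin n => Q) ℕ
      (fun i => p ∘ₗ LinearMap.single R (fun _ => Q) i) = p := by
  ext i x : 2
  simp only [LinearMap.comp_apply, LinearMap.lsum_apply, LinearMap.sum_apply,
    LinearMap.proj_apply]
  rw [← map_sum]
  congr 1
  exact Finset.univ_sum_single _

lemma HomModule.finite (hQ : IsQuasiProjective R Q) {n : ℕ} (p : (Fin n → Q) →ₗ[R] N)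
    (hp : Function.Surjective p) : Module.Finite (GammaRing R Q) (HomModule R Q N) := by
  refine ⟨Submodule.fg_iff_exists_fin_generating_family.2
    ⟨n, fun i => p ∘ₗ LinearMap.single R (fun _ => Q) i, ?_⟩⟩
  rw [eq_top_iff]
  intro g _
  obtain ⟨h, hh⟩ := hQ N n p hp g
  rw [Submodule.mem_span_range_iff_exists_fun]
  refine ⟨fun i => MulOpposite.op (LinearMap.proj i ∘ₗ h), ?_⟩
  rw [HomModule.sum_smul_eq, lsum_comp_single]
  exact hh

/-- A `Γ(Q)`-submodule `V` of `Hom(Q, N)` is determined by the sum of the images of its elements: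
it contains every map into that sum. -/
lemma HomModule.mem_of_range_le (hQ : IsQuasiProjective R Q)
    (V : Submodule (GammaRing R Q) (HomModule R Q N)) (hV : V.FG) (g : Q →ₗ[R] N)
    (hg : LinearMap.range g ≤ ⨆ v : V, LinearMap.range (v.1 : Q →ₗ[R] N)) :
    (g : HomModule R Q N) ∈ V := by
  obtain ⟨n, q, rfl⟩ := Submodule.fg_iff_exists_fin_generating_family.1 hV
  obtain ⟨h, hh⟩ := hQ.lift_range
    (LinearMap.lsum R (fun _ : Fin n => Q) ℕ (fun i => (q i : Q →ₗ[R] N))) g (by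
      intro x
      have h1 := hg ⟨x, rfl⟩
      refine (iSup_le ?_ : (⨆ v : Submodule.span (GammaRing R Q) (Set.range q),
        LinearMap.range (v.1 : Q →ₗ[R] N)) ≤ _) h1
      rintro ⟨v, hv⟩
      obtain ⟨c, hc⟩ := (Submodule.mem_span_range_iff_exists_fun _).1 hv
      change LinearMap.range v ≤ _
      rw [← hc, HomModule.sum_smul_eq]
      exact LinearMap.range_comp_le_range _ _)
  rw [Submodule.mem_span_range_iff_exists_fun]
  refine ⟨fun i => MulOpposite.op (LinearMap.proj i ∘ₗ h), ?_⟩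
  rw [HomModule.sum_smul_eq]
  exact hh

/-- `Hom(Q, -)` is faithful on modules generated by `Q`. -/
lemma HomModule.map_injective (htop : IsGeneratedBy Q (⊤ : Submodule R N)) {f g : N →ₗ[R] N'}
    (h : (HomModule.map f : HomModule R Q N →ₗ[GammaRing R Q] HomModule R Q N') =
      HomModule.map g) : f = g := by
  ext x
  refine homTrace_induction (htop (Submodule.mem_top : x ∈ ⊤)) (p := fun x => f x = g x)
    (fun a y _ => ?_) (by simp) (fun x y hx hy => by simp [hx, hy])
  have := LinearMap.congr_fun h (a : HomModule R Q N)
  exact LinearMap.congr_fun (show (f ∘ₗ a : Q →ₗ[R] N') = g ∘ₗ a from this) y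

/-- `Hom(Q, -)` is full on modules presented by `Q`. -/
lemma HomModule.map_surjective (hQ : IsQuasiProjective R Q) (hN : IsPresentedBy (R := R) Q N)
    (φ : HomModule R Q N →ₗ[GammaRing R Q] HomModule R Q N') :
    ∃ f : N →ₗ[R] N', HomModule.map f = φ := by
  obtain ⟨n, p, hp, hK⟩ := hN
  let q : Fin n → HomModule R Q N := fun i => p ∘ₗ LinearMap.single R (fun _ => Q) i
  let p' : (Fin n → Q) →ₗ[R] N' :=
    LinearMap.lsum R (fun _ : Fin n => Q) ℕ (fun i => (φ (q i) : Q →ₗ[R] N'))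
  have key : ∀ u : Q →ₗ[R] (Fin n → Q),
      (φ (p ∘ₗ u : Q →ₗ[R] N) : Q →ₗ[R] N') = p' ∘ₗ u := by
    intro u
    have h1 : (p ∘ₗ u : Q →ₗ[R] N) =
        (∑ i, (MulOpposite.op (LinearMap.proj i ∘ₗ u) : GammaRing R Q) • q i :
          HomModule R Q N) := by
      rw [HomModule.sum_smul_eq, lsum_comp_single]
      rfl
    rw [h1, map_sum]
    simp only [map_smul]
    rw [HomModule.sum_smul_eq]
    rfl
  have hker : LinearMap.ker p ≤ LinearMap.ker p' := by
    intro x hx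
    refine homTrace_induction (hK hx) (p := fun x => p' x = 0) (fun u y hu => ?_)
      (by simp) (fun x y hx hy => by rw [map_add, hx, hy, add_zero])
    have h0 : p ∘ₗ u = 0 := by ext z; exact hu z
    have := key u
    rw [h0] at this
    have h2 : (φ ((0 : Q →ₗ[R] N) : HomModule R Q N)) = 0 := map_zero φ
    rw [h2] at this
    exact (LinearMap.congr_fun this y).symm
  let e := p.quotKerEquivOfSurjective hp
  let f : N →ₗ[R] N' := (LinearMap.ker p).liftQ p' hker ∘ₗ e.symm.toLinearMap
  have hf : f ∘ₗ p = p' := by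
    ext1 i
    ext x
    simp only [f, e, LinearMap.comp_apply, LinearEquiv.coe_coe]
    have : (p.quotKerEquivOfSurjective hp).symm (p ((LinearMap.single R (fun _ => Q) i) x)) =
        Submodule.Quotient.mk ((LinearMap.single R (fun _ => Q) i) x) := by
      rw [LinearEquiv.symm_apply_eq]; rfl
    rw [this]
    rfl
  refine ⟨f, ?_⟩
  ext g
  obtain ⟨u, rfl⟩ := hQ N n p hp g
  rw [key u, HomModule.map_apply, ← LinearMap.comp_assoc, hf]

lemma IsPresentedBy.isGeneratedBy_top (hN : IsPresentedBy (R := R) Q N) :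
    IsGeneratedBy Q (⊤ : Submodule R N) := by
  obtain ⟨n, p, hp, -⟩ := hN
  rw [← LinearMap.range_eq_top.2 hp]
  exact isGeneratedBy_range p

/-- Every finitely generated `Γ(Q)`-module is `Hom(Q, N)` for a module `N` presented by `Q`,
namely for the cokernel of the map between powers of `Q` given by the matrix of a presentation. -/
lemma HomModule.exists_equiv [IsNoetherianRing (GammaRing R Q)] (hQ : IsQuasiProjective R Q)
    (X : Type u) [AddCommGroup X] [Module (GammaRing R Q) X] [Module.Finite (GammaRing R Q) X] :
    ∃ (m : ℕ) (K : Submodule R (Fin m → Q)), IsGeneratedBy Q K ∧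
      Nonempty (X ≃ₗ[GammaRing R Q] HomModule R Q ((Fin m → Q) ⧸ K)) := by
  obtain ⟨m, π, hπ⟩ := Module.Finite.exists_fin' (GammaRing R Q) X
  obtain ⟨l, a, ha⟩ := Submodule.fg_iff_exists_fin_generating_family.1
    (IsNoetherian.noetherian (LinearMap.ker π))
  let A : Fin l → (Q →ₗ[R] (Fin m → Q)) :=
    fun j => LinearMap.pi fun i => ((a j i).unop : Q →ₗ[R] Q)
  let T : (Fin l → Q) →ₗ[R] (Fin m → Q) := LinearMap.lsum R (fun _ : Fin l => Q) ℕ A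
  let K := LinearMap.range T
  let θ : (Fin m → GammaRing R Q) →ₗ[GammaRing R Q] HomModule R Q ((Fin m → Q) ⧸ K) :=
    { toFun := fun γ => K.mkQ ∘ₗ LinearMap.pi fun i => ((γ i).unop : Q →ₗ[R] Q)
      map_add' := fun γ δ => by
        rw [← LinearMap.comp_add]; rfl
      map_smul' := fun γ δ => rfl }
  have hθ : ∀ γ, (θ γ : Q →ₗ[R] ((Fin m → Q) ⧸ K)) =
    K.mkQ ∘ₗ LinearMap.pi fun i => ((γ i).unop : Q →ₗ[R] Q) := fun _ => rfl
  have hθs : Function.Surjective θ := by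
    intro g
    obtain ⟨h, hh⟩ := hQ _ m K.mkQ K.mkQ_surjective g
    refine ⟨fun i => MulOpposite.op (LinearMap.proj i ∘ₗ h), ?_⟩
    rw [← hh]
    rfl
  have hcomb : ∀ c : Fin l → GammaRing R Q, (LinearMap.pi fun i => (((∑ j, c j • a j) i).unop :
      Q →ₗ[R] Q)) = T ∘ₗ LinearMap.pi (fun j => ((c j).unop : Q →ₗ[R] Q)) := by
    intro c
    ext x i
    simp [T, A, LinearMap.lsum_apply, Finset.sum_apply, Finset.unop_sum]
  have hker : LinearMap.ker θ = LinearMap.ker π := by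
    rw [← ha]
    ext γ
    rw [Submodule.mem_span_range_iff_exists_fun, LinearMap.mem_ker]
    constructor
    · intro h
      obtain ⟨b, hb⟩ := hQ.lift_range T (LinearMap.pi fun i => ((γ i).unop : Q →ₗ[R] Q)) (by
        intro x
        have := LinearMap.congr_fun (show (K.mkQ ∘ₗ LinearMap.pi fun i =>
          ((γ i).unop : Q →ₗ[R] Q)) = 0 from h) x
        exact (Submodule.Quotient.mk_eq_zero K).1 this)
      refine ⟨fun j => MulOpposite.op (LinearMap.proj j ∘ₗ b), ?_⟩
      have h1 := hcomb (fun j => MulOpposite.op (LinearMap.proj j ∘ₗ b))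
      have h2 : (LinearMap.pi fun j => ((MulOpposite.op (LinearMap.proj j ∘ₗ b) :
          GammaRing R Q).unop : Q →ₗ[R] Q)) = b := rfl
      rw [h2, hb] at h1
      funext i
      apply MulOpposite.unop_injective
      ext x
      exact congrFun (LinearMap.congr_fun h1 x) i
    · rintro ⟨c, rfl⟩
      have : (θ (∑ j, c j • a j) : Q →ₗ[R] ((Fin m → Q) ⧸ K)) = 0 := by
        rw [hθ, hcomb, ← LinearMap.comp_assoc]
        have : K.mkQ ∘ₗ T = 0 := by
          ext1 i
          ext x
          exact (Submodule.Quotient.mk_eq_zero K).2 ⟨_, rfl⟩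
        rw [this]; rfl
      exact this
  refine ⟨m, K, isGeneratedBy_range T, ⟨?_⟩⟩
  exact (π.quotKerEquivOfSurjective hπ).symm ≪≫ₗ
    (Submodule.quotEquivOfEq _ _ hker.symm) ≪≫ₗ θ.quotKerEquivOfSurjective hθs

/-- `Hom(Q, N)` is uniserial if `N` is. -/
lemma HomModule.total [IsNoetherianRing (GammaRing R Q)] (hQ : IsQuasiProjective R Q)
    [Module.Finite (GammaRing R Q) (HomModule R Q N)]
    (hN : ∀ A B : Submodule R N, A ≤ B ∨ B ≤ A)
    (V W : Submodule (GammaRing R Q) (HomModule R Q N)) : V ≤ W ∨ W ≤ V := by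
  refine (hN (⨆ v : V, LinearMap.range (v.1 : Q →ₗ[R] N))
    (⨆ v : W, LinearMap.range (v.1 : Q →ₗ[R] N))).imp (fun h g hg => ?_) (fun h g hg => ?_)
  · exact HomModule.mem_of_range_le hQ W (IsNoetherian.noetherian _) g
      ((le_iSup (fun v : V => LinearMap.range (v.1 : Q →ₗ[R] N)) ⟨g, hg⟩).trans h)
  · exact HomModule.mem_of_range_le hQ V (IsNoetherian.noetherian _) g
      ((le_iSup (fun v : W => LinearMap.range (v.1 : Q →ₗ[R] N)) ⟨g, hg⟩).trans h)

end HomModule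

section HomFunctor

variable {k : Type w} [Field k] {R : Type u} [Ring R] [Algebra k R] {Q : Type u} [AddCommGroup Q]
  [Module k Q] [Module R Q] [IsScalarTower k R Q]

lemma finite_gammaRing [Module.Finite k R] [Module.Finite R Q] :
    Module.Finite k (GammaRing R Q) := by
  have : Module.Finite k Q := Module.Finite.trans R Q
  let f : (Module.End R Q) →ₗ[k] (Q →ₗ[k] Q) :=
    { toFun := fun g => g.restrictScalars k
      map_add' := fun _ _ => rfl
      map_smul' := fun _ _ => rfl }
  have : Module.Finite k (Module.End R Q) := Module.Finite.of_injective f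
    (LinearMap.restrictScalars_injective k)
  exact Module.Finite.equiv (MulOpposite.opLinearEquiv k)

variable (P : ObjectProperty (FGModuleCat.{u} R))

/-- The functor `Hom(Q, -)` from a subcategory of modules presented by `Q` to `mod Γ(Q)`. -/
def homFunctor (hQ : IsQuasiProjective R Q) (hP : ∀ N, P N → IsPresentedBy (R := R) Q N) :
    P.FullSubcategory ⥤ FGModuleCat.{u} (GammaRing R Q) where
  obj X :=
    haveI : Module.Finite (GammaRing R Q) (HomModule R Q X.obj) := by
      obtain ⟨n, p, hp, -⟩ := hP X.obj X.property
      exact HomModule.finite hQ p hp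
    FGModuleCat.of _ (HomModule R Q X.obj)
  map f := ⟨ModuleCat.ofHom (HomModule.map f.hom.hom.hom)⟩

variable {P} (hQ : IsQuasiProjective R Q) (hP : ∀ N, P N → IsPresentedBy (R := R) Q N)

instance : (homFunctor P hQ hP).Additive where
  map_add {X Y f g} := by
    apply FGModuleCat.hom_ext
    ext h
    exact LinearMap.add_comp _ _ _

instance : (homFunctor P hQ hP).Linear k where
  map_smul {X Y} f c := by
    apply FGModuleCat.hom_ext
    refine LinearMap.ext fun (h : Q →ₗ[R] X.obj) => LinearMap.ext fun q => ?_
    change algebraMap k R c • f.hom.hom.hom (h q) = f.hom.hom.hom (h (c • q))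
    rw [← map_smul, ← map_smul, algebraMap_smul]

instance : (homFunctor P hQ hP).Faithful where
  map_injective {X Y f g} hfg := by
    have h1 : (HomModule.map f.hom.hom.hom : HomModule R Q X.obj →ₗ[GammaRing R Q]
        HomModule R Q Y.obj) = HomModule.map g.hom.hom.hom :=
      congrArg (fun z => z.hom.hom) hfg
    have h2 := HomModule.map_injective (hP _ X.property).isGeneratedBy_top h1
    apply ObjectProperty.hom_ext
    exact FGModuleCat.hom_ext h2

instance : (homFunctor P hQ hP).Full where
  map_surjective {X Y} φ := by
    obtain ⟨f, hf⟩ := HomModule.map_surjective hQ (hP _ X.property) φ.hom.hom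
    exact ⟨⟨⟨ModuleCat.ofHom f⟩⟩, FGModuleCat.hom_ext hf⟩

lemma homFunctor_essSurj [IsNoetherianRing (GammaRing R Q)] [Module.Finite R Q]
    (hP' : ∀ N : FGModuleCat.{u} R, IsPresentedBy (R := R) Q N → P N) :
    (homFunctor P hQ hP).EssSurj where
  mem_essImage X := by
    obtain ⟨m, K, hK, ⟨e⟩⟩ := HomModule.exists_equiv hQ X
    let N : FGModuleCat.{u} R := FGModuleCat.of R ((Fin m → Q) ⧸ K)
    have hN : IsPresentedBy (R := R) Q N :=
      isPresentedBy_of_surjective K.mkQ K.mkQ_surjective (by rwa [Submodule.ker_mkQ])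
    have : Module.Finite (GammaRing R Q) (HomModule R Q ((Fin m → Q) ⧸ K)) :=
      Module.Finite.equiv e
    exact ⟨⟨N, hP' N hN⟩, ⟨e.symm.toFGModuleCatIso⟩⟩

lemma homFunctor_isEquivalence [IsNoetherianRing (GammaRing R Q)] [Module.Finite R Q]
    (hP' : ∀ N : FGModuleCat.{u} R, IsPresentedBy (R := R) Q N → P N) :
    (homFunctor P hQ hP).IsEquivalence :=
  { essSurj := homFunctor_essSurj hQ hP hP' }

end HomFunctor

/-! ### Uniserial modules -/

section Uniserial

variable {R : Type u} [Ring R] {N N' : Type u} [AddCommGroup N] [Module R N]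
  [AddCommGroup N'] [Module R N']

variable (R N) in
/-- The submodules of `N` form a chain. -/
def IsUniserial : Prop := ∀ A B : Submodule R N, A ≤ B ∨ B ≤ A

variable (R) in
/-- Every indecomposable finitely generated `R`-module is uniserial. -/
def IndecomposablesUniserial : Prop :=
  ∀ (N : Type u) [AddCommGroup N] [Module R N] [Module.Finite R N],
    IsIndecomposableModule R N → IsUniserial R N

lemma IsUniserial.of_injective (h : IsUniserial R N') (f : N →ₗ[R] N')
    (hf : Function.Injective f) : IsUniserial R N := fun A B =>
  (h (A.map f) (B.map f)).imp (Submodule.map_le_map_iff_of_injective hf _ _).1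
    (Submodule.map_le_map_iff_of_injective hf _ _).1

lemma IsUniserial.of_surjective (h : IsUniserial R N) (f : N →ₗ[R] N')
    (hf : Function.Surjective f) : IsUniserial R N' := fun A B =>
  (h (A.comap f) (B.comap f)).imp (Submodule.comap_le_comap_iff_of_surjective hf).1
    (Submodule.comap_le_comap_iff_of_surjective hf).1

lemma IsUniserial.submodule (h : IsUniserial R N) (A : Submodule R N) : IsUniserial R A :=
  h.of_injective A.subtype A.subtype_injective

lemma IsUniserial.quotient (h : IsUniserial R N) (A : Submodule R N) : IsUniserial R (N ⧸ A) :=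
  h.of_surjective A.mkQ A.mkQ_surjective

lemma IsUniserial.eq_top_or_eq_top (h : IsUniserial R N) {A B : Submodule R N}
    (hAB : A ⊔ B = ⊤) : A = ⊤ ∨ B = ⊤ := by
  rcases h A B with h | h
  · right; rwa [sup_eq_right.2 h] at hAB
  · left; rwa [sup_eq_left.2 h] at hAB

lemma IsUniserial.eq_bot_or_eq_bot (h : IsUniserial R N) {A B : Submodule R N}
    (hAB : A ⊓ B = ⊥) : A = ⊥ ∨ B = ⊥ := by
  rcases h A B with h | h
  · left; rwa [inf_eq_left.2 h] at hAB
  · right; rwa [inf_eq_right.2 h] at hAB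

lemma IsUniserial.isIndecomposableModule [Nontrivial N] (h : IsUniserial R N) :
    IsIndecomposableModule R N :=
  ⟨inferInstance, fun _ _ hUV => h.eq_bot_or_eq_bot hUV.inf_eq_bot⟩

/-- In a uniserial module the kernel of a map onto a simple module is the largest proper
submodule. -/
lemma IsUniserial.eq_top_of_not_le_ker (h : IsUniserial R N) [IsSimpleModule R N']
    {p : N →ₗ[R] N'} (hp : Function.Surjective p) {A : Submodule R N}
    (hA : ¬ A ≤ LinearMap.ker p) : A = ⊤ := by
  have hc := LinearMap.isCoatom_ker_of_surjective hp
  exact hc.2 _ (lt_of_le_not_ge ((h _ _).resolve_left hA) hA)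

/-- In a uniserial module the image of a simple module is the smallest nonzero submodule. -/
lemma IsUniserial.range_le_of_ne_bot (h : IsUniserial R N') [IsSimpleModule R N]
    (j : N →ₗ[R] N') {A : Submodule R N'} (hA : A ≠ ⊥) : LinearMap.range j ≤ A := by
  rcases h (LinearMap.range j) A with h1 | h1
  · exact h1
  · by_cases h2 : A.comap j = ⊤
    · rintro _ ⟨x, rfl⟩
      have : x ∈ A.comap j := h2 ▸ Submodule.mem_top
      exact this
    · exfalso
      have h3 := (eq_bot_or_eq_top (A.comap j)).resolve_right h2
      apply hA
      rw [eq_bot_iff]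
      intro y hy
      obtain ⟨x, rfl⟩ := h1 hy
      have : x ∈ A.comap j := hy
      rw [h3, Submodule.mem_bot] at this
      simp [this]

lemma exists_comp_eq_of_ker_le {Z T : Type u} [AddCommGroup Z] [Module R Z] [AddCommGroup T]
    [Module R T] (h : N →ₗ[R] Z) (hh : Function.Surjective h) (g : N →ₗ[R] T)
    (hk : LinearMap.ker h ≤ LinearMap.ker g) : ∃ f : Z →ₗ[R] T, f ∘ₗ h = g := by
  refine ⟨(LinearMap.ker h).liftQ g hk ∘ₗ (h.quotKerEquivOfSurjective hh).symm.toLinearMap, ?_⟩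
  ext x
  have : (h.quotKerEquivOfSurjective hh).symm (h x) = Submodule.Quotient.mk x := by
    rw [LinearEquiv.symm_apply_eq]; rfl
  simp [this]

lemma exists_comp_eq_of_range_le {Z T : Type u} [AddCommGroup Z] [Module R Z] [AddCommGroup T]
    [Module R T] (h : Z →ₗ[R] N) (hh : Function.Injective h) (g : T →ₗ[R] N)
    (hk : LinearMap.range g ≤ LinearMap.range h) : ∃ f : T →ₗ[R] Z, h ∘ₗ f = g := by
  refine ⟨(LinearEquiv.ofInjective h hh).symm.toLinearMap ∘ₗ g.codRestrict _
    (fun x => hk ⟨x, rfl⟩), ?_⟩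
  ext x
  have := congrArg Subtype.val ((LinearEquiv.ofInjective h hh).apply_symm_apply
    (g.codRestrict _ (fun x => hk ⟨x, rfl⟩) x))
  simp only [LinearMap.comp_apply, LinearEquiv.coe_coe]
  exact this

/-- A submodule minimal among those mapping onto a uniserial module is indecomposable. -/
lemma exists_indecomposable_map_eq_top [IsArtinian R N] [Nontrivial N'] (hN' : IsUniserial R N')
    (p : N →ₗ[R] N') (hp : Function.Surjective p) :
    ∃ U : Submodule R N, U.map p = ⊤ ∧ IsIndecomposableModule R U := by
  obtain ⟨U, hU, hmin⟩ := wellFounded_lt.has_min {U : Submodule R N | U.map p = ⊤}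
    ⟨⊤, by simp [LinearMap.range_eq_top, hp]⟩
  refine ⟨U, hU, ?_, ?_⟩
  · rw [Submodule.nontrivial_iff_ne_bot]
    rintro rfl
    have h0 : Submodule.map p ⊥ = ⊤ := hU
    rw [Submodule.map_bot] at h0
    exact bot_ne_top h0
  · intro A B hAB
    have hsup : (A.map U.subtype).map p ⊔ (B.map U.subtype).map p = ⊤ := by
      rw [← Submodule.map_sup, ← Submodule.map_sup, hAB.sup_eq_top, Submodule.map_subtype_top]
      exact hU
    have key : ∀ C : Submodule R U, (C.map U.subtype).map p = ⊤ → C = ⊤ := by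
      intro C hC
      have h1 := eq_of_le_of_not_lt (Submodule.map_subtype_le U C) (hmin _ hC)
      rw [eq_top_iff]
      rintro ⟨x, hx⟩ -
      rw [← h1] at hx
      obtain ⟨y, hy, hyx⟩ := hx
      rwa [show (⟨x, hx⟩ : U) = y from Subtype.ext hyx.symm]
    rcases hN'.eq_top_or_eq_top hsup with h | h
    · right
      have := hAB.inf_eq_bot
      rwa [key A h, top_inf_eq] at this
    · left
      have := hAB.inf_eq_bot
      rwa [key B h, inf_top_eq] at this

/-- If `K` is maximal among the submodules meeting a uniserial submodule trivially, the quotient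
by `K` is indecomposable. -/
lemma exists_indecomposable_quotient [IsNoetherian R N'] [Nontrivial N] (hN : IsUniserial R N)
    (i : N →ₗ[R] N') (hi : Function.Injective i) :
    ∃ K : Submodule R N', Function.Injective (K.mkQ ∘ₗ i) ∧
      IsIndecomposableModule R (N' ⧸ K) := by
  obtain ⟨K, hK, hmax⟩ := wellFounded_gt.has_min {K : Submodule R N' | K.comap i = ⊥}
    ⟨⊥, by simp [LinearMap.ker_eq_bot, hi]⟩
  have hK' : K.comap i = ⊥ := hK
  have hinj : Function.Injective (K.mkQ ∘ₗ i) := by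
    rw [← LinearMap.ker_eq_bot, LinearMap.ker_comp, Submodule.ker_mkQ, hK']
  refine ⟨K, hinj, hinj.nontrivial, ?_⟩
  intro A B hAB
  have h1 : (A.comap K.mkQ).comap i ⊓ (B.comap K.mkQ).comap i = ⊥ := by
    rw [← Submodule.comap_inf, ← Submodule.comap_inf, hAB.inf_eq_bot, Submodule.comap_bot,
      Submodule.ker_mkQ, hK']
  have key : ∀ C : Submodule R (N' ⧸ K), (C.comap K.mkQ).comap i = ⊥ → C = ⊥ := by
    intro C hC
    have h2 : K ≤ C.comap K.mkQ := by
      intro x hx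
      have : K.mkQ x = 0 := (Submodule.Quotient.mk_eq_zero K).2 hx
      simp [this]
    have h3 := eq_of_le_of_not_lt h2 (hmax _ hC)
    rw [eq_bot_iff]
    intro x hx
    obtain ⟨y, rfl⟩ := K.mkQ_surjective x
    have : y ∈ K := by rw [h3]; exact hx
    simpa using this
  exact (hN.eq_bot_or_eq_bot h1).imp (key A) (key B)

lemma exists_comp_eq_of_common_cover {U S : Type u} [AddCommGroup U] [Module R U] [AddCommGroup S]
    [Module R S] (hU : IsUniserial R U) (a : U →ₗ[R] N) (ha : Function.Surjective a)
    (b : U →ₗ[R] N') (hb : Function.Surjective b) (p : N →ₗ[R] S) (p' : N' →ₗ[R] S)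
    (hp : p ∘ₗ a = p' ∘ₗ b) :
    (∃ f : N →ₗ[R] N', p' ∘ₗ f = p) ∨ (∃ f : N' →ₗ[R] N, p ∘ₗ f = p') := by
  rcases hU (LinearMap.ker a) (LinearMap.ker b) with h | h
  · left
    obtain ⟨f, hf⟩ := exists_comp_eq_of_ker_le a ha b h
    refine ⟨f, ?_⟩
    rw [← LinearMap.cancel_right ha, LinearMap.comp_assoc, hf, hp]
  · right
    obtain ⟨f, hf⟩ := exists_comp_eq_of_ker_le b hb a h
    refine ⟨f, ?_⟩
    rw [← LinearMap.cancel_right hb, LinearMap.comp_assoc, hf, hp]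

/-- The simple module `B` follows `A`: some uniserial module of length two has top `A` and
socle `B`. -/
def Follows (R : Type u) [Ring R] (A B : Type u) [AddCommGroup A] [Module R A] [AddCommGroup B]
    [Module R B] : Prop :=
  ∃ (U : Type u) (_ : AddCommGroup U) (_ : Module R U) (i : B →ₗ[R] U) (p : U →ₗ[R] A),
    Module.Finite R U ∧ IsUniserial R U ∧ Function.Injective i ∧ Function.Surjective p ∧
      LinearMap.range i = LinearMap.ker p

variable {A A' B B' : Type u} [AddCommGroup A] [Module R A] [AddCommGroup A'] [Module R A']
  [AddCommGroup B] [Module R B] [AddCommGroup B'] [Module R B']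

lemma Follows.congr (h : Follows R A B) (e : A ≃ₗ[R] A') (e' : B ≃ₗ[R] B') : Follows R A' B' := by
  obtain ⟨U, _, _, i, p, hfin, hU, hi, hp, hip⟩ := h
  refine ⟨U, _, _, i ∘ₗ e'.symm.toLinearMap, e.toLinearMap ∘ₗ p, hfin, hU,
    hi.comp e'.symm.injective, e.surjective.comp hp, ?_⟩
  rw [LinearMap.ker_comp, LinearEquiv.ker, ← LinearMap.ker, ← hip, LinearMap.range_comp,
    LinearEquiv.range, ← LinearMap.range_eq_map]

variable [IsArtinianRing R]

/-- Uniserial modules with the same simple top are comparable: one maps to the other over the top.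
The comparison is made inside an indecomposable submodule of the fibre product. -/
lemma IndecomposablesUniserial.exists_map_over_top (hR : IndecomposablesUniserial R)
    [Module.Finite R N] [Module.Finite R N'] (hN : IsUniserial R N) (hN' : IsUniserial R N')
    {S : Type u} [AddCommGroup S] [Module R S] [IsSimpleModule R S]
    (p : N →ₗ[R] S) (hp : Function.Surjective p) (p' : N' →ₗ[R] S)
    (hp' : Function.Surjective p') :
    (∃ f : N →ₗ[R] N', p' ∘ₗ f = p) ∨ (∃ f : N' →ₗ[R] N, p ∘ₗ f = p') := by
  have : Nontrivial S := IsSimpleModule.nontrivial R S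
  have : Nontrivial N := hp.nontrivial
  let L : Submodule R (N × N') :=
    LinearMap.ker (p ∘ₗ LinearMap.fst R N N' - p' ∘ₗ LinearMap.snd R N N')
  have hL : ∀ x : L, p x.1.1 = p' x.1.2 := fun x => sub_eq_zero.1 x.2
  let a : L →ₗ[R] N := LinearMap.fst R N N' ∘ₗ L.subtype
  let b : L →ₗ[R] N' := LinearMap.snd R N N' ∘ₗ L.subtype
  have ha : Function.Surjective a := by
    intro x
    obtain ⟨y, hy⟩ := hp' (p x)
    exact ⟨⟨(x, y), sub_eq_zero.2 hy.symm⟩, rfl⟩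
  have hpab : p ∘ₗ a = p' ∘ₗ b := LinearMap.ext hL
  obtain ⟨U, hU, hind⟩ := exists_indecomposable_map_eq_top hN a ha
  have hUu := hR U hind
  let a' : U →ₗ[R] N := a ∘ₗ U.subtype
  let b' : U →ₗ[R] N' := b ∘ₗ U.subtype
  have ha' : Function.Surjective a' := by
    rw [← LinearMap.range_eq_top, LinearMap.range_comp, Submodule.range_subtype, hU]
  have hpab' : p ∘ₗ a' = p' ∘ₗ b' := by
    simp only [a', b', ← LinearMap.comp_assoc, hpab]
  have hb' : Function.Surjective b' := by
    rw [← LinearMap.range_eq_top]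
    apply hN'.eq_top_of_not_le_ker hp'
    intro hle
    obtain ⟨s, hs⟩ := exists_ne (0 : S)
    obtain ⟨u, hu⟩ := (hp.comp ha') s
    have h1 : p' (b' u) = 0 := hle ⟨u, rfl⟩
    have h2 := LinearMap.congr_fun hpab' u
    simp only [LinearMap.comp_apply] at h2
    rw [h1] at h2
    exact hs (hu.symm.trans h2)
  exact exists_comp_eq_of_common_cover hUu a' ha' b' hb' p p' hpab'

/-- Uniserial modules with the same simple socle are comparable: one maps to the other under the
socle. This is dual to `IndecomposablesUniserial.exists_map_over_top`. -/
lemma IndecomposablesUniserial.exists_map_under_socle (hR : IndecomposablesUniserial R)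
    [Module.Finite R N] [Module.Finite R N'] (hN : IsUniserial R N) (hN' : IsUniserial R N')
    {S : Type u} [AddCommGroup S] [Module R S] [IsSimpleModule R S]
    (j : S →ₗ[R] N) (hj : Function.Injective j) (j' : S →ₗ[R] N')
    (hj' : Function.Injective j') :
    (∃ f : N →ₗ[R] N', f ∘ₗ j = j') ∨ (∃ f : N' →ₗ[R] N, f ∘ₗ j' = j) := by
  have : Nontrivial S := IsSimpleModule.nontrivial R S
  have : Nontrivial N := hj.nontrivial
  let D : Submodule R (N × N') := LinearMap.range (j.prod (-j'))
  let a : N →ₗ[R] ((N × N') ⧸ D) := D.mkQ ∘ₗ LinearMap.inl R N N'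
  let b : N' →ₗ[R] ((N × N') ⧸ D) := D.mkQ ∘ₗ LinearMap.inr R N N'
  have hab : a ∘ₗ j = b ∘ₗ j' := by
    ext s
    rw [← sub_eq_zero]
    simp only [a, b, LinearMap.comp_apply, ← map_sub]
    exact (Submodule.Quotient.mk_eq_zero D).2 ⟨s, by simp⟩
  have ha : Function.Injective a := by
    rw [← LinearMap.ker_eq_bot, eq_bot_iff]
    intro x hx
    obtain ⟨s, hs⟩ := (Submodule.Quotient.mk_eq_zero D).1 (show D.mkQ (x, 0) = 0 from hx)
    have h1 : j s = x := congrArg Prod.fst hs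
    have h2 : - j' s = 0 := congrArg Prod.snd hs
    have h3 : s = 0 := hj' (by simpa using h2)
    simp [← h1, h3]
  obtain ⟨K, hK, hind⟩ := exists_indecomposable_quotient hN a ha
  have hE := hR _ hind
  let a' := K.mkQ ∘ₗ a
  let b' := K.mkQ ∘ₗ b
  have hab' : a' ∘ₗ j = b' ∘ₗ j' := by simp only [a', b', LinearMap.comp_assoc, hab]
  have hb' : Function.Injective b' := by
    by_contra hne
    rw [← LinearMap.ker_eq_bot] at hne
    have h1 := hN'.range_le_of_ne_bot j' hne
    obtain ⟨s, hs⟩ := exists_ne (0 : S)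
    have h2 : b' (j' s) = 0 := h1 ⟨s, rfl⟩
    have h3 : a' (j s) = 0 := (LinearMap.congr_fun hab' s).trans h2
    exact hs ((hK.comp hj) (by simpa [a'] using h3))
  rcases hE (LinearMap.range a') (LinearMap.range b') with h | h
  · left
    obtain ⟨f, hf⟩ := exists_comp_eq_of_range_le b' hb' a' h
    refine ⟨f, ?_⟩
    rw [← LinearMap.cancel_left hb', ← LinearMap.comp_assoc, hf, hab']
  · right
    obtain ⟨f, hf⟩ := exists_comp_eq_of_range_le a' hK b' h
    refine ⟨f, ?_⟩
    rw [← LinearMap.cancel_left hK, ← LinearMap.comp_assoc, hf, ← hab']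

lemma IndecomposablesUniserial.follows_unique (hR : IndecomposablesUniserial R)
    [IsSimpleModule R A] [IsSimpleModule R B] [IsSimpleModule R B'] (h : Follows R A B)
    (h' : Follows R A B') : Nonempty (B ≃ₗ[R] B') := by
  have main : ∀ (B B' : Type u) [AddCommGroup B] [Module R B] [AddCommGroup B'] [Module R B']
      [IsSimpleModule R B] [IsSimpleModule R B'] (U U' : Type u) [AddCommGroup U] [Module R U]
      [AddCommGroup U'] [Module R U'] (i : B →ₗ[R] U) (p : U →ₗ[R] A) (i' : B' →ₗ[R] U')
      (p' : U' →ₗ[R] A), IsUniserial R U' → Function.Surjective p → Function.Injective i' →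
      LinearMap.range i = LinearMap.ker p → LinearMap.range i' = LinearMap.ker p' →
      (∃ f : U →ₗ[R] U', p' ∘ₗ f = p) → Nonempty (B ≃ₗ[R] B') := by
    intro B B' _ _ _ _ _ _ U U' _ _ _ _ i p i' p' hU' hp hi' hip hip' ⟨f, hf⟩
    have : Nontrivial A := IsSimpleModule.nontrivial R A
    have : Nontrivial B' := IsSimpleModule.nontrivial R B'
    obtain ⟨g, hg⟩ := exists_comp_eq_of_range_le i' hi' (f ∘ₗ i) (by
      rintro _ ⟨x, rfl⟩
      rw [hip', LinearMap.mem_ker]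
      have h1 : i x ∈ LinearMap.ker p := hip ▸ ⟨x, rfl⟩
      exact (LinearMap.congr_fun hf (i x)).trans h1)
    have hg0 : g ≠ 0 := by
      rintro rfl
      rw [LinearMap.comp_zero] at hg
      have h1 : LinearMap.ker p' ≤ LinearMap.range f := by
        refine (hU' _ _).resolve_right fun hle => ?_
        obtain ⟨a, ha⟩ := exists_ne (0 : A)
        obtain ⟨u, rfl⟩ := hp a
        exact ha ((LinearMap.congr_fun hf u).symm.trans (hle ⟨u, rfl⟩))
      obtain ⟨b, hb⟩ := exists_ne (0 : B')
      have h2 : i' b ∈ LinearMap.ker p' := hip' ▸ ⟨b, rfl⟩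
      obtain ⟨u, hu⟩ := h1 h2
      have h3 : u ∈ LinearMap.range i := by
        rw [hip, LinearMap.mem_ker, ← hf, LinearMap.comp_apply, hu]
        exact h2
      obtain ⟨x, rfl⟩ := h3
      have h4 : f (i x) = 0 := (LinearMap.congr_fun hg x).symm
      rw [hu] at h4
      exact hb (hi' (by simpa using h4))
    exact ⟨LinearEquiv.ofBijective g (LinearMap.bijective_of_ne_zero hg0)⟩
  obtain ⟨U, _, _, i, p, hfin, hU, hi, hp, hip⟩ := h
  obtain ⟨U', _, _, i', p', hfin', hU', hi', hp', hip'⟩ := h'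
  rcases hR.exists_map_over_top hU hU' p hp p' hp' with hf | hf
  · exact main B B' U U' i p i' p' hU' hp hi' hip hip' hf
  · exact (main B' B U' U i' p' i p hU hp' hi hip' hip hf).map LinearEquiv.symm

lemma IndecomposablesUniserial.follows_unique_left (hR : IndecomposablesUniserial R)
    [IsSimpleModule R A] [IsSimpleModule R A'] [IsSimpleModule R B] (h : Follows R A B)
    (h' : Follows R A' B) : Nonempty (A ≃ₗ[R] A') := by
  have main : ∀ (A A' : Type u) [AddCommGroup A] [Module R A] [AddCommGroup A'] [Module R A']
      [IsSimpleModule R A] [IsSimpleModule R A'] (U U' : Type u) [AddCommGroup U] [Module R U]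
      [AddCommGroup U'] [Module R U'] (i : B →ₗ[R] U) (p : U →ₗ[R] A) (i' : B →ₗ[R] U')
      (p' : U' →ₗ[R] A'), IsUniserial R U → Function.Surjective p → Function.Injective i' →
      LinearMap.range i = LinearMap.ker p → LinearMap.range i' = LinearMap.ker p' →
      (∃ f : U →ₗ[R] U', f ∘ₗ i = i') → Nonempty (A ≃ₗ[R] A') := by
    intro A A' _ _ _ _ _ _ U U' _ _ _ _ i p i' p' hU hp hi' hip hip' ⟨f, hf⟩
    have : Nontrivial A := IsSimpleModule.nontrivial R A
    have : Nontrivial B := IsSimpleModule.nontrivial R B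
    obtain ⟨g, hg⟩ := exists_comp_eq_of_ker_le p hp (p' ∘ₗ f) (by
      rw [← hip]
      rintro _ ⟨x, rfl⟩
      rw [LinearMap.mem_ker, LinearMap.comp_apply, ← LinearMap.comp_apply f, hf,
        ← LinearMap.mem_ker, ← hip']
      exact ⟨x, rfl⟩)
    have hg0 : g ≠ 0 := by
      rintro rfl
      rw [LinearMap.zero_comp] at hg
      have hker : LinearMap.ker f = ⊥ := by
        by_contra hne
        have h1 := hU.range_le_of_ne_bot i hne
        obtain ⟨b, hb⟩ := exists_ne (0 : B)
        have h2 : f (i b) = 0 := h1 ⟨b, rfl⟩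
        rw [← LinearMap.comp_apply f, hf] at h2
        exact hb (hi' (by simpa using h2))
      obtain ⟨a, ha⟩ := exists_ne (0 : A)
      obtain ⟨u, rfl⟩ := hp a
      have h3 : f u ∈ LinearMap.range i' := by
        rw [hip', LinearMap.mem_ker]
        exact (LinearMap.congr_fun hg u).symm
      obtain ⟨b, hb⟩ := h3
      rw [← hf] at hb
      have h4 : i b = u := LinearMap.ker_eq_bot.1 hker hb
      apply ha
      rw [← h4, ← LinearMap.mem_ker, ← hip]
      exact ⟨b, rfl⟩
    exact ⟨LinearEquiv.ofBijective g (LinearMap.bijective_of_ne_zero hg0)⟩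
  obtain ⟨U, _, _, i, p, hfin, hU, hi, hp, hip⟩ := h
  obtain ⟨U', _, _, i', p', hfin', hU', hi', hp', hip'⟩ := h'
  rcases hR.exists_map_under_socle hU hU' i hi i' hi' with hf | hf
  · exact main A A' U U' i p i' p' hU hp hi' hip hip' hf
  · exact (main A' A U' U i' p' i p hU' hp' hi hip' hip hf).map LinearEquiv.symm

end Uniserial

/-! ### Serial modules and Nakayama algebras -/

section Serial

variable {R : Type u} [Ring R] {N : Type u} [AddCommGroup N] [Module R N]

lemma IsSerialModule.isUniserial (h : IsSerialModule R N) : IsUniserial R N := by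
  obtain ⟨c, ⟨h0, h1⟩, huniq⟩ := h
  have hfl := isFiniteLength_of_exists_compositionSeries ⟨c, h0, h1⟩
  have := (isFiniteLength_iff_isNoetherian_isArtinian.mp hfl).1
  have := (isFiniteLength_iff_isNoetherian_isArtinian.mp hfl).2
  have mem : ∀ A : Submodule R N, A ∈ c := by
    intro A
    obtain ⟨d, i, hi, hd0, hd1⟩ := LTSeries.exists_relSeries_covBy_and_head_eq_bot_and_last_eq_bot
      (RelSeries.singleton _ A)
    have hdc : d = c := huniq d ⟨hd0, hd1⟩
    rw [← hdc]
    have := congrFun hi 0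
    exact ⟨i 0, this⟩
  intro A B
  exact CompositionSeries.total (mem A) (mem B)

lemma IsUniserial.mem_compositionSeries (h : IsUniserial R N)
    (c : CompositionSeries (Submodule R N)) (h0 : c.head = ⊥) (h1 : c.last = ⊤)
    (A : Submodule R N) : A ∈ c := by
  have key : ∀ i : Fin (c.length + 1), A ≤ c i → A ∈ c := by
    intro i
    induction i using Fin.induction with
    | zero =>
      intro hA
      refine ⟨0, ?_⟩
      have : c 0 = ⊥ := h0
      rw [this] at hA
      exact this.trans (le_bot_iff.1 hA).symm
    | succ i ih =>
      intro hA
      rcases h A (c i.castSucc) with h2 | h2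
      · exact ih h2
      · have hc : c i.castSucc ⋖ c i.succ := c.step i
        rcases hc.eq_or_eq h2 hA with h3 | h3
        · exact ⟨_, h3.symm⟩
        · exact ⟨_, h3.symm⟩
  apply key (Fin.last _)
  have : c (Fin.last _) = ⊤ := h1
  rw [this]
  exact le_top

lemma IsUniserial.isSerialModule [IsNoetherian R N] [IsArtinian R N] (h : IsUniserial R N) :
    IsSerialModule R N := by
  obtain ⟨c, h0, h1⟩ := exists_compositionSeries_of_isNoetherian_isArtinian R N
  refine ⟨c, ⟨h0, h1⟩, ?_⟩
  rintro d ⟨hd0, hd1⟩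
  exact CompositionSeries.ext fun A =>
    ⟨fun _ => h.mem_compositionSeries c h0 h1 A, fun _ => h.mem_compositionSeries d hd0 hd1 A⟩

lemma IsNakayamaAlgebra.indecomposablesUniserial {k : Type w} [Field k] [Algebra k R]
    (h : IsNakayamaAlgebra k R) : IndecomposablesUniserial R :=
  fun N _ _ _ hN => (h.serial N hN).isUniserial

end Serial

/-! ### Composition factors over connected rings -/

section Connected

variable {R : Type u} [Ring R] {N N' : Type u} [AddCommGroup N] [Module R N]
  [AddCommGroup N'] [Module R N']

lemma follows_of_uniserial {Y Z S T : Type u} [AddCommGroup Y] [Module R Y] [AddCommGroup Z]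
    [Module R Z] [AddCommGroup S] [Module R S] [AddCommGroup T] [Module R T] [Module.Finite R Z]
    (hZ : IsUniserial R Z) (f : Y →ₗ[R] Z) (hf : Function.Injective f)
    (q : Z →ₗ[R] S) (hq : Function.Surjective q) (hfq : LinearMap.range f = LinearMap.ker q)
    (g : Y →ₗ[R] T) (hg : Function.Surjective g) : Follows R S T := by
  let K := (LinearMap.ker g).map f
  have hK : K ≤ LinearMap.ker q := hfq ▸ LinearMap.map_le_range
  obtain ⟨i, hi⟩ := exists_comp_eq_of_ker_le g hg (K.mkQ ∘ₗ f) (fun x hx =>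
    (Submodule.Quotient.mk_eq_zero K).2 (Submodule.mem_map_of_mem hx))
  refine ⟨Z ⧸ K, inferInstance, inferInstance, i, K.liftQ q hK, inferInstance, hZ.quotient K,
    ?_, ?_, ?_⟩
  · rw [injective_iff_map_eq_zero]
    intro t ht
    obtain ⟨y, rfl⟩ := hg t
    have h1 : K.mkQ (f y) = 0 := (LinearMap.congr_fun hi y).symm.trans ht
    obtain ⟨y', hy', h2⟩ := (Submodule.Quotient.mk_eq_zero K).1 h1
    rw [← hf h2]
    exact hy'
  · intro s
    obtain ⟨z, rfl⟩ := hq s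
    exact ⟨K.mkQ z, rfl⟩
  · rw [← LinearMap.range_comp_of_range_eq_top i (LinearMap.range_eq_top.2 hg), hi,
      LinearMap.range_comp, hfq, Submodule.ker_liftQ]

lemma nonempty_equiv_of_surjective_of_isUniserial {S T : Type u} [AddCommGroup S] [Module R S]
    [AddCommGroup T] [Module R T] [IsSimpleModule R S] [IsSimpleModule R T]
    (hN : IsUniserial R N) (p : N →ₗ[R] S) (hp : Function.Surjective p) (q : N →ₗ[R] T)
    (hq : Function.Surjective q) : Nonempty (S ≃ₗ[R] T) := by
  have := IsSimpleModule.nontrivial R T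
  obtain ⟨f, hf⟩ := exists_comp_eq_of_ker_le p hp q (by
    by_contra hle
    have h1 := hN.eq_top_of_not_le_ker hq hle
    have h2 := LinearMap.isCoatom_ker_of_surjective hp
    exact h2.1 h1)
  have hf0 : f ≠ 0 := by
    rintro rfl
    obtain ⟨t, ht⟩ := exists_ne (0 : T)
    obtain ⟨x, rfl⟩ := hq t
    exact ht (LinearMap.congr_fun hf x).symm
  exact ⟨LinearEquiv.ofBijective f (LinearMap.bijective_of_ne_zero hf0)⟩

variable (C : ∀ (T : Type u) [AddCommGroup T] [Module R T], Prop)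

/-- Every simple subquotient of `N` that lies in the submodule `A` has the property `C`. -/
def FactorsSatisfy (A : Submodule R N) : Prop :=
  ∀ Y ≤ A, ∀ (T : Type u) [AddCommGroup T] [Module R T] [IsSimpleModule R T] (g : Y →ₗ[R] T),
    Function.Surjective g → C T

variable {C}

lemma FactorsSatisfy.map {A : Submodule R N} (hA : FactorsSatisfy C A) (f : N →ₗ[R] N') :
    FactorsSatisfy C (A.map f) := by
  intro Y hY T _ _ _ g hg
  let Y0 : Submodule R N := A ⊓ Y.comap f
  let f' : Y0 →ₗ[R] Y := f.restrict fun x hx => hx.2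
  refine hA Y0 inf_le_left T (g ∘ₗ f') (hg.comp ?_)
  rintro ⟨y, hy⟩
  obtain ⟨x, hx, rfl⟩ := hY hy
  exact ⟨⟨x, hx, hy⟩, rfl⟩

lemma FactorsSatisfy.sup {A B : Submodule R N} (hA : FactorsSatisfy C A)
    (hB : FactorsSatisfy C B) : FactorsSatisfy C (A ⊔ B) := by
  intro Y hY T _ _ _ g hg
  by_cases h : LinearMap.ker (A.mkQ.submoduleMap Y) ≤ LinearMap.ker g
  · obtain ⟨f, hf⟩ := exists_comp_eq_of_ker_le (A.mkQ.submoduleMap Y)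
      (A.mkQ.submoduleMap_surjective Y) g h
    have hle : Y.map A.mkQ ≤ B.map A.mkQ := by
      have : (A ⊔ B).map A.mkQ = B.map A.mkQ := by
        rw [Submodule.map_sup, Submodule.mkQ_map_self, bot_sup_eq]
      exact this ▸ Submodule.map_mono hY
    refine hB.map A.mkQ _ hle T f ?_
    rw [← hf] at hg
    exact Function.Surjective.of_comp hg
  · let Y0 : Submodule R N := A ⊓ Y
    refine hA Y0 inf_le_left T (g ∘ₗ Submodule.inclusion inf_le_right)
      (LinearMap.surjective_of_ne_zero fun h0 => h ?_)
    intro y hy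
    have hyA : (y : N) ∈ A := (Submodule.Quotient.mk_eq_zero A).1 (congrArg Subtype.val hy)
    exact LinearMap.congr_fun h0 ⟨y.1, hyA, y.2⟩

/-- If the property `C` is invariant under `Follows`, then all composition factors of a uniserial
module agree as to `C`. -/
lemma IsUniserial.factor_iff [IsArtinianRing R] [Module.Finite R N] (hN : IsUniserial R N)
    (hCe : ∀ (T T' : Type u) [AddCommGroup T] [Module R T] [AddCommGroup T'] [Module R T'],
      (T ≃ₗ[R] T') → C T → C T')
    (hC : ∀ (T T' : Type u) [AddCommGroup T] [Module R T] [AddCommGroup T'] [Module R T']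
      [IsSimpleModule R T] [IsSimpleModule R T'], Follows R T T' → (C T ↔ C T'))
    {S : Type u} [AddCommGroup S] [Module R S] [IsSimpleModule R S] (p : N →ₗ[R] S)
    (hp : Function.Surjective p) (Y : Submodule R N) :
    ∀ (T : Type u) [AddCommGroup T] [Module R T] [IsSimpleModule R T] (g : Y →ₗ[R] T),
      Function.Surjective g → (C T ↔ C S) := by
  induction Y using WellFoundedGT.induction with
  | ind Y ih =>
    intro T _ _ _ g hg
    by_cases hY : Y = ⊤
    · subst hY
      obtain ⟨e⟩ := nonempty_equiv_of_surjective_of_isUniserial (hN.submodule ⊤) g hg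
        (p ∘ₗ Submodule.subtype ⊤) (hp.comp fun x => ⟨⟨x, trivial⟩, rfl⟩)
      exact ⟨hCe _ _ e, hCe _ _ e.symm⟩
    · obtain ⟨Z, hZ, -⟩ := exists_covBy_le_of_lt (lt_top_iff_ne_top.2 hY)
      have : IsSimpleModule R (Z ⧸ Y.submoduleOf Z) := (covBy_iff_quot_is_simple hZ.le).1 hZ
      rw [← ih Z hZ.lt (Z ⧸ Y.submoduleOf Z) (Submodule.mkQ _) (Submodule.mkQ_surjective _)]
      refine (hC _ _ ?_).symm
      refine follows_of_uniserial (hN.submodule Z) (Submodule.inclusion hZ.le)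
        (Submodule.inclusion_injective _) (Submodule.mkQ (Y.submoduleOf Z))
        (Submodule.mkQ_surjective _) ?_ g hg
      rw [Submodule.ker_mkQ, Submodule.range_inclusion]
      rfl

/-- Over a connected ring whose indecomposables are uniserial, a property of simple modules which
is invariant under `Follows` holds for all simple modules or for none. The left ideals generated
by the uniserial left ideals of the two kinds are complementary two-sided ideals. -/
lemma IndecomposablesUniserial.factor_dichotomy [IsArtinianRing R]
    (hR : IndecomposablesUniserial R) (hconn : IsConnectedRing R)
    (hCe : ∀ (T T' : Type u) [AddCommGroup T] [Module R T] [AddCommGroup T'] [Module R T'],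
      (T ≃ₗ[R] T') → C T → C T')
    (hC : ∀ (T T' : Type u) [AddCommGroup T] [Module R T] [AddCommGroup T'] [Module R T']
      [IsSimpleModule R T] [IsSimpleModule R T'], Follows R T T' → (C T ↔ C T'))
    (S T : Type u) [AddCommGroup S] [Module R S] [IsSimpleModule R S]
    [AddCommGroup T] [Module R T] [IsSimpleModule R T] (hS : C S) : C T := by
  have greatest : ∀ C' : ∀ (T : Type u) [AddCommGroup T] [Module R T], Prop,
      ∃ X : Submodule R R, FactorsSatisfy C' X ∧ ∀ A, FactorsSatisfy C' A → A ≤ X := by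
    intro C'
    obtain ⟨X, hX, hmax⟩ := wellFounded_gt.has_min {X : Submodule R R | FactorsSatisfy C' X}
      ⟨⊥, by
        intro Y hY T _ _ _ g hg
        have := IsSimpleModule.nontrivial R T
        obtain ⟨t, ht⟩ := exists_ne (0 : T)
        obtain ⟨y, rfl⟩ := hg t
        have : y = 0 := Subtype.ext (hY y.2)
        exact absurd (by rw [this, map_zero]) ht⟩
    refine ⟨X, hX, fun A hA => ?_⟩
    have h1 := eq_of_le_of_not_lt (le_sup_left : X ≤ X ⊔ A) (hmax _ (FactorsSatisfy.sup hX hA))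
    exact h1 ▸ le_sup_right
  obtain ⟨X, hX, hXmax⟩ := greatest C
  obtain ⟨Y, hY, hYmax⟩ := greatest (fun T => ¬ C T)
  have hsup : X ⊔ Y = ⊤ := by
    by_contra hne
    obtain ⟨H, hH, hle⟩ := (eq_top_or_exists_le_coatom (X ⊔ Y)).resolve_left hne
    have : IsSimpleModule R (R ⧸ H) := isSimpleModule_iff_isCoatom.2 hH
    have : Nontrivial (R ⧸ H) := IsSimpleModule.nontrivial R _
    have hu : IsUniserial R (R ⧸ H) := fun A B => by
      rcases eq_bot_or_eq_top A with h | h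
      · left; rw [h]; exact bot_le
      · right; rw [h]; exact le_top
    obtain ⟨V, hV, hind⟩ := exists_indecomposable_map_eq_top hu H.mkQ H.mkQ_surjective
    have hVu := hR V hind
    have hVX : ¬ V ≤ H := by
      intro hVH
      have : V.map H.mkQ = ⊥ := by
        rw [eq_bot_iff, ← Submodule.mkQ_map_self H]
        exact Submodule.map_mono hVH
      rw [hV] at this
      exact top_ne_bot this
    apply hVX
    have hp : Function.Surjective (H.mkQ ∘ₗ V.subtype) := by
      rw [← LinearMap.range_eq_top, LinearMap.range_comp, Submodule.range_subtype, hV]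
    have hfac := hVu.factor_iff hCe hC (H.mkQ ∘ₗ V.subtype) hp
    have hfac' : ∀ Z ≤ V, ∀ (T : Type u) [AddCommGroup T] [Module R T] [IsSimpleModule R T]
        (g : Z →ₗ[R] T), Function.Surjective g → (C T ↔ C (R ⧸ H)) := by
      intro Z hZ T _ _ _ g hg
      exact hfac (Z.submoduleOf V) T (g ∘ₗ (Submodule.submoduleOfEquivOfLe hZ).toLinearMap)
        (hg.comp (LinearEquiv.surjective _))
    by_cases hc : C (R ⧸ H)
    · exact (hXmax V fun Z hZ T _ _ _ g hg => (hfac' Z hZ T g hg).2 hc).trans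
        (le_sup_left.trans hle)
    · exact (hYmax V fun Z hZ T _ _ _ g hg => fun h => hc ((hfac' Z hZ T g hg).1 h)).trans
        (le_sup_right.trans hle)
  have hinf : X ⊓ Y = ⊥ := by
    by_contra hne
    obtain ⟨A, hA, hle⟩ := (eq_bot_or_exists_atom_le (X ⊓ Y)).resolve_left hne
    have : IsSimpleModule R A := isSimpleModule_iff_isAtom.2 hA
    exact hY A (hle.trans inf_le_right) A LinearMap.id Function.surjective_id
      (hX A (hle.trans inf_le_left) A LinearMap.id Function.surjective_id)
  -- Right multiplications are left linear, so both left ideals are two-sided.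
  have hXr : ∀ x ∈ X, ∀ r, x * r ∈ X := fun x hx r =>
    hXmax _ (hX.map (LinearMap.toSpanSingleton R R r)) ⟨x, hx, rfl⟩
  have hYr : ∀ x ∈ Y, ∀ r, x * r ∈ Y := fun x hx r =>
    hYmax _ (hY.map (LinearMap.toSpanSingleton R R r)) ⟨x, hx, rfl⟩
  have h0 : ∀ z, z ∈ X → z ∈ Y → z = 0 := fun z h1 h2 => by
    have : z ∈ X ⊓ Y := ⟨h1, h2⟩
    rwa [hinf] at this
  obtain ⟨e, he, f, hf, hef⟩ := Submodule.mem_sup.1 (hsup ▸ Submodule.mem_top : (1 : R) ∈ X ⊔ Y)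
  have hYX : ∀ y ∈ Y, ∀ x ∈ X, y * x = 0 ∧ x * y = 0 := fun y hy x hx =>
    ⟨h0 _ (X.smul_mem y hx) (hYr y hy x), h0 _ (hXr x hx y) (Y.smul_mem x hy)⟩
  have hidem : IsIdempotentElem e := by
    have h1 : e * (e + f) = e := by rw [hef, mul_one]
    rwa [mul_add, (hYX f hf e he).2, add_zero] at h1
  have hcent : e ∈ Subring.center R := by
    rw [Subring.mem_center_iff]
    intro r
    have h1 : r * e - e * r = f * r - r * f := by
      have h2 : r * (e + f) = (e + f) * r := by rw [hef, mul_one, one_mul]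
      rw [mul_add, add_mul] at h2
      rw [sub_eq_sub_iff_add_eq_add, h2, add_comm]
    rw [← sub_eq_zero]
    refine h0 _ (sub_mem (X.smul_mem r he) (hXr e he r)) ?_
    rw [h1]
    exact sub_mem (hYr f hf r) (Y.smul_mem r hf)
  -- The idempotent `e` acts as the identity on simple modules with `C` and as zero on the others.
  have hsimple : ∀ (T : Type u) [AddCommGroup T] [Module R T] [IsSimpleModule R T]
      (Z : Submodule R R), (∃ x ∈ Z, ∃ t : T, x • t ≠ 0) →
      ∃ g : Z →ₗ[R] T, Function.Surjective g := by
    rintro T _ _ _ Z ⟨x, hx, t, hxt⟩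
    refine ⟨LinearMap.toSpanSingleton R T t ∘ₗ Z.subtype, LinearMap.surjective_of_ne_zero ?_⟩
    intro h
    exact hxt (LinearMap.congr_fun h ⟨x, hx⟩)
  have := IsSimpleModule.nontrivial R S
  have := IsSimpleModule.nontrivial R T
  by_contra hT
  rcases hconn.2 e hcent hidem with h | h
  · have hf1 : f = 1 := by rw [← hef, h, zero_add]
    obtain ⟨t, ht⟩ := exists_ne (0 : S)
    obtain ⟨g, hg⟩ := hsimple S Y ⟨f, hf, t, by rwa [hf1, one_smul]⟩
    exact hY Y le_rfl S g hg hS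
  · obtain ⟨t, ht⟩ := exists_ne (0 : T)
    obtain ⟨g, hg⟩ := hsimple T X ⟨e, he, t, by rwa [h, one_smul]⟩
    exact hT (hX X le_rfl T g hg)

end Connected

/-! ### The periodic Loewy series of a long uniserial module -/

section SimpleClasses

variable {R : Type u} [Ring R]

/-- The isomorphism class of a simple module. -/
def simpleClass (R : Type u) [Ring R] (T : Type u) [AddCommGroup T] [Module R T]
    [h : IsSimpleModule R T] : Quotient (simpleModuleSetoid R) :=
  Quotient.mk _ ⟨ModuleCat.of R T, h⟩

lemma simpleClass_eq_iff {T T' : Type u} [AddCommGroup T] [Module R T] [h : IsSimpleModule R T]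
    [AddCommGroup T'] [Module R T'] [h' : IsSimpleModule R T'] :
    simpleClass R T = simpleClass R T' ↔ Nonempty (T ≃ₗ[R] T') :=
  Quotient.eq (r := simpleModuleSetoid R)

lemma exists_simpleClass_eq (q : Quotient (simpleModuleSetoid R)) :
    ∃ (T : Type u) (_ : AddCommGroup T) (_ : Module R T) (_ : IsSimpleModule R T),
      simpleClass R T = q := by
  induction q using Quotient.ind with
  | _ X => exact ⟨X.1, inferInstance, inferInstance, X.2, rfl⟩

lemma finite_simpleClasses (R : Type u) [Ring R] [IsArtinianRing R] :
    Finite (Quotient (simpleModuleSetoid R)) := by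
  have key : ∀ A : Submodule R R, {q | ∃ (Y : Submodule R R) (_ : Y ≤ A) (T : Type u)
      (_ : AddCommGroup T) (_ : Module R T) (_ : IsSimpleModule R T) (g : Y →ₗ[R] T),
      Function.Surjective g ∧ simpleClass R T = q}.Finite := by
    intro A
    induction A using WellFoundedLT.induction with
    | ind A ih =>
      by_cases hA : A = ⊥
      · refine Set.Finite.subset Set.finite_empty ?_
        rintro q ⟨Y, hY, T, _, _, _, g, hg, -⟩
        have := IsSimpleModule.nontrivial R T
        obtain ⟨t, ht⟩ := exists_ne (0 : T)
        obtain ⟨y, rfl⟩ := hg t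
        have : y = 0 := Subtype.ext (by simpa [hA] using hY y.2)
        exact absurd (by rw [this, map_zero]) ht
      · obtain ⟨B, -, hB⟩ := exists_le_covBy_of_lt (bot_lt_iff_ne_bot.2 hA)
        have hs : IsSimpleModule R (A ⧸ B.submoduleOf A) := (covBy_iff_quot_is_simple hB.le).1 hB
        refine ((ih B hB.lt).insert (simpleClass R (A ⧸ B.submoduleOf A))).subset ?_
        rintro q ⟨Y, hY, T, _, _, _, g, hg, rfl⟩
        let r : Y →ₗ[R] (A ⧸ B.submoduleOf A) := (B.submoduleOf A).mkQ ∘ₗ Submodule.inclusion hY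
        by_cases h : LinearMap.ker r ≤ LinearMap.ker g
        · left
          have := IsSimpleModule.nontrivial R T
          have hr0 : r ≠ 0 := by
            intro h0
            rw [h0, LinearMap.ker_zero, top_le_iff, LinearMap.ker_eq_top] at h
            obtain ⟨t, ht⟩ := exists_ne (0 : T)
            obtain ⟨y, rfl⟩ := hg t
            exact ht (by rw [h, LinearMap.zero_apply])
          have hr := LinearMap.surjective_of_ne_zero hr0
          obtain ⟨f, hf⟩ := exists_comp_eq_of_ker_le r hr g h
          have hf0 : f ≠ 0 := by
            rintro rfl
            obtain ⟨t, ht⟩ := exists_ne (0 : T)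
            obtain ⟨y, rfl⟩ := hg t
            exact ht (LinearMap.congr_fun hf y).symm
          exact simpleClass_eq_iff.2
            ⟨(LinearEquiv.ofBijective f (LinearMap.bijective_of_ne_zero hf0)).symm⟩
        · right
          refine ⟨B ⊓ Y, inf_le_left, T, _, _, _, g ∘ₗ Submodule.inclusion inf_le_right,
            LinearMap.surjective_of_ne_zero fun h0 => h ?_, rfl⟩
          intro y hy
          have hyB : (y : R) ∈ B := (Submodule.Quotient.mk_eq_zero (B.submoduleOf A)).1 hy
          exact LinearMap.congr_fun h0 ⟨y.1, hyB, y.2⟩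
  have htop := key ⊤
  rw [← Set.finite_univ_iff]
  refine htop.subset ?_
  intro q _
  obtain ⟨T, _, _, _, rfl⟩ := exists_simpleClass_eq q
  have := IsSimpleModule.nontrivial R T
  obtain ⟨t, ht⟩ := exists_ne (0 : T)
  refine ⟨⊤, le_rfl, T, _, _, _, LinearMap.toSpanSingleton R T t ∘ₗ Submodule.subtype ⊤, ?_, rfl⟩
  exact (IsSimpleModule.toSpanSingleton_surjective R ht).comp fun x => ⟨⟨x, trivial⟩, rfl⟩

end SimpleClasses

section Flag

variable {R : Type u} [Ring R] {M : Type u} [AddCommGroup M] [Module R M]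

/-- `W` is a strictly descending sequence of submodules of `M` with simple factors, starting at
`⊤` and reaching `⊥` after exactly `t` steps. -/
structure IsLoewySeries (W : ℕ → Submodule R M) (t : ℕ) : Prop where
  zero : W 0 = ⊤
  covBy : ∀ i < t, W (i + 1) ⋖ W i
  bot : ∀ i, t ≤ i → W i = ⊥

/-- The `i`-th factor of a descending sequence of submodules. -/
abbrev loewyFactor (W : ℕ → Submodule R M) (i : ℕ) : Type u :=
  W i ⧸ (W (i + 1)).submoduleOf (W i)

variable {W : ℕ → Submodule R M} {t : ℕ}

namespace IsLoewySeries

lemma antitone (hW : IsLoewySeries W t) : Antitone W :=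
  antitone_nat_of_succ_le fun i => by
    rcases lt_or_ge i t with h | h
    · exact (hW.covBy i h).le
    · rw [hW.bot i h, hW.bot (i + 1) (by omega)]

lemma lt_of_lt (hW : IsLoewySeries W t) {i j : ℕ} (hij : i < j) (hi : i < t) : W j < W i :=
  (hW.antitone (show i + 1 ≤ j by omega)).trans_lt (hW.covBy i hi).lt

lemma le_iff (hW : IsLoewySeries W t) {i j : ℕ} (hi : i < t) : W i ≤ W j ↔ j ≤ i := by
  refine ⟨fun h => ?_, fun h => hW.antitone h⟩
  by_contra hlt
  exact absurd h (not_le_of_gt (hW.lt_of_lt (by omega) hi))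

lemma eq_bot_iff (hW : IsLoewySeries W t) {i : ℕ} : W i = ⊥ ↔ t ≤ i := by
  refine ⟨fun h => ?_, hW.bot i⟩
  by_contra hlt
  have := hW.covBy i (by omega)
  rw [h] at this
  exact not_lt_bot this.lt

lemma exists_eq (hW : IsLoewySeries W t) (hM : IsUniserial R M) (A : Submodule R M) :
    ∃ i ≤ t, W i = A := by
  have key : ∀ i ≤ t, W i ≤ A → ∃ j ≤ t, W j = A := by
    intro i
    induction i with
    | zero =>
      intro _ h
      rw [hW.zero] at h
      exact ⟨0, Nat.zero_le _, hW.zero.trans (top_le_iff.1 h).symm⟩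
    | succ i ih =>
      intro hi h
      rcases hM (W i) A with h1 | h1
      · exact ih (by omega) h1
      · rcases (hW.covBy i (by omega)).eq_or_eq h h1 with h2 | h2
        · exact ⟨i + 1, hi, h2.symm⟩
        · exact ⟨i, by omega, h2.symm⟩
  exact key t le_rfl (by rw [hW.bot t le_rfl]; exact bot_le)

lemma isSimpleModule (hW : IsLoewySeries W t) {i : ℕ} (hi : i < t) :
    IsSimpleModule R (loewyFactor W i) :=
  (covBy_iff_quot_is_simple (hW.covBy i hi).le).1 (hW.covBy i hi)

lemma length_add (hW : IsLoewySeries W t) {i : ℕ} (hi : i ≤ t) :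
    Module.length R (W i) = (t - i : ℕ) := by
  obtain ⟨d, rfl⟩ := Nat.exists_eq_add_of_le hi
  rw [Nat.add_sub_cancel_left]
  induction d generalizing i with
  | zero => rw [hW.bot i (by omega)]; simp
  | succ d ih =>
    have := hW.isSimpleModule (i := i) (by omega)
    have hle := (hW.covBy i (by omega)).le
    have h1 := Module.length_eq_add_of_exact (Submodule.inclusion hle)
      ((W (i + 1)).submoduleOf (W i)).mkQ (Submodule.inclusion_injective _)
      (Submodule.mkQ_surjective _) (by
        rw [LinearMap.exact_iff, Submodule.ker_mkQ, Submodule.range_inclusion]; rfl)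
    rw [h1, Module.length_eq_one R (loewyFactor W i), ih (i := i + 1) (by rwa [show i + 1 + d = i + (d + 1) by omega])
      (by omega)]
    simp

lemma length_eq (hW : IsLoewySeries W t) : Module.length R M = t := by
  have := hW.length_add (Nat.zero_le t)
  rw [hW.zero, Module.length_top] at this
  simpa using this

lemma follows (hW : IsLoewySeries W t) [IsNoetherian R M] (hM : IsUniserial R M) {i : ℕ}
    (hi : i + 1 < t) : Follows R (loewyFactor W i) (loewyFactor W (i + 1)) := by
  have hle := (hW.covBy i (by omega)).le
  refine follows_of_uniserial (hM.submodule (W i)) (Submodule.inclusion hle)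
    (Submodule.inclusion_injective _) (Submodule.mkQ _) (Submodule.mkQ_surjective _) ?_
    (Submodule.mkQ _) (Submodule.mkQ_surjective _)
  rw [Submodule.ker_mkQ, Submodule.range_inclusion]
  rfl

/-- The simple top of `W i` is the `i`-th factor. -/
lemma nonempty_equiv_of_surjective (hW : IsLoewySeries W t) (hM : IsUniserial R M) {i : ℕ}
    (hi : i < t) {T : Type u} [AddCommGroup T] [Module R T] [IsSimpleModule R T]
    (g : W i →ₗ[R] T) (hg : Function.Surjective g) : Nonempty (T ≃ₗ[R] loewyFactor W i) := by
  have := hW.isSimpleModule hi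
  exact nonempty_equiv_of_surjective_of_isUniserial (hM.submodule (W i)) g hg
    (Submodule.mkQ _) (Submodule.mkQ_surjective _)

end IsLoewySeries

lemma exists_isLoewySeries (R M : Type u) [Ring R] [AddCommGroup M] [Module R M]
    [IsArtinian R M] [IsNoetherian R M] :
    ∃ (W : ℕ → Submodule R M) (t : ℕ), IsLoewySeries W t := by
  obtain ⟨a, h0, n, hn, ha⟩ := exists_covBy_seq_of_wellFoundedLT_wellFoundedGT (Submodule R M)
  refine ⟨fun i => a (n - i), n, hn.eq_top, fun i hi => ?_, fun i hi => ?_⟩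
  · have := ha (n - (i + 1)) (by omega)
    rwa [show n - (i + 1) + 1 = n - i by omega] at this
  · simp only [Nat.sub_eq_zero_of_le hi]
    exact h0.eq_bot

/-- A Loewy series whose factors repeat with period `s`, where the first `s` factors represent
all simple modules. -/
structure IsPeriodicLoewySeries (W : ℕ → Submodule R M) (s t : ℕ) : Prop
    extends IsLoewySeries W t where
  pos : 0 < s
  le : s ≤ t
  nonempty_equiv_iff : ∀ i < t, ∀ j < t,
    (Nonempty (loewyFactor W i ≃ₗ[R] loewyFactor W j) ↔ i % s = j % s)
  exists_equiv : ∀ (T : Type u) [AddCommGroup T] [Module R T] [IsSimpleModule R T],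
    ∃ i < s, Nonempty (T ≃ₗ[R] loewyFactor W i)

/-- Over a connected ring with `s` simple modules whose indecomposables are uniserial, the Loewy
series of a uniserial module of length at least `s` is periodic with period `s`: the simples
following each other in the series up to its first repetition are closed under `Follows`, so by
connectedness they are all the simples. -/
lemma IndecomposablesUniserial.isPeriodicLoewySeries [IsArtinianRing R]
    (hR : IndecomposablesUniserial R) (hconn : IsConnectedRing R) {s : ℕ}
    (hs : numSimples R = s) [Module.Finite R M] (hM : IsUniserial R M) (hW : IsLoewySeries W t)
    (ht : 0 < t) (hst : s ≤ t) : IsPeriodicLoewySeries W s t := by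
  let E : ℕ → ℕ → Prop := fun i j => Nonempty (loewyFactor W i ≃ₗ[R] loewyFactor W j)
  have Esymm : ∀ {i j}, E i j → E j i := fun ⟨e⟩ => ⟨e.symm⟩
  have Etrans : ∀ {i j l}, E i j → E j l → E i l := fun ⟨e⟩ ⟨f⟩ => ⟨e.trans f⟩
  have Erefl : ∀ i, E i i := fun i => ⟨LinearEquiv.refl _ _⟩
  have up : ∀ i j, i + 1 < t → j + 1 < t → E i j → E (i + 1) (j + 1) := by
    rintro i j hi hj ⟨e⟩
    have := hW.isSimpleModule hi
    have := hW.isSimpleModule hj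
    have := hW.isSimpleModule (show i < t by omega)
    exact hR.follows_unique (hW.follows hM hi)
      ((hW.follows hM hj).congr e.symm (LinearEquiv.refl _ _))
  have down : ∀ i j, i + 1 < t → j + 1 < t → E (i + 1) (j + 1) → E i j := by
    rintro i j hi hj ⟨e⟩
    have := hW.isSimpleModule hi
    have := hW.isSimpleModule (show i < t by omega)
    have := hW.isSimpleModule (show j < t by omega)
    exact hR.follows_unique_left (hW.follows hM hi)
      ((hW.follows hM hj).congr (LinearEquiv.refl _ _) e.symm)
  have shift : ∀ l i j, i + l < t → j + l < t → (E (i + l) (j + l) ↔ E i j) := by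
    intro l
    induction l with
    | zero => exact fun i j _ _ => Iff.rfl
    | succ l ih =>
      intro i j hi hj
      rw [← ih i j (by omega) (by omega)]
      exact ⟨down _ _ hi hj, up _ _ hi hj⟩
  have sub : ∀ i j, i ≤ j → j < t → (E i j ↔ E 0 (j - i)) := by
    intro i j hij hj
    have := shift i 0 (j - i) (by omega) (by omega)
    rwa [zero_add, Nat.sub_add_cancel hij] at this
  have hsimp : ∀ i : {i // i < t}, IsSimpleModule R (loewyFactor W i) :=
    fun i => hW.isSimpleModule i.2
  let cl : {i // i < t} → Quotient (simpleModuleSetoid R) := fun i =>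
    simpleClass R (loewyFactor W i) (h := hsimp i)
  have hcl : ∀ i j, cl i = cl j ↔ E i j := fun i j =>
    simpleClass_eq_iff (h := hsimp i) (h' := hsimp j)
  have hfin := finite_simpleClasses R
  have hpos : 0 < s := by
    rw [← hs]
    have : Nonempty (Quotient (simpleModuleSetoid R)) := ⟨cl ⟨0, ht⟩⟩
    exact Nat.card_pos
  by_cases hrep : ∃ d, 0 < d ∧ d < t ∧ E 0 d
  · classical
    obtain ⟨hd0, hdt, hd⟩ := Nat.find_spec hrep
    have hmin : ∀ m, 0 < m → m < Nat.find hrep → ¬ E 0 m := fun m h1 h2 h3 =>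
      Nat.find_min hrep h2 ⟨h1, by omega, h3⟩
    generalize Nat.find hrep = d at *
    have hall : ∀ (T : Type u) [AddCommGroup T] [Module R T] [IsSimpleModule R T],
        ∃ i < d, Nonempty (T ≃ₗ[R] loewyFactor W i) := by
      intro T _ _ _
      have := hW.isSimpleModule ht
      refine hR.factor_dichotomy hconn
        (C := fun T _ _ => ∃ i < d, Nonempty (T ≃ₗ[R] loewyFactor W i)) ?_ ?_
        (loewyFactor W 0) T ⟨0, hd0, Erefl 0⟩
      · rintro T T' _ _ _ _ e ⟨i, hi, ⟨f⟩⟩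
        exact ⟨i, hi, ⟨e.symm.trans f⟩⟩
      · intro T T' _ _ _ _ _ _ hTT
        constructor
        · rintro ⟨i, hi, ⟨e⟩⟩
          have := hW.isSimpleModule (show i + 1 < t by omega)
          have := hW.isSimpleModule (show i < t by omega)
          obtain ⟨f⟩ := hR.follows_unique (hTT.congr e (LinearEquiv.refl _ _))
            (hW.follows hM (show i + 1 < t by omega))
          by_cases hi' : i + 1 < d
          · exact ⟨i + 1, hi', ⟨f⟩⟩
          · obtain rfl : d = i + 1 := by omega
            obtain ⟨g⟩ := hd
            exact ⟨0, hd0, ⟨f.trans g.symm⟩⟩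
        · rintro ⟨i, hi, ⟨e⟩⟩
          have key : ∀ j, j + 1 < t → Nonempty (T' ≃ₗ[R] loewyFactor W (j + 1)) →
              Nonempty (T ≃ₗ[R] loewyFactor W j) := by
            rintro j hj ⟨e⟩
            have := hW.isSimpleModule hj
            have := hW.isSimpleModule (show j < t by omega)
            exact hR.follows_unique_left (hTT.congr (LinearEquiv.refl _ _) e)
              (hW.follows hM hj)
          rcases Nat.eq_zero_or_pos i with rfl | hi0
          · obtain ⟨g⟩ := hd
            refine ⟨d - 1, by omega, key (d - 1) (by omega) ?_⟩
            rw [Nat.sub_add_cancel hd0]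
            exact ⟨e.trans g⟩
          · refine ⟨i - 1, by omega, key (i - 1) (by omega) ?_⟩
            rw [Nat.sub_add_cancel hi0]
            exact ⟨e⟩
    have hds : d = s := by
      have hbij : Function.Bijective (fun i : Fin d => cl ⟨i, by omega⟩) := by
        constructor
        · have main : ∀ i j : Fin d, i ≤ j → E i j → i = j := by
            intro i j hij hE
            by_contra hne
            have hlt : i < j := lt_of_le_of_ne hij hne
            rw [sub i j hij (by omega)] at hE
            exact hmin _ (by omega) (by omega) hE
          intro i j hij
          have hE : E i j := (hcl _ _).1 hij
          rcases le_total i j with h | h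
          · exact main i j h hE
          · exact (main j i h (Esymm hE)).symm
        · intro q
          obtain ⟨T, _, _, _, rfl⟩ := exists_simpleClass_eq q
          obtain ⟨i, hi, ⟨e⟩⟩ := hall T
          exact ⟨⟨i, hi⟩, (simpleClass_eq_iff (h := hsimp ⟨i, by omega⟩)).2 ⟨e.symm⟩⟩
      rw [← hs, numSimples, ← Nat.card_eq_of_bijective _ hbij, Nat.card_fin]
    subst hds
    have hzero : ∀ m, m < t → (E 0 m ↔ m % d = 0) := by
      intro m
      induction m using Nat.strong_induction_on with
      | _ m ih =>
        intro hm
        rcases lt_or_ge m d with h | h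
        · rw [Nat.mod_eq_of_lt h]
          refine ⟨fun hE => ?_, fun h0 => h0 ▸ Erefl 0⟩
          by_contra hne
          exact hmin m (by omega) h hE
        · rw [Nat.mod_eq_sub_mod h, ← ih (m - d) (by omega) (by omega), ← sub d m h hm]
          exact ⟨fun hE => Etrans (Esymm hd) hE, fun hE => Etrans hd hE⟩
    refine { hW with pos := hpos, le := hst, nonempty_equiv_iff := ?_, exists_equiv := hall }
    have main : ∀ i j, i ≤ j → j < t → (E i j ↔ i % d = j % d) := by
      intro i j hij hj
      rw [sub i j hij hj, hzero _ (by omega)]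
      rw [← Nat.dvd_iff_mod_eq_zero, ← Nat.modEq_iff_dvd' hij]
      rfl
    intro i hi j hj
    rcases le_total i j with h | h
    · exact main i j h hj
    · rw [eq_comm, ← main j i h hi]
      exact ⟨Esymm, Esymm⟩
  · have hinj : Function.Injective (fun i : Fin t => cl ⟨i, i.2⟩) := by
      have main : ∀ i j : Fin t, i ≤ j → E i j → i = j := by
        intro i j hij hE
        by_contra hne
        have hlt : i < j := lt_of_le_of_ne hij hne
        rw [sub i j hij (by omega)] at hE
        exact hrep ⟨_, by omega, by omega, hE⟩
      intro i j hij
      have hE : E i j := (hcl _ _).1 hij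
      rcases le_total i j with h | h
      · exact main i j h hE
      · exact (main j i h (Esymm hE)).symm
    have hcard : Nat.card (Fin t) = Nat.card (Quotient (simpleModuleSetoid R)) := by
      apply le_antisymm
      · exact Nat.card_le_card_of_injective _ hinj
      · rw [Nat.card_fin]; exact hs.le.trans hst
    have hst' : t = s := by rw [← hs, numSimples, ← hcard, Nat.card_fin]
    subst hst'
    have hsurj : Function.Surjective (fun i : Fin t => cl ⟨i, i.2⟩) :=
      (Function.Injective.bijective_of_nat_card_le hinj hcard.symm.le).2
    refine { hW with pos := hpos, le := hst, nonempty_equiv_iff := ?_, exists_equiv := ?_ }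
    · intro i hi j hj
      rw [Nat.mod_eq_of_lt hi, Nat.mod_eq_of_lt hj]
      refine ⟨fun hE => ?_, fun h => h ▸ Erefl i⟩
      have := @hinj ⟨i, hi⟩ ⟨j, hj⟩ ((hcl _ _).2 hE)
      simpa using this
    · intro T _ _ _
      obtain ⟨i, hi⟩ := hsurj (simpleClass R T)
      obtain ⟨e⟩ := (simpleClass_eq_iff (h := hsimp ⟨i, i.2⟩)).1 hi
      exact ⟨i, i.2, ⟨e.symm⟩⟩

end Flag

/-! ### Modules annihilated by the annihilator of `M` -/

section AnnLE

variable {R : Type u} [Ring R] {M N N' : Type u} [AddCommGroup M] [Module R M]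
  [AddCommGroup N] [Module R N] [AddCommGroup N'] [Module R N']

variable (R M N) in
/-- The annihilator of `M` annihilates `N`. -/
def AnnLE : Prop := ∀ r : R, (∀ m : M, r • m = 0) → ∀ n : N, r • n = 0

lemma AnnLE.refl : AnnLE R M M := fun _ h => h

lemma AnnLE.of_injective (h : AnnLE R M N') (f : N →ₗ[R] N') (hf : Function.Injective f) :
    AnnLE R M N := fun r hr n => hf (by rw [map_smul, h r hr, map_zero])

lemma AnnLE.of_surjective (h : AnnLE R M N) (f : N →ₗ[R] N') (hf : Function.Surjective f) :
    AnnLE R M N' := fun r hr n => by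
  obtain ⟨n, rfl⟩ := hf n
  rw [← map_smul, h r hr, map_zero]

lemma AnnLE.submodule (h : AnnLE R M N) (A : Submodule R N) : AnnLE R M A :=
  h.of_injective A.subtype A.subtype_injective

lemma AnnLE.quotient (h : AnnLE R M N) (A : Submodule R N) : AnnLE R M (N ⧸ A) :=
  h.of_surjective A.mkQ A.mkQ_surjective

lemma AnnLE.prod (h : AnnLE R M N) (h' : AnnLE R M N') : AnnLE R M (N × N') :=
  fun r hr n => Prod.ext (h r hr n.1) (h' r hr n.2)

lemma AnnLE.pi {ι : Type} {P : ι → Type u} [∀ i, AddCommGroup (P i)] [∀ i, Module R (P i)]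
    (h : ∀ i, AnnLE R M (P i)) : AnnLE R M (Π i, P i) :=
  fun r hr n => funext fun i => h i r hr (n i)

variable (R M) in
/-- Over an artinian ring, finitely many elements of `M` have the same annihilator as `M`. -/
lemma exists_finset_annihilator [IsArtinianRing R] :
    ∃ S : Finset M, ∀ r : R, (∀ x ∈ S, r • x = 0) → ∀ m : M, r • m = 0 := by
  classical
  let K : Finset M → Submodule R R := fun S =>
    ⨅ x ∈ S, LinearMap.ker (LinearMap.toSpanSingleton R M x)
  have hK : ∀ S r, r ∈ K S ↔ ∀ x ∈ S, r • x = 0 := by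
    intro S r
    simp [K, Submodule.mem_iInf]
  obtain ⟨_, ⟨S, rfl⟩, hmin⟩ := wellFounded_lt.has_min (Set.range K) ⟨_, ⟨∅, rfl⟩⟩
  refine ⟨S, fun r hr m => ?_⟩
  have hle : K (insert m S) ≤ K S := by
    intro r hr
    rw [hK] at hr ⊢
    exact fun x hx => hr x (Finset.mem_insert_of_mem hx)
  have heq := eq_of_le_of_not_lt hle (hmin _ ⟨_, rfl⟩)
  have : r ∈ K (insert m S) := by rw [heq, hK]; exact hr
  exact (hK _ _).1 this m (Finset.mem_insert_self _ _)

end AnnLE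

section Relative

variable {R : Type u} [Ring R] {M N N' : Type u} [AddCommGroup M] [Module R M]
  [AddCommGroup N] [Module R N] [AddCommGroup N'] [Module R N']
  {W : ℕ → Submodule R M} {s t : ℕ}

/-- A map into a uniserial module is surjective if it is so modulo the radical. -/
lemma surjective_of_comp_eq_top {S : Type u} [AddCommGroup S] [Module R S] [IsSimpleModule R S]
    (hN' : IsUniserial R N') {p : N →ₗ[R] S} (hp : Function.Surjective p) {p' : N' →ₗ[R] S}
    {f : N →ₗ[R] N'} (hf : p' ∘ₗ f = p) : Function.Surjective f := by
  have := IsSimpleModule.nontrivial R S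
  have hp' : Function.Surjective p' := by
    rw [← hf] at hp
    exact Function.Surjective.of_comp hp
  rw [← LinearMap.range_eq_top]
  apply hN'.eq_top_of_not_le_ker hp'
  intro hle
  obtain ⟨x, hx⟩ := exists_ne (0 : S)
  obtain ⟨y, rfl⟩ := hp x
  exact hx ((LinearMap.congr_fun hf y).symm.trans (hle ⟨y, rfl⟩))

/-- If a family of maps out of a uniserial module is jointly injective, then one of them already
is injective on the socle, hence injective. -/
lemma IsUniserial.exists_injective (hN : IsUniserial R N) [IsArtinian R N] [Nontrivial N]
    {ι : Type*} (π : ι → N →ₗ[R] N') (hπ : ∀ y, (∀ i, π i y = 0) → y = 0) :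
    ∃ i, Function.Injective (π i) := by
  obtain ⟨T, hT, -⟩ := (eq_bot_or_exists_atom_le (⊤ : Submodule R N)).resolve_left top_ne_bot
  obtain ⟨i, hi⟩ : ∃ i, ¬ T ≤ LinearMap.ker (π i) := by
    by_contra! h
    exact hT.1 (eq_bot_iff.2 fun y hy => hπ y fun i => h i hy)
  have hlt := lt_of_le_not_ge ((hN _ _).resolve_left hi) hi
  exact ⟨i, LinearMap.ker_eq_bot.1 (hT.2 _ hlt)⟩

lemma surjective_of_injective_of_length_le [IsNoetherian R N] [IsArtinian R N] (f : N →ₗ[R] N')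
    (hf : Function.Injective f) (hle : Module.length R N' ≤ Module.length R N) :
    Function.Surjective f := by
  have h := Module.length_eq_add_of_exact f (LinearMap.range f).mkQ hf
    (Submodule.mkQ_surjective _) (LinearMap.exact_map_mkQ_range f)
  have hfin := Module.length_ne_top (R := R) (M := N)
  have h0 : Module.length R (N' ⧸ LinearMap.range f) = 0 := by
    have h1 : Module.length R N + Module.length R (N' ⧸ LinearMap.range f) ≤
        Module.length R N + 0 := by rw [← h, add_zero]; exact hle
    exact nonpos_iff_eq_zero.1 ((ENat.add_le_add_iff_left hfin).1 h1)
  rw [Module.length_eq_zero_iff, Submodule.Quotient.subsingleton_iff] at h0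
  exact LinearMap.range_eq_top.1 h0

/-- The image of a nonzero map `W i → M` is a term of the Loewy series with the same top. -/
lemma IsPeriodicLoewySeries.exists_range_eq (hM : IsUniserial R M)
    (hW : IsPeriodicLoewySeries W s t) {i : ℕ} (hi : i < t) (h : W i →ₗ[R] M) (h0 : h ≠ 0) :
    ∃ l < t, LinearMap.range h = W l ∧ l % s = i % s := by
  obtain ⟨l, hl, hWl⟩ := hW.exists_eq hM (LinearMap.range h)
  have hlt : l < t := by
    by_contra hlt
    rw [hW.bot l (by omega)] at hWl
    exact h0 (LinearMap.range_eq_bot.1 hWl.symm)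
  refine ⟨l, hlt, hWl.symm, ?_⟩
  have := hW.isSimpleModule hlt
  let h' : W i →ₗ[R] W l := h.codRestrict _ fun x => hWl ▸ ⟨x, rfl⟩
  have hh' : Function.Surjective h' := by
    rintro ⟨y, hy⟩
    rw [hWl] at hy
    obtain ⟨x, rfl⟩ := hy
    exact ⟨x, rfl⟩
  obtain ⟨e⟩ := hW.nonempty_equiv_of_surjective hM hi
    (((W (l + 1)).submoduleOf (W l)).mkQ ∘ₗ h') ((Submodule.mkQ_surjective _).comp hh')
  exact (hW.nonempty_equiv_iff l hlt i hi).1 ⟨e⟩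

variable [IsArtinianRing R]

/-- A uniserial module annihilated by the annihilator of `M` is a quotient of a submodule of `M`:
cover it by a uniserial submodule of a power of `M`, which then embeds into `M`. -/
lemma IsPeriodicLoewySeries.exists_surjective_of_annLE (hR : IndecomposablesUniserial R)
    (hM : IsUniserial R M) (hW : IsPeriodicLoewySeries W s t) [Module.Finite R N] [Nontrivial N]
    (hN : IsUniserial R N) (hann : AnnLE R M N) :
    ∃ i < t, ∃ g : W i →ₗ[R] N, Function.Surjective g := by
  obtain ⟨S, hS⟩ := exists_finset_annihilator R M
  obtain ⟨H, hH, -⟩ := (eq_top_or_exists_le_coatom (⊥ : Submodule R N)).resolve_left bot_ne_top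
  obtain ⟨u, hu⟩ : ∃ u, u ∉ H := by
    by_contra! h
    exact hH.1 (eq_top_iff.2 fun x _ => h x)
  have hspan : Function.Surjective (LinearMap.toSpanSingleton R N u) := by
    rw [← LinearMap.range_eq_top]
    have hnot : ¬ LinearMap.range (LinearMap.toSpanSingleton R N u) ≤ H := fun h =>
      hu (h ⟨1, by simp⟩)
    exact hH.2 _ (lt_of_le_not_ge ((hN _ _).resolve_left hnot) hnot)
  let x : R →ₗ[R] (S → M) := LinearMap.pi fun m => LinearMap.toSpanSingleton R M m.1
  obtain ⟨f, hf⟩ := exists_comp_eq_of_ker_le x.rangeRestrict x.surjective_rangeRestrict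
    (LinearMap.toSpanSingleton R N u) (by
      intro r hr
      rw [LinearMap.ker_rangeRestrict] at hr
      refine hann r (hS r fun m hm => ?_) u
      exact congrFun (LinearMap.mem_ker.1 hr) ⟨m, hm⟩)
  have hfs : Function.Surjective f := by
    rw [← hf] at hspan
    exact Function.Surjective.of_comp hspan
  obtain ⟨V, hV, hind⟩ := exists_indecomposable_map_eq_top hN f hfs
  have hVu := hR V hind
  have := hind.1
  let π : S → V →ₗ[R] M := fun m => LinearMap.proj m ∘ₗ (LinearMap.range x).subtype ∘ₗ V.subtype
  obtain ⟨m, hinj⟩ := hVu.exists_injective π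
    fun y hy => Subtype.ext (Subtype.ext (funext fun m => hy m))
  obtain ⟨i, hi, hWi⟩ := hW.exists_eq hM (LinearMap.range (π m))
  have e : V ≃ₗ[R] W i := (LinearEquiv.ofInjective (π m) hinj).trans (LinearEquiv.ofEq _ _ hWi.symm)
  refine ⟨i, ?_, f ∘ₗ V.subtype ∘ₗ e.symm.toLinearMap, ?_⟩
  · by_contra hit
    have h1 := hW.bot i (by omega)
    have : Subsingleton (W i) := by rw [h1]; infer_instance
    exact not_subsingleton V e.toEquiv.subsingleton
  · have : Function.Surjective (f ∘ₗ V.subtype) := by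
      rw [← LinearMap.range_eq_top, LinearMap.range_comp, Submodule.range_subtype, hV]
    exact this.comp e.symm.surjective

variable [Module.Finite R M]

/-- Terms of the periodic Loewy series whose indices agree modulo the period are quotients of each
other. -/
lemma IsPeriodicLoewySeries.exists_surjective (hR : IndecomposablesUniserial R)
    (hM : IsUniserial R M) (hW : IsPeriodicLoewySeries W s t) {i j : ℕ} (hij : i ≤ j) (hj : j < t)
    (hmod : i % s = j % s) : ∃ g : W i →ₗ[R] W j, Function.Surjective g := by
  have := hW.isSimpleModule (show i < t by omega)
  obtain ⟨e⟩ := (hW.nonempty_equiv_iff i (by omega) j hj).2 hmod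
  have hp : Function.Surjective ((W (i + 1)).submoduleOf (W i)).mkQ := Submodule.mkQ_surjective _
  have hp' : Function.Surjective (e.symm.toLinearMap ∘ₗ ((W (j + 1)).submoduleOf (W j)).mkQ) :=
    e.symm.surjective.comp (Submodule.mkQ_surjective _)
  rcases hR.exists_map_over_top (hM.submodule (W i)) (hM.submodule (W j)) _ hp _ hp' with
    ⟨f, hf⟩ | ⟨f, hf⟩
  · exact ⟨f, surjective_of_comp_eq_top (hM.submodule (W j)) hp hf⟩
  · have h1 := Module.length_le_of_surjective f
      (surjective_of_comp_eq_top (hM.submodule (W i)) hp' hf)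
    rw [hW.length_add (by omega), hW.length_add (by omega), Nat.cast_le] at h1
    obtain rfl : i = j := by omega
    exact ⟨LinearMap.id, Function.surjective_id⟩

/-- If the top of `N` is the top of `W i` with `i < s`, then `W i` covers `N`. -/
lemma IsPeriodicLoewySeries.exists_surjective_of_top (hR : IndecomposablesUniserial R)
    (hM : IsUniserial R M) (hW : IsPeriodicLoewySeries W s t) [Module.Finite R N]
    (hN : IsUniserial R N) (hann : AnnLE R M N) {i : ℕ} (hi : i < s)
    {T : Type u} [AddCommGroup T] [Module R T] [IsSimpleModule R T] (q : N →ₗ[R] T)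
    (hq : Function.Surjective q) (e : T ≃ₗ[R] loewyFactor W i) :
    ∃ g : W i →ₗ[R] N, Function.Surjective g := by
  have := IsSimpleModule.nontrivial R T
  have : Nontrivial N := hq.nontrivial
  obtain ⟨j, hj, g, hg⟩ := hW.exists_surjective_of_annLE hR hM hN hann
  obtain ⟨e'⟩ := hW.nonempty_equiv_of_surjective hM hj (q ∘ₗ g) (hq.comp hg)
  have hle := hW.le
  have hmod := (hW.nonempty_equiv_iff i (by omega) j hj).1 ⟨e.symm.trans e'⟩
  have hij : i ≤ j := by
    rw [Nat.mod_eq_of_lt hi] at hmod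
    rw [hmod]
    exact Nat.mod_le _ _
  obtain ⟨f, hf⟩ := hW.exists_surjective hR hM hij hj hmod
  exact ⟨g ∘ₗ f, hg.comp hf⟩

variable (R M) in
/-- `Q` is projective relative to the finitely generated modules annihilated by the annihilator of
`M`. -/
def IsAnnProjective (Q : Type u) [AddCommGroup Q] [Module R Q] : Prop :=
  ∀ (N N' : Type u) [AddCommGroup N] [Module R N] [AddCommGroup N'] [Module R N']
    [Module.Finite R N], AnnLE R M N → ∀ f : N →ₗ[R] N', Function.Surjective f →
    ∀ g : Q →ₗ[R] N', ∃ h : Q →ₗ[R] N, f ∘ₗ h = g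

/-- The first `s` terms of the Loewy series are projective relative to the finitely generated
modules annihilated by the annihilator of `M`: an indecomposable submodule of the pullback which
maps onto `W i` is itself a quotient of `W i`, so it maps isomorphically. -/
lemma IsPeriodicLoewySeries.isAnnProjective (hR : IndecomposablesUniserial R)
    (hM : IsUniserial R M) (hW : IsPeriodicLoewySeries W s t) {i : ℕ} (hi : i < s) :
    IsAnnProjective R M (W i) := by
  intro N N' _ _ _ _ _ hann f hf g
  have hle := hW.le
  have hsimp := hW.isSimpleModule (show i < t by omega)
  have := IsSimpleModule.nontrivial R (loewyFactor W i)
  have hq : Function.Surjective ((W (i + 1)).submoduleOf (W i)).mkQ := Submodule.mkQ_surjective _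
  have : Nontrivial (W i) := hq.nontrivial
  let P : Submodule R (W i × N) :=
    LinearMap.ker (g ∘ₗ LinearMap.fst R (W i) N - f ∘ₗ LinearMap.snd R (W i) N)
  have hP : ∀ x : P, g x.1.1 = f x.1.2 := fun x => sub_eq_zero.1 x.2
  let a : P →ₗ[R] W i := LinearMap.fst R (W i) N ∘ₗ P.subtype
  have ha : Function.Surjective a := by
    intro x
    obtain ⟨y, hy⟩ := hf (g x)
    exact ⟨⟨(x, y), sub_eq_zero.2 hy.symm⟩, rfl⟩
  obtain ⟨U, hU, hind⟩ := exists_indecomposable_map_eq_top (hM.submodule (W i)) a ha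
  have hUu := hR U hind
  let a' : U →ₗ[R] W i := a ∘ₗ U.subtype
  have ha' : Function.Surjective a' := by
    rw [← LinearMap.range_eq_top, LinearMap.range_comp, Submodule.range_subtype, hU]
  have hannU : AnnLE R M U :=
    (((AnnLE.refl.submodule (W i)).prod hann).submodule P).submodule U
  obtain ⟨c, hc⟩ := hW.exists_surjective_of_top hR hM hUu hannU hi
    (((W (i + 1)).submoduleOf (W i)).mkQ ∘ₗ a') (hq.comp ha') (LinearEquiv.refl _ _)
  have hinj : Function.Injective (a' ∘ₗ c) :=
    IsNoetherian.injective_of_surjective_endomorphism (a' ∘ₗ c) (ha'.comp hc)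
  have hinj' : Function.Injective a' := by
    intro x y hxy
    obtain ⟨x, rfl⟩ := hc x
    obtain ⟨y, rfl⟩ := hc y
    rw [hinj hxy]
  let e := LinearEquiv.ofBijective a' ⟨hinj', ha'⟩
  refine ⟨LinearMap.snd R (W i) N ∘ₗ P.subtype ∘ₗ U.subtype ∘ₗ e.symm.toLinearMap, ?_⟩
  ext x
  obtain ⟨y, rfl⟩ := e.surjective x
  simp only [LinearMap.comp_apply, LinearEquiv.coe_coe, LinearEquiv.symm_apply_apply]
  exact (hP y.1).symm

/-- `M` is injective relative to the finitely generated modules annihilated by its annihilator: an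
indecomposable quotient of the pushout containing `M` is a quotient of some `W j`, so its length is
at most that of `M`. -/
lemma IsPeriodicLoewySeries.exists_extension (hR : IndecomposablesUniserial R)
    (hM : IsUniserial R M) (hW : IsPeriodicLoewySeries W s t) [Module.Finite R N']
    (hann : AnnLE R M N') (i : N →ₗ[R] N') (hi : Function.Injective i) (g : N →ₗ[R] M) :
    ∃ h : N' →ₗ[R] M, h ∘ₗ i = g := by
  have : Nontrivial M := by
    rw [← Module.length_pos_iff (R := R), hW.length_eq]
    exact_mod_cast hW.pos.trans_le hW.le
  let D : Submodule R (M × N') := LinearMap.range (g.prod (-i))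
  let a : M →ₗ[R] ((M × N') ⧸ D) := D.mkQ ∘ₗ LinearMap.inl R M N'
  let b : N' →ₗ[R] ((M × N') ⧸ D) := D.mkQ ∘ₗ LinearMap.inr R M N'
  have hab : a ∘ₗ g = b ∘ₗ i := by
    ext x
    rw [← sub_eq_zero]
    simp only [a, b, LinearMap.comp_apply, ← map_sub]
    exact (Submodule.Quotient.mk_eq_zero D).2 ⟨x, by simp⟩
  have ha : Function.Injective a := by
    rw [← LinearMap.ker_eq_bot, eq_bot_iff]
    intro x hx
    obtain ⟨y, hy⟩ := (Submodule.Quotient.mk_eq_zero D).1 (show D.mkQ (x, 0) = 0 from hx)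
    have h1 : g y = x := congrArg Prod.fst hy
    have h2 : - i y = 0 := congrArg Prod.snd hy
    have h3 : y = 0 := hi (by simpa using h2)
    simp [← h1, h3]
  obtain ⟨K, hK, hind⟩ := exists_indecomposable_quotient hM a ha
  have hE := hR _ hind
  have := hind.1
  have hannE : AnnLE R M (((M × N') ⧸ D) ⧸ K) := ((AnnLE.refl.prod hann).quotient D).quotient K
  obtain ⟨j, hj, c, hc⟩ := hW.exists_surjective_of_annLE hR hM hE hannE
  have hsurj : Function.Surjective (K.mkQ ∘ₗ a) := by
    apply surjective_of_injective_of_length_le _ hK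
    exact (Module.length_le_of_surjective c hc).trans
      (Module.length_le_of_injective (W j).subtype (W j).subtype_injective)
  let e := LinearEquiv.ofBijective (K.mkQ ∘ₗ a) ⟨hK, hsurj⟩
  refine ⟨e.symm.toLinearMap ∘ₗ K.mkQ ∘ₗ b, ?_⟩
  ext x
  simp only [LinearMap.comp_apply, LinearEquiv.coe_coe]
  rw [LinearEquiv.symm_apply_eq]
  exact congrArg K.mkQ (LinearMap.congr_fun hab x).symm

end Relative

/-! ### The perpendicular category -/

section Perpendicular

variable {R : Type u} [Ring R] {M : Type u} [AddCommGroup M] [Module R M]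

/-- Let `W` be the periodic Loewy series of `M`. The modules `N` annihilated by the annihilator of
`M` which are (`Hom`- and `Ext¹`-)perpendicular to the simple modules `W i / W (i + 1)`, for those
`i < s` for which neither `i + 1 = s` nor `i + 1 = t % s`. Both conditions are expressed through
the presentation `W (i + 1) → W i` of this simple module, which is projective relative to these
modules. -/
structure IsPerpendicular (W : ℕ → Submodule R M) (s t : ℕ) (N : Type u) [AddCommGroup N]
    [Module R N] : Prop where
  ann : AnnLE R M N
  unique : ∀ i, i + 1 < s → i + 1 ≠ t % s → ∀ h : W i →ₗ[R] N,
    (∀ x : W i, x.1 ∈ W (i + 1) → h x = 0) → h = 0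
  extend : ∀ i, i + 1 < s → i + 1 ≠ t % s → ∀ f : W (i + 1) →ₗ[R] N,
    ∃ g : W i →ₗ[R] N, ∀ (x : W i) (hx : x.1 ∈ W (i + 1)), g x = f ⟨x.1, hx⟩

variable {N N' N'' : Type u} [AddCommGroup N] [Module R N] [AddCommGroup N'] [Module R N']
  [AddCommGroup N''] [Module R N''] {W : ℕ → Submodule R M} {s t : ℕ}

namespace IsPerpendicular

lemma congr (h : IsPerpendicular W s t N) (e : N ≃ₗ[R] N') : IsPerpendicular W s t N' where
  ann := h.ann.of_injective e.symm.toLinearMap e.symm.injective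
  unique i hi hi' f hf := by
    have := h.unique i hi hi' (e.symm.toLinearMap ∘ₗ f) fun x hx => by simp [hf x hx]
    ext x
    exact e.symm.injective ((LinearMap.congr_fun this x).trans (map_zero e.symm).symm)
  extend i hi hi' f := by
    obtain ⟨g, hg⟩ := h.extend i hi hi' (e.symm.toLinearMap ∘ₗ f)
    exact ⟨e.toLinearMap ∘ₗ g, fun x hx => by simp [hg x hx]⟩

lemma pi {ι : Type} {P : ι → Type u} [∀ i, AddCommGroup (P i)] [∀ i, Module R (P i)]
    (h : ∀ i, IsPerpendicular W s t (P i)) : IsPerpendicular W s t (Π i, P i) where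
  ann := AnnLE.pi fun i => (h i).ann
  unique i hi hi' f hf := by
    ext x j
    exact LinearMap.congr_fun ((h j).unique i hi hi' (LinearMap.proj j ∘ₗ f) fun x hx =>
      congrFun (hf x hx) j) x
  extend i hi hi' f := by
    choose g hg using fun j => (h j).extend i hi hi' (LinearMap.proj j ∘ₗ f)
    exact ⟨LinearMap.pi g, fun x hx => funext fun j => hg j x hx⟩

lemma prod (h : IsPerpendicular W s t N) (h' : IsPerpendicular W s t N') :
    IsPerpendicular W s t (N × N') where
  ann := h.ann.prod h'.ann
  unique i hi hi' f hf := by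
    ext x
    · exact LinearMap.congr_fun (h.unique i hi hi' (LinearMap.fst R N N' ∘ₗ f) fun x hx =>
        congrArg Prod.fst (hf x hx)) x
    · exact LinearMap.congr_fun (h'.unique i hi hi' (LinearMap.snd R N N' ∘ₗ f) fun x hx =>
        congrArg Prod.snd (hf x hx)) x
  extend i hi hi' f := by
    obtain ⟨g, hg⟩ := h.extend i hi hi' (LinearMap.fst R N N' ∘ₗ f)
    obtain ⟨g', hg'⟩ := h'.extend i hi hi' (LinearMap.snd R N N' ∘ₗ f)
    exact ⟨g.prod g', fun x hx => Prod.ext (hg x hx) (hg' x hx)⟩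

/-- The perpendicular category is closed under kernels. -/
lemma of_ker (h : IsPerpendicular W s t N) (h' : IsPerpendicular W s t N') (f : N →ₗ[R] N')
    (j : N'' →ₗ[R] N) (hj : Function.Injective j) (hjf : LinearMap.range j = LinearMap.ker f) :
    IsPerpendicular W s t N'' where
  ann := h.ann.of_injective j hj
  unique i hi hi' g hg := by
    have := h.unique i hi hi' (j ∘ₗ g) fun x hx => by simp [hg x hx]
    ext x
    exact hj ((LinearMap.congr_fun this x).trans (map_zero j).symm)
  extend i hi hi' g := by
    obtain ⟨a, ha⟩ := h.extend i hi hi' (j ∘ₗ g)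
    have hfj : ∀ x, f (j x) = 0 := fun x => by
      have : j x ∈ LinearMap.ker f := hjf ▸ ⟨x, rfl⟩
      exact this
    have hfa := h'.unique i hi hi' (f ∘ₗ a) fun x hx => by
      rw [LinearMap.comp_apply, ha x hx]
      exact hfj _
    obtain ⟨b, hb⟩ := exists_comp_eq_of_range_le j hj a (by
      rw [hjf]
      rintro _ ⟨x, rfl⟩
      exact LinearMap.congr_fun hfa x)
    refine ⟨b, fun x hx => hj ?_⟩
    exact (LinearMap.congr_fun hb x).trans (ha x hx)

lemma ker (h : IsPerpendicular W s t N) (h' : IsPerpendicular W s t N') (f : N →ₗ[R] N') :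
    IsPerpendicular W s t (LinearMap.ker f) :=
  h.of_ker h' f (LinearMap.ker f).subtype (Submodule.subtype_injective _)
    (Submodule.range_subtype _)

variable [IsArtinianRing R] [Module.Finite R M]

/-- The perpendicular category is closed under cokernels. -/
lemma of_coker (hR : IndecomposablesUniserial R) (hM : IsUniserial R M)
    (hW : IsPeriodicLoewySeries W s t) [Module.Finite R N] [Module.Finite R N']
    (h : IsPerpendicular W s t N) (h' : IsPerpendicular W s t N') (f : N →ₗ[R] N')
    (c : N' →ₗ[R] N'') (hc : Function.Surjective c) (hfc : LinearMap.range f = LinearMap.ker c) :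
    IsPerpendicular W s t N'' where
  ann := h'.ann.of_surjective c hc
  unique i hi hi' g hg := by
    have hle : W (i + 1) ≤ W i := hW.antitone (Nat.le_succ i)
    obtain ⟨g', hg'⟩ := hW.isAnnProjective hR hM (show i < s by omega) _ _ h'.ann c hc g
    have hmem : ∀ x : W (i + 1), (g' ∘ₗ Submodule.inclusion hle) x ∈ LinearMap.range f := fun x => by
      rw [hfc]
      exact (LinearMap.congr_fun hg' _).trans (hg _ x.2)
    obtain ⟨a, ha⟩ := hW.isAnnProjective hR hM hi _ _ h.ann f.rangeRestrict
      f.surjective_rangeRestrict ((g' ∘ₗ Submodule.inclusion hle).codRestrict _ hmem)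
    obtain ⟨b, hb⟩ := h.extend i hi hi' a
    have hz := h'.unique i hi hi' (g' - f ∘ₗ b) fun x hx => by
      have := congrArg Subtype.val (LinearMap.congr_fun ha ⟨x.1, hx⟩)
      rw [LinearMap.sub_apply, sub_eq_zero, LinearMap.comp_apply, hb x hx]
      exact this.symm
    ext x
    have h1 : g' x = f (b x) := sub_eq_zero.1 (LinearMap.congr_fun hz x)
    have h2 : f (b x) ∈ LinearMap.ker c := hfc ▸ ⟨_, rfl⟩
    rw [← hg', LinearMap.comp_apply, h1]
    exact h2
  extend i hi hi' g := by
    obtain ⟨g', hg'⟩ := hW.isAnnProjective hR hM hi _ _ h'.ann c hc g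
    obtain ⟨b, hb⟩ := h'.extend i hi hi' g'
    refine ⟨c ∘ₗ b, fun x hx => ?_⟩
    rw [LinearMap.comp_apply, hb x hx]
    exact LinearMap.congr_fun hg' _

lemma range (hR : IndecomposablesUniserial R) (hM : IsUniserial R M)
    (hW : IsPeriodicLoewySeries W s t) [Module.Finite R N] [Module.Finite R N']
    (h : IsPerpendicular W s t N) (h' : IsPerpendicular W s t N') (f : N →ₗ[R] N') :
    IsPerpendicular W s t (LinearMap.range f) :=
  h'.of_ker (of_coker hR hM hW h h' f (LinearMap.range f).mkQ (Submodule.mkQ_surjective _)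
    (Submodule.ker_mkQ _).symm) (LinearMap.range f).mkQ (LinearMap.range f).subtype
    (Submodule.subtype_injective _) (by rw [Submodule.range_subtype, Submodule.ker_mkQ])

lemma quotient (hR : IndecomposablesUniserial R) (hM : IsUniserial R M)
    (hW : IsPeriodicLoewySeries W s t) [Module.Finite R N] (h : IsPerpendicular W s t N)
    {A : Submodule R N} (hA : IsPerpendicular W s t A) : IsPerpendicular W s t (N ⧸ A) :=
  have : Module.Finite R A := Module.Finite.of_fg (IsNoetherian.noetherian A)
  of_coker hR hM hW hA h A.subtype A.mkQ (Submodule.mkQ_surjective _)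
    (by rw [Submodule.range_subtype, Submodule.ker_mkQ])

/-- The simple quotients of the modules of the perpendicular category are tops of `W 0` or of
`W (t % s)`. -/
lemma eq_of_surjective (hR : IndecomposablesUniserial R) (hM : IsUniserial R M)
    (hW : IsPeriodicLoewySeries W s t) [Module.Finite R N] (h : IsPerpendicular W s t N)
    {T : Type u} [AddCommGroup T] [Module R T] [IsSimpleModule R T] (p : N →ₗ[R] T)
    (hp : Function.Surjective p) {i : ℕ} (hi : i < s) (e : T ≃ₗ[R] loewyFactor W i) :
    i = 0 ∨ i = t % s := by
  by_contra! hcon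
  obtain ⟨j, rfl⟩ := Nat.exists_eq_succ_of_ne_zero hcon.1
  have hst := hW.le
  obtain ⟨g, hg⟩ := hW.isAnnProjective hR hM hi _ _ h.ann p hp
    (e.symm.toLinearMap ∘ₗ ((W (j + 1 + 1)).submoduleOf (W (j + 1))).mkQ)
  have hpg : Function.Surjective (p ∘ₗ g) := by
    rw [hg]
    exact e.symm.surjective.comp (Submodule.mkQ_surjective _)
  obtain ⟨g', hg'⟩ := h.extend j hi hcon.2 g
  have hle : W (j + 1) ≤ W j := hW.antitone (Nat.le_succ j)
  have hval : ∀ x : W (j + 1), g' ⟨x.1, hle x.2⟩ = g x := fun x => hg' ⟨x.1, hle x.2⟩ x.2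
  have hpg' : Function.Surjective (p ∘ₗ g') := fun y => by
    obtain ⟨x, rfl⟩ := hpg y
    exact ⟨⟨x.1, hle x.2⟩, congrArg p (hval x)⟩
  have htop := (hM.submodule (W j)).eq_top_of_not_le_ker hpg' (A := (W (j + 1)).submoduleOf (W j))
    (fun hk => by
      have := IsSimpleModule.nontrivial R T
      obtain ⟨y, hy⟩ := exists_ne (0 : T)
      obtain ⟨x, rfl⟩ := hpg y
      refine hy ?_
      have : p (g' ⟨x.1, hle x.2⟩) = 0 := hk (show x.1 ∈ W (j + 1) from x.2)
      rwa [hval] at this)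
  exact (hW.lt_of_lt (Nat.lt_succ_self j) (by omega)).not_ge (Submodule.submoduleOf_eq_top.1 htop)

/-- A module of the perpendicular category is generated by the images of `W 0` and
`W (t % s)`. -/
lemma eq_top (hR : IndecomposablesUniserial R) (hM : IsUniserial R M)
    (hW : IsPeriodicLoewySeries W s t) [Module.Finite R N] (h : IsPerpendicular W s t N)
    (Z : Submodule R N) (h0 : ∀ f : W 0 →ₗ[R] N, LinearMap.range f ≤ Z)
    (h1 : ∀ f : W (t % s) →ₗ[R] N, LinearMap.range f ≤ Z) : Z = ⊤ := by
  by_contra hZ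
  obtain ⟨H, hH, hZH⟩ := (eq_top_or_exists_le_coatom Z).resolve_left hZ
  have : IsSimpleModule R (N ⧸ H) := isSimpleModule_iff_isCoatom.2 hH
  obtain ⟨i, hi, ⟨e⟩⟩ := hW.exists_equiv (N ⧸ H)
  have hst := hW.le
  have hsimp := hW.isSimpleModule (show i < t by omega)
  obtain ⟨g, hg⟩ := hW.isAnnProjective hR hM hi _ _ h.ann H.mkQ (Submodule.mkQ_surjective _)
    (e.symm.toLinearMap ∘ₗ ((W (i + 1)).submoduleOf (W i)).mkQ)
  have hgZ : LinearMap.range g ≤ Z := by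
    rcases h.eq_of_surjective hR hM hW H.mkQ (Submodule.mkQ_surjective _) hi e with rfl | rfl
    · exact h0 g
    · exact h1 g
  have := IsSimpleModule.nontrivial R (N ⧸ H)
  obtain ⟨y, hy⟩ := exists_ne (0 : N ⧸ H)
  obtain ⟨x, hx⟩ := Submodule.mkQ_surjective ((W (i + 1)).submoduleOf (W i)) (e y)
  apply hy
  have h2 : H.mkQ (g x) = y := (LinearMap.congr_fun hg x).trans (by simp [hx])
  rw [← h2]
  exact (Submodule.Quotient.mk_eq_zero H).2 (hZH (hgZ ⟨x, rfl⟩))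

end IsPerpendicular

namespace IsPeriodicLoewySeries

lemma ker_eq_of_range_eq (hM : IsUniserial R M) (hW : IsPeriodicLoewySeries W s t)
    {l : ℕ} {φ : M →ₗ[R] N} (hφ : Module.length R (LinearMap.range φ) = l) :
    LinearMap.ker φ = W l := by
  obtain ⟨j, hj, hWj⟩ := hW.exists_eq hM (LinearMap.ker φ)
  have h := Module.length_eq_add_of_exact (LinearMap.ker φ).subtype φ.rangeRestrict
    (Submodule.subtype_injective _) φ.surjective_rangeRestrict (by
      rw [LinearMap.exact_iff, LinearMap.ker_rangeRestrict, Submodule.range_subtype])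
  rw [hφ, ← hWj, hW.length_add hj, hW.length_eq] at h
  have h' : t = t - j + l := by exact_mod_cast h
  rw [← hWj]
  congr 1
  omega

variable [IsArtinianRing R] [Module.Finite R M]

lemma isPerpendicular_self (hR : IndecomposablesUniserial R) (hM : IsUniserial R M)
    (hW : IsPeriodicLoewySeries W s t) : IsPerpendicular W s t M where
  ann := AnnLE.refl
  unique i hi hi' h hh := by
    by_contra h0
    have hst := hW.le
    obtain ⟨l, hl, hrange, hmod⟩ := hW.exists_range_eq hM (show i < t by omega) h h0
    have := hW.isSimpleModule (show i < t by omega)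
    obtain ⟨g, hg⟩ := exists_comp_eq_of_ker_le ((W (i + 1)).submoduleOf (W i)).mkQ
      (Submodule.mkQ_surjective _) h.rangeRestrict (by
        intro x hx
        rw [Submodule.ker_mkQ] at hx
        exact Subtype.ext (hh x hx))
    have hgs : Function.Surjective g := by
      have := h.surjective_rangeRestrict
      rw [← hg] at this
      exact Function.Surjective.of_comp this
    have hlen := Module.length_le_of_surjective g hgs
    rw [Module.length_eq_one R (loewyFactor W i), hrange, hW.length_add hl.le] at hlen
    have hlen' : t - l ≤ 1 := by exact_mod_cast hlen
    apply hi'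
    obtain rfl : t = l + 1 := by omega
    rw [Nat.add_mod, hmod, Nat.mod_eq_of_lt (show i < s by omega),
      Nat.mod_eq_of_lt (show 1 < s by omega), Nat.mod_eq_of_lt hi]
  extend i hi hi' f := by
    have hle : W (i + 1) ≤ W i := hW.antitone (Nat.le_succ i)
    obtain ⟨g, hg⟩ := hW.exists_extension hR hM (AnnLE.refl.submodule (W i))
      (Submodule.inclusion hle) (Submodule.inclusion_injective _) f
    exact ⟨g, fun x hx => LinearMap.congr_fun hg ⟨x.1, hx⟩⟩

/-- Terms of the Loewy series with index divisible by `s` are images of endomorphisms of `M`. -/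
lemma exists_end_range_eq (hR : IndecomposablesUniserial R) (hM : IsUniserial R M)
    (hW : IsPeriodicLoewySeries W s t) {l : ℕ} (hl : l % s = 0) :
    ∃ φ : M →ₗ[R] M, LinearMap.range φ = W l := by
  rcases lt_or_ge l t with h | h
  · obtain ⟨g, hg⟩ := hW.exists_surjective hR hM (Nat.zero_le l) h (by rw [hl, Nat.zero_mod])
    refine ⟨(W l).subtype ∘ₗ g ∘ₗ LinearMap.codRestrict (W 0) LinearMap.id fun x => by
      rw [hW.zero]; trivial, ?_⟩
    rw [LinearMap.range_comp, LinearMap.range_eq_top.2, Submodule.map_subtype_top]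
    refine hg.comp fun x => ⟨x.1, rfl⟩
  · exact ⟨0, by rw [LinearMap.range_zero, hW.bot l h]⟩

/-- Terms of the Loewy series with index congruent to `0` or `t` modulo `s` are images or kernels
of endomorphisms of `M`, hence perpendicular. -/
lemma isPerpendicular (hR : IndecomposablesUniserial R) (hM : IsUniserial R M)
    (hW : IsPeriodicLoewySeries W s t) {l : ℕ} (hl : l ≤ t) (h : l % s = 0 ∨ l % s = t % s) :
    IsPerpendicular W s t (W l) := by
  have hMp := hW.isPerpendicular_self hR hM
  rcases h with h | h
  · obtain ⟨φ, hφ⟩ := hW.exists_end_range_eq hR hM h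
    rw [← hφ]
    exact IsPerpendicular.range hR hM hW hMp hMp φ
  · have hd : (t - l) % s = 0 := Nat.sub_mod_eq_zero_of_mod_eq h.symm
    obtain ⟨φ, hφ⟩ := hW.exists_end_range_eq hR hM hd
    rw [← hW.ker_eq_of_range_eq hM (φ := φ) (by
      rw [hφ, hW.length_add (by omega), Nat.sub_sub_self hl])]
    exact hMp.ker hMp φ

lemma mod_eq_of_isPerpendicular (hR : IndecomposablesUniserial R) (hM : IsUniserial R M)
    (hW : IsPeriodicLoewySeries W s t) {l : ℕ} (hl : l < t) (h : IsPerpendicular W s t (W l)) :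
    l % s = 0 ∨ l % s = t % s := by
  have := hW.isSimpleModule hl
  have hlt := Nat.mod_lt l hW.pos
  have hst := hW.le
  obtain ⟨e⟩ := (hW.nonempty_equiv_iff l hl (l % s) (by omega)).2 (Nat.mod_mod l s).symm
  exact h.eq_of_surjective hR hM hW ((W (l + 1)).submoduleOf (W l)).mkQ
    (Submodule.mkQ_surjective _) hlt e

end IsPeriodicLoewySeries

end Perpendicular

/-! ### Generators of the perpendicular category -/

section Generator

variable {R : Type u} [Ring R] {M : Type u} [AddCommGroup M] [Module R M]
  {N N' Q Q' : Type u} [AddCommGroup N] [Module R N] [AddCommGroup N'] [Module R N']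
  [AddCommGroup Q] [Module R Q] [AddCommGroup Q'] [Module R Q']
  {W : ℕ → Submodule R M} {s t : ℕ}

lemma IsAnnProjective.congr (h : IsAnnProjective R M Q) (e : Q ≃ₗ[R] Q') :
    IsAnnProjective R M Q' := by
  intro N N' _ _ _ _ _ hann f hf g
  obtain ⟨a, ha⟩ := h N N' hann f hf (g ∘ₗ e.toLinearMap)
  refine ⟨a ∘ₗ e.symm.toLinearMap, ?_⟩
  rw [← LinearMap.comp_assoc, ha]
  ext x
  simp

lemma IsAnnProjective.prod (h : IsAnnProjective R M Q) (h' : IsAnnProjective R M Q') :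
    IsAnnProjective R M (Q × Q') := by
  intro N N' _ _ _ _ _ hann f hf g
  obtain ⟨a, ha⟩ := h N N' hann f hf (g ∘ₗ LinearMap.inl R Q Q')
  obtain ⟨b, hb⟩ := h' N N' hann f hf (g ∘ₗ LinearMap.inr R Q Q')
  refine ⟨a.coprod b, ?_⟩
  rw [LinearMap.comp_coprod, ha, hb, ← LinearMap.comp_coprod, LinearMap.coprod_inl_inr,
    LinearMap.comp_id]

/-- `Q` is a projective generator of the perpendicular category of `W`. -/
structure IsPerpGenerator (W : ℕ → Submodule R M) (s t : ℕ) (Q : Type u) [AddCommGroup Q]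
    [Module R Q] : Prop where
  annProjective : IsAnnProjective R M Q
  isPerpendicular : IsPerpendicular W s t Q
  exists_zero : ∃ p : Q →ₗ[R] W 0, Function.Surjective p
  exists_mod : ∃ p : Q →ₗ[R] W (t % s), Function.Surjective p

namespace IsPerpGenerator

lemma isQuasiProjective [Module.Finite R Q] (hQ : IsPerpGenerator W s t Q) :
    IsQuasiProjective R Q := fun _ _ _ _ p hp g =>
  hQ.annProjective _ _ (AnnLE.pi fun _ => hQ.isPerpendicular.ann) p hp g

variable [IsArtinianRing R] [Module.Finite R M]

lemma isGeneratedBy_top (hR : IndecomposablesUniserial R) (hM : IsUniserial R M)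
    (hW : IsPeriodicLoewySeries W s t) (hQ : IsPerpGenerator W s t Q) [Module.Finite R N]
    (hN : IsPerpendicular W s t N) : IsGeneratedBy Q (⊤ : Submodule R N) := by
  have key : ∀ {l : ℕ}, (∃ p : Q →ₗ[R] W l, Function.Surjective p) → ∀ f : W l →ₗ[R] N,
      LinearMap.range f ≤ homTrace Q (⊤ : Submodule R N) := by
    rintro l ⟨p, hp⟩ f _ ⟨x, rfl⟩
    obtain ⟨y, rfl⟩ := hp x
    exact apply_mem_homTrace (f ∘ₗ p) (fun _ => Submodule.mem_top) y
  exact (hN.eq_top hR hM hW _ (key hQ.exists_zero) (key hQ.exists_mod)).ge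

lemma isGeneratedBy (hR : IndecomposablesUniserial R) (hM : IsUniserial R M)
    (hW : IsPeriodicLoewySeries W s t) (hQ : IsPerpGenerator W s t Q) [Module.Finite R N]
    {A : Submodule R N} (hA : IsPerpendicular W s t A) : IsGeneratedBy Q A := by
  have : Module.Finite R A := Module.Finite.of_fg (IsNoetherian.noetherian A)
  have h := (hQ.isGeneratedBy_top hR hM hW hA).map A.subtype
  rwa [Submodule.map_subtype_top] at h

/-- The perpendicular category consists of the modules presented by its projective generator. -/
lemma isPerpendicular_iff (hR : IndecomposablesUniserial R) (hM : IsUniserial R M)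
    (hW : IsPeriodicLoewySeries W s t) (hQ : IsPerpGenerator W s t Q) [Module.Finite R Q]
    [Module.Finite R N] : IsPerpendicular W s t N ↔ IsPresentedBy (R := R) Q N := by
  constructor
  · intro hN
    obtain ⟨n, p, hp⟩ := (hQ.isGeneratedBy_top hR hM hW hN).exists_range_eq
      (IsNoetherian.noetherian _)
    exact ⟨n, p, LinearMap.range_eq_top.1 hp, hQ.isGeneratedBy hR hM hW
      ((IsPerpendicular.pi fun _ => hQ.isPerpendicular).ker hN p)⟩
  · rintro ⟨n, p, hp, hK⟩
    obtain ⟨m, q, hq⟩ := hK.exists_range_eq (IsNoetherian.noetherian _)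
    exact IsPerpendicular.of_coker hR hM hW (IsPerpendicular.pi fun _ => hQ.isPerpendicular)
      (IsPerpendicular.pi fun _ => hQ.isPerpendicular) q p hp hq

end IsPerpGenerator

namespace IsPeriodicLoewySeries

/-- The first term of a Loewy series is the whole module. -/
def equivZero (hW : IsPeriodicLoewySeries W s t) : M ≃ₗ[R] W 0 :=
  Submodule.topEquiv.symm.trans (LinearEquiv.ofEq _ _ hW.zero.symm)

variable [IsArtinianRing R] [Module.Finite R M]

lemma isPerpGenerator_self (hR : IndecomposablesUniserial R) (hM : IsUniserial R M)
    (hW : IsPeriodicLoewySeries W s t) (hst : s ∣ t) : IsPerpGenerator W s t M where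
  annProjective := (hW.isAnnProjective hR hM hW.pos).congr hW.equivZero.symm
  isPerpendicular := hW.isPerpendicular_self hR hM
  exists_zero := ⟨hW.equivZero, hW.equivZero.surjective⟩
  exists_mod := by
    rw [Nat.mod_eq_zero_of_dvd hst]
    exact ⟨hW.equivZero, hW.equivZero.surjective⟩

lemma isPerpGenerator_prod (hR : IndecomposablesUniserial R) (hM : IsUniserial R M)
    (hW : IsPeriodicLoewySeries W s t) : IsPerpGenerator W s t (M × W (t % s)) where
  annProjective := ((hW.isAnnProjective hR hM hW.pos).congr hW.equivZero.symm).prod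
    (hW.isAnnProjective hR hM (Nat.mod_lt t hW.pos))
  isPerpendicular := (hW.isPerpendicular_self hR hM).prod
    (hW.isPerpendicular hR hM (Nat.mod_le t s) (Or.inr (Nat.mod_mod t s)))
  exists_zero := ⟨hW.equivZero.toLinearMap ∘ₗ LinearMap.fst R M _,
    hW.equivZero.surjective.comp Prod.fst_surjective⟩
  exists_mod := ⟨LinearMap.snd R M _, Prod.snd_surjective⟩

lemma isQuasiProjective_self (hR : IndecomposablesUniserial R) (hM : IsUniserial R M)
    (hW : IsPeriodicLoewySeries W s t) : IsQuasiProjective R M := fun _ _ _ _ p hp g =>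
  (hW.isAnnProjective hR hM hW.pos).congr hW.equivZero.symm _ _
    (AnnLE.pi fun _ => AnnLE.refl) p hp g

end IsPeriodicLoewySeries

end Generator

/-! ### Quotients of `M` -/

section Bracket

variable {R : Type u} [Ring R] {M : Type u} [AddCommGroup M] [Module R M]
  {N N' S : Type u} [AddCommGroup N] [Module R N] [AddCommGroup N'] [Module R N']
  [AddCommGroup S] [Module R S] {W : ℕ → Submodule R M} {s t : ℕ}

lemma IsUniserial.isSimpleModule_moduleTop [IsNoetherian R N] [Nontrivial N]
    (hN : IsUniserial R N) : IsSimpleModule R (ModuleTop R N) := by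
  obtain ⟨H, hH, -⟩ := (eq_top_or_exists_le_coatom (⊥ : Submodule R N)).resolve_left bot_ne_top
  have : Module.jacobson R N = H := by
    refine le_antisymm (sInf_le hH) (le_sInf fun K hK => ?_)
    rcases hN H K with h | h
    · exact h
    · exact (hK.le_iff.1 h).elim (fun h => absurd h hH.1) fun h => h.le
  change IsSimpleModule R (N ⧸ Module.jacobson R N)
  rw [this]
  exact isSimpleModule_iff_isCoatom.2 hH

lemma injective_of_surjective_of_length_le [IsNoetherian R N'] [IsArtinian R N']
    (f : N →ₗ[R] N') (hf : Function.Surjective f)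
    (hle : Module.length R N ≤ Module.length R N') : Function.Injective f := by
  have h := Module.length_eq_add_of_exact (LinearMap.ker f).subtype f
    (Submodule.subtype_injective _) hf (LinearMap.exact_subtype_ker_map f)
  have hfin := Module.length_ne_top (R := R) (M := N')
  have h0 : Module.length R (LinearMap.ker f) = 0 := by
    have h1 : Module.length R (LinearMap.ker f) + Module.length R N' ≤
        0 + Module.length R N' := by rw [← h, zero_add]; exact hle
    exact nonpos_iff_eq_zero.1 ((ENat.add_le_add_iff_right hfin).1 h1)
  rw [Module.length_eq_zero_iff, Submodule.subsingleton_iff_eq_bot] at h0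
  exact LinearMap.ker_eq_bot.1 h0

lemma IsLoewySeries.length_quotient (hW : IsLoewySeries W t) {i : ℕ} (hi : i ≤ t) :
    Module.length R (M ⧸ W i) = i := by
  have h := Module.length_eq_add_of_exact (W i).subtype (W i).mkQ
    (Submodule.subtype_injective _) (Submodule.mkQ_surjective _)
    (LinearMap.exact_subtype_mkQ _)
  rw [hW.length_eq, hW.length_add hi, add_comm] at h
  have h2 : (t : ℕ∞) = (i : ℕ∞) + (t - i : ℕ) := by exact_mod_cast (by omega : t = i + (t - i))
  rw [h2] at h
  exact (ENat.add_left_injective_of_ne_top (ENat.natCast_ne_top _) h).symm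

/-- The quotient of `M` of length `i` is `[i]S`. -/
lemma IsLoewySeries.isBracket_iff [IsArtinianRing R] [Module.Finite R M] [Module.Finite R N]
    (hR : IndecomposablesUniserial R) (hM : IsUniserial R M) (hW : IsLoewySeries W t)
    (hS : Nonempty (ModuleTop R M ≃ₗ[R] S)) {i : ℕ} (hi : 1 ≤ i) (hit : i ≤ t) :
    IsBracket R S i N ↔ Nonempty (N ≃ₗ[R] M ⧸ W i) := by
  obtain ⟨eS⟩ := hS
  have : Nontrivial M := by
    rw [← Module.length_pos_iff (R := R), hW.length_eq]
    exact_mod_cast hi.trans hit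
  have hMt := hM.isSimpleModule_moduleTop
  have hSs : IsSimpleModule R S := IsSimpleModule.congr eS.symm
  have hp : Function.Surjective (eS.toLinearMap ∘ₗ (Module.jacobson R M).mkQ) :=
    eS.surjective.comp (Submodule.mkQ_surjective _)
  constructor
  · intro hN
    obtain ⟨e⟩ := hN.top_iso
    have hNu := hR N hN.indecomposable
    have hq : Function.Surjective (e.toLinearMap ∘ₗ (Module.jacobson R N).mkQ) :=
      e.surjective.comp (Submodule.mkQ_surjective _)
    have hquot : ∀ f : M →ₗ[R] N, Function.Surjective f → Nonempty (N ≃ₗ[R] M ⧸ W i) := by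
      intro f hf
      obtain ⟨l, hl, hWl⟩ := hW.exists_eq hM (LinearMap.ker f)
      have e' : (M ⧸ W l) ≃ₗ[R] N :=
        (Submodule.quotEquivOfEq _ _ hWl).trans (f.quotKerEquivOfSurjective hf)
      have hlen := e'.length_eq
      rw [hW.length_quotient hl, hN.length_eq, Nat.cast_inj] at hlen
      exact ⟨(hlen ▸ e').symm⟩
    rcases hR.exists_map_over_top hM hNu _ hp _ hq with ⟨f, hf⟩ | ⟨f, hf⟩
    · exact hquot f (surjective_of_comp_eq_top hNu hp hf)
    · have hfs := surjective_of_comp_eq_top hM hq hf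
      have hfi := injective_of_surjective_of_length_le f hfs (by
        rw [hN.length_eq, hW.length_eq]
        exact_mod_cast hit)
      exact hquot (LinearEquiv.ofBijective f ⟨hfi, hfs⟩).symm.toLinearMap
        (LinearEquiv.surjective _)
  · rintro ⟨e⟩
    have hlen : Module.length R N = i := e.length_eq.trans (hW.length_quotient hit)
    have : Nontrivial N := by
      rw [← Module.length_pos_iff (R := R), hlen]
      exact_mod_cast hi
    have hNu : IsUniserial R N := (hM.quotient (W i)).of_injective e.toLinearMap e.injective
    have := hNu.isSimpleModule_moduleTop
    exact ⟨hNu.isIndecomposableModule, hlen, nonempty_equiv_of_surjective_of_isUniserial hM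
      ((Module.jacobson R N).mkQ ∘ₗ e.symm.toLinearMap ∘ₗ (W i).mkQ)
      ((Submodule.mkQ_surjective _).comp (e.symm.surjective.comp (Submodule.mkQ_surjective _)))
      _ hp⟩

end Bracket

/-! ### Filtrations and indecomposable modules -/

section Filtration

variable {R : Type u} [Ring R] {M : Type u} [AddCommGroup M] [Module R M]
  {N B₁ B₂ : Type u} [AddCommGroup N] [Module R N] [AddCommGroup B₁] [Module R B₁]
  [AddCommGroup B₂] [Module R B₂] {W : ℕ → Submodule R M} {s t : ℕ}

/-- If every nonzero module of a class of modules has a submodule isomorphic to `B₁` or `B₂` with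
quotient in the class, then the modules of the class are filtered by `B₁` and `B₂`. -/
lemma hasFiltration_of_exists_submodule
    {C : ∀ (X : Type u) [AddCommGroup X] [Module R X], Prop}
    (hcongr : ∀ (X Y : Type u) [AddCommGroup X] [Module R X] [AddCommGroup Y] [Module R Y],
      (X ≃ₗ[R] Y) → C X → C Y)
    (hC : ∀ (X : Type u) [AddCommGroup X] [Module R X] [Module.Finite R X] [Nontrivial X], C X →
      ∃ I : Submodule R X, I ≠ ⊥ ∧ (Nonempty (I ≃ₗ[R] B₁) ∨ Nonempty (I ≃ₗ[R] B₂)) ∧ C (X ⧸ I))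
    [IsNoetherian R N] (hN : C N) : HasFiltration R B₁ B₂ N := by
  let Filt : Set (Submodule R N) := {A | C (N ⧸ A) ∧
    ∃ (n : ℕ) (F : Fin (n + 1) → Submodule R N), F 0 = ⊥ ∧ F (Fin.last n) = A ∧
    ∀ i : Fin n, F i.castSucc ≤ F i.succ ∧
      (Nonempty ((F i.succ ⧸ (F i.castSucc).submoduleOf (F i.succ)) ≃ₗ[R] B₁) ∨
       Nonempty ((F i.succ ⧸ (F i.castSucc).submoduleOf (F i.succ)) ≃ₗ[R] B₂))}
  have hbot : (⊥ : Submodule R N) ∈ Filt :=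
    ⟨hcongr N _ (Submodule.quotEquivOfEqBot ⊥ rfl).symm hN, 0, fun _ => ⊥, rfl, rfl,
      fun i => i.elim0⟩
  obtain ⟨A, ⟨hCA, n, F, hF0, hFn, hF⟩, hmax⟩ := wellFounded_gt.has_min Filt ⟨_, hbot⟩
  by_cases hA : A = ⊤
  · exact ⟨n, F, hF0, hFn.trans hA, hF⟩
  exfalso
  have : Nontrivial (N ⧸ A) := Submodule.Quotient.nontrivial_iff.2 hA
  obtain ⟨I, hI, hIB, hCI⟩ := hC (N ⧸ A) hCA
  let A' := I.comap A.mkQ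
  have hAA' : A ≤ A' := fun x hx => by
    have : A.mkQ x = 0 := (Submodule.Quotient.mk_eq_zero A).2 hx
    change A.mkQ x ∈ I
    rw [this]
    exact zero_mem _
  have hlt : A < A' := by
    refine lt_of_le_of_ne hAA' fun h => hI ?_
    rw [eq_bot_iff]
    intro y hy
    obtain ⟨x, rfl⟩ := A.mkQ_surjective y
    have hx : x ∈ A := by rw [h]; exact hy
    exact (Submodule.Quotient.mk_eq_zero A).2 hx
  refine hmax A' ⟨?_, n + 1, Fin.snoc F A', ?_, Fin.snoc_last _ _, ?_⟩ hlt
  · have e := (I.mkQ ∘ₗ A.mkQ).quotKerEquivOfSurjective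
      (I.mkQ_surjective.comp A.mkQ_surjective)
    refine hcongr _ _ (e.symm.trans (Submodule.quotEquivOfEq _ _ ?_)) hCI
    rw [LinearMap.ker_comp, Submodule.ker_mkQ]
  · have : (0 : Fin (n + 1 + 1)) = Fin.castSucc 0 := rfl
    rw [this, Fin.snoc_castSucc, hF0]
  · intro i
    induction i using Fin.lastCases with
    | cast i =>
      have h1 : Fin.snoc (α := fun _ => Submodule R N) F A' i.castSucc.castSucc = F i.castSucc :=
        Fin.snoc_castSucc _ _ _
      have h2 : Fin.snoc (α := fun _ => Submodule R N) F A' i.castSucc.succ = F i.succ := by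
        rw [Fin.succ_castSucc]
        exact Fin.snoc_castSucc _ _ _
      rw [h1, h2]
      exact hF i
    | last =>
      have h1 : Fin.snoc (α := fun _ => Submodule R N) F A' (Fin.last n).castSucc = A := by
        rw [← hFn]
        exact Fin.snoc_castSucc _ _ _
      have h2 : Fin.snoc (α := fun _ => Submodule R N) F A' (Fin.last n).succ = A' := by
        rw [Fin.succ_last]
        exact Fin.snoc_last _ _
      rw [h1, h2]
      refine ⟨hAA', ?_⟩
      have hmem : ∀ x : A', A.mkQ x.1 ∈ I := fun x => x.2
      let g : A' →ₗ[R] I := (A.mkQ ∘ₗ A'.subtype).codRestrict I hmem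
      have hg : Function.Surjective g := by
        rintro ⟨y, hy⟩
        obtain ⟨x, rfl⟩ := A.mkQ_surjective y
        exact ⟨⟨x, hy⟩, rfl⟩
      have hker : LinearMap.ker g = A.submoduleOf A' := by
        refine (LinearMap.ker_codRestrict _ _ _).trans ?_
        rw [LinearMap.ker_comp, Submodule.ker_mkQ]
        rfl
      have e : (A' ⧸ A.submoduleOf A') ≃ₗ[R] I :=
        (Submodule.quotEquivOfEq _ _ hker.symm).trans (g.quotKerEquivOfSurjective hg)
      exact hIB.imp (fun ⟨f⟩ => ⟨e.trans f⟩) fun ⟨f⟩ => ⟨e.trans f⟩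

variable [IsArtinianRing R] [Module.Finite R M]

/-- A nonzero module `N` of the perpendicular category contains a copy of `M / W (t % s)` or of
`W (t % s) / W s` with quotient in the perpendicular category: take a minimal nonzero submodule of
`N` in the perpendicular category. -/
lemma IsPerpendicular.exists_submodule (hR : IndecomposablesUniserial R) (hM : IsUniserial R M)
    (hW : IsPeriodicLoewySeries W s t) (hst : t % s ≠ 0) [Module.Finite R N] [Nontrivial N]
    (hN : IsPerpendicular W s t N) :
    ∃ I : Submodule R N, I ≠ ⊥ ∧ (Nonempty (I ≃ₗ[R] M ⧸ W (t % s)) ∨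
      Nonempty (I ≃ₗ[R] W (t % s) ⧸ (W s).submoduleOf (W (t % s)))) ∧
      IsPerpendicular W s t (N ⧸ I) := by
  have hst' := hW.le
  have hmod := Nat.mod_lt t hW.pos
  obtain ⟨I, ⟨hI0, hI⟩, hmin⟩ := wellFounded_lt.has_min
    {A : Submodule R N | A ≠ ⊥ ∧ IsPerpendicular W s t A}
    ⟨⊤, top_ne_bot, hN.congr Submodule.topEquiv.symm⟩
  have hIfin : Module.Finite R I := Module.Finite.of_fg (IsNoetherian.noetherian I)
  refine ⟨I, hI0, ?_, hN.quotient hR hM hW hI⟩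
  -- by minimality, nonzero maps to `I` from the perpendicular category are surjective
  have hsurj : ∀ {l : ℕ} (f : W l →ₗ[R] I), IsPerpendicular W s t (W l) → f ≠ 0 →
      Function.Surjective f := by
    intro l f hl hf
    have hr := IsPerpendicular.range hR hM hW hl hI f
    by_contra hns
    refine hmin ((LinearMap.range f).map I.subtype) ⟨?_, ?_⟩ (lt_of_le_of_ne ?_ ?_)
    · exact fun h => hf (LinearMap.range_eq_bot.1 (Submodule.map_injective_of_injective
        I.subtype_injective (h.trans (Submodule.map_bot _).symm)))
    · exact hr.congr ((LinearMap.range f).equivMapOfInjective I.subtype I.subtype_injective)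
    · exact Submodule.map_subtype_le _ _
    · intro h
      apply hns
      rw [← LinearMap.range_eq_top]
      apply Submodule.map_injective_of_injective I.subtype_injective
      rw [h, Submodule.map_subtype_top]
  -- the kernel of such an epimorphism is the next term of the series in the category
  have hker : ∀ {j l : ℕ} (f : W j →ₗ[R] I), j < l → l ≤ t → IsPerpendicular W s t (W j) →
      IsPerpendicular W s t (W l) → (∀ i, j < i → i < t → (i % s = 0 ∨ i % s = t % s) → l ≤ i) →
      Function.Surjective f → LinearMap.ker f = (W l).submoduleOf (W j) := by
    intro j l f hjl hlt hj hl hnext hf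
    have hle : W l ≤ W j := hW.antitone hjl.le
    obtain ⟨i, hi, hWi⟩ := hW.exists_eq hM ((LinearMap.ker f).map (W j).subtype)
    have hkeri : LinearMap.ker f = (W i).submoduleOf (W j) := by
      rw [hWi, Submodule.submoduleOf, Submodule.comap_map_eq_of_injective (W j).subtype_injective]
    have hij : j < i := by
      by_contra hij
      have htop : LinearMap.ker f = ⊤ := by
        rw [hkeri, Submodule.submoduleOf_eq_top]
        exact hW.antitone (by omega)
      have hf0 := LinearMap.ker_eq_top.1 htop
      have : Nontrivial I := Submodule.nontrivial_iff_ne_bot.2 hI0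
      obtain ⟨y, hy⟩ := exists_ne (0 : I)
      obtain ⟨x, rfl⟩ := hf y
      exact hy (by rw [hf0, LinearMap.zero_apply])
    have hli : l ≤ i := by
      rcases hi.lt_or_eq with h | rfl
      · refine hnext i hij h (hW.mod_eq_of_isPerpendicular hR hM h ?_)
        rw [hWi]
        exact (hj.ker hI f).congr
          ((LinearMap.ker f).equivMapOfInjective (W j).subtype (W j).subtype_injective)
      · exact hlt
    rw [hkeri]
    have hzero : f ∘ₗ Submodule.inclusion hle = 0 := by
      by_contra h0
      have := hsurj _ hl h0
      have htop : W j ≤ W l := by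
        rw [← Submodule.submoduleOf_eq_top]
        refine ((hM.submodule (W j)).eq_top_or_eq_top (B := LinearMap.ker f) ?_).resolve_right ?_
        · rw [eq_top_iff]
          intro x _
          obtain ⟨y, hy⟩ := this (f x)
          rw [← sub_add_cancel x (Submodule.inclusion hle y), add_comm]
          exact Submodule.add_mem_sup (show y.1 ∈ W l from y.2) (by
            rw [LinearMap.mem_ker, map_sub, sub_eq_zero]
            exact hy.symm)
        · rw [hkeri, Submodule.submoduleOf_eq_top]
          exact (hW.lt_of_lt hij (by omega)).not_ge
      exact (hW.lt_of_lt hjl (by omega)).not_ge htop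
    have hli' : W l ≤ W i := fun x hx => by
      have : (⟨x, hle hx⟩ : W j) ∈ LinearMap.ker f := LinearMap.congr_fun hzero ⟨x, hx⟩
      rw [hkeri] at this
      exact this
    rw [le_antisymm hli' (hW.antitone hli)]
  have h0 := hW.isPerpendicular hR hM (Nat.zero_le t) (Or.inl (Nat.zero_mod s))
  have h1 := hW.isPerpendicular hR hM (Nat.mod_le t s) (Or.inr (Nat.mod_mod t s))
  have h2 := hW.isPerpendicular hR hM hst' (Or.inl (Nat.mod_self s))
  by_cases hz : ∀ f : W 0 →ₗ[R] I, f = 0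
  · obtain ⟨f, hf⟩ : ∃ f : W (t % s) →ₗ[R] I, f ≠ 0 := by
      by_contra! hz'
      have := hI.eq_top hR hM hW ⊥ (fun f => by simp [hz f]) (fun f => by simp [hz' f])
      exact hI0 (by simpa using congrArg (Submodule.map I.subtype) this.symm)
    right
    have hfs := hsurj f h1 hf
    refine ⟨((Submodule.quotEquivOfEq _ _ ?_).trans (f.quotKerEquivOfSurjective hfs)).symm⟩
    refine (hker f hmod hst' h1 h2 (fun i hi hit h => ?_) hfs).symm
    by_contra hlt
    rw [Nat.mod_eq_of_lt (by omega : i < s)] at h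
    omega
  · push Not at hz
    obtain ⟨f, hf⟩ := hz
    left
    have hfs := hsurj f h0 hf
    have hk := hker f (by omega) (Nat.mod_le t s) h0 h1 (fun i hi hit h => by
      by_contra hlt
      rw [Nat.mod_eq_of_lt (by omega : i < s)] at h
      omega) hfs
    refine ⟨((Submodule.quotEquivOfEq _ _ ?_).trans
      ((f ∘ₗ hW.equivZero.toLinearMap).quotKerEquivOfSurjective
        (hfs.comp hW.equivZero.surjective))).symm⟩
    rw [LinearMap.ker_comp, hk]
    rfl

end Filtration

section Indecomposable

variable {R : Type u} [Ring R] {M : Type u} [AddCommGroup M] [Module R M]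
  {N : Type u} [AddCommGroup N] [Module R N] {W : ℕ → Submodule R M} {s t : ℕ}

/-- A uniserial module generated by `M` is a quotient of `M`. -/
lemma IsUniserial.exists_surjective_of_isGeneratedBy [IsNoetherian R N] (hN : IsUniserial R N)
    (h : IsGeneratedBy M (⊤ : Submodule R N)) : ∃ f : M →ₗ[R] N, Function.Surjective f := by
  by_contra! hcon
  rcases subsingleton_or_nontrivial N with h0 | h0
  · exact hcon 0 fun x => ⟨0, Subsingleton.elim _ _⟩
  obtain ⟨H, hH, -⟩ := (eq_top_or_exists_le_coatom (⊥ : Submodule R N)).resolve_left bot_ne_top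
  apply hH.1
  rw [eq_top_iff]
  intro x _
  refine homTrace_induction (h (Submodule.mem_top (x := x))) (p := fun x => x ∈ H) ?_
    (zero_mem _) fun _ _ => add_mem
  intro f y _
  have hr : LinearMap.range f ≤ H := by
    rcases hN (LinearMap.range f) H with h1 | h1
    · exact h1
    · exact (hH.le_iff.1 h1).elim (fun h2 => absurd (LinearMap.range_eq_top.1 h2) (hcon f))
        fun h2 => h2.le
  exact hr ⟨y, rfl⟩

variable [IsArtinianRing R] [Module.Finite R M]

/-- A term of the Loewy series is generated by `M` if and only if its index is divisible by `s`. -/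
lemma IsPeriodicLoewySeries.isGeneratedBy_iff (hR : IndecomposablesUniserial R)
    (hM : IsUniserial R M) (hW : IsPeriodicLoewySeries W s t) {l : ℕ} (hl : l < t) :
    IsGeneratedBy M (W l) ↔ s ∣ l := by
  constructor
  · intro h
    obtain ⟨x, hx, hx'⟩ := SetLike.exists_of_lt (hW.lt_of_lt (Nat.lt_succ_self l) hl)
    by_contra hsl
    refine hx' (homTrace_induction (h hx) (p := fun x => x ∈ W (l + 1)) ?_ (zero_mem _)
      fun _ _ => add_mem)
    intro f y hf
    obtain ⟨j, hj, hWj⟩ := hW.exists_eq hM (LinearMap.range f)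
    have hle : W j ≤ W l := by
      rw [hWj]
      rintro _ ⟨y, rfl⟩
      exact hf y
    have hmem : f y ∈ W j := hWj ▸ ⟨y, rfl⟩
    rcases hj.lt_or_eq with hjt | rfl
    · have hlj := (hW.le_iff hjt).1 hle
      refine hW.antitone (lt_of_le_of_ne hlj ?_) hmem
      rintro rfl
      have h0 : f ∘ₗ hW.equivZero.symm.toLinearMap ≠ 0 := by
        intro h0
        have : f = 0 := by
          ext z
          simpa using LinearMap.congr_fun h0 (hW.equivZero z)
        rw [this, LinearMap.range_zero] at hWj
        exact absurd (hW.eq_bot_iff.1 hWj) (by omega)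
      obtain ⟨i, hi, hWi, hmod⟩ := hW.exists_range_eq hM (by omega) _ h0
      have hrange : LinearMap.range (f ∘ₗ hW.equivZero.symm.toLinearMap) = LinearMap.range f := by
        rw [LinearMap.range_comp, LinearEquiv.range, Submodule.map_top]
      rw [hrange, ← hWj] at hWi
      have h1 := (hW.le_iff hjt).1 hWi.le
      have h2 := (hW.le_iff hi).1 hWi.ge
      obtain rfl : l = i := by omega
      rw [Nat.zero_mod] at hmod
      exact hsl (Nat.dvd_of_mod_eq_zero hmod)
    · rw [hW.bot j le_rfl] at hmem
      rw [(Submodule.mem_bot R).1 hmem]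
      exact zero_mem _
  · intro h
    obtain ⟨φ, hφ⟩ := hW.exists_end_range_eq hR hM (Nat.mod_eq_zero_of_dvd h)
    rw [← hφ]
    exact isGeneratedBy_range_one φ

lemma IsPeriodicLoewySeries.isPresentedBy_quotient_iff (hR : IndecomposablesUniserial R)
    (hM : IsUniserial R M) (hW : IsPeriodicLoewySeries W s t) {l : ℕ} (hl : l ≤ t) :
    IsPresentedBy (R := R) M (M ⧸ W l) ↔ l = t ∨ s ∣ l := by
  have hQ := hW.isQuasiProjective_self hR hM
  have key : IsPresentedBy (R := R) M (M ⧸ W l) ↔ IsGeneratedBy M (W l) := by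
    constructor
    · intro h
      have := h.isGeneratedBy_ker_one hQ (W l).mkQ (W l).mkQ_surjective
      rwa [Submodule.ker_mkQ] at this
    · intro h
      refine isPresentedBy_of_surjective_one (W l).mkQ (W l).mkQ_surjective ?_
      rwa [Submodule.ker_mkQ]
  rw [key]
  rcases hl.lt_or_eq with h | rfl
  · rw [hW.isGeneratedBy_iff hR hM h]
    simp [h.ne]
  · rw [hW.bot l le_rfl]
    simp [isGeneratedBy_bot]

/-- The indecomposable modules presented by `M` are `M` and the modules `M / W (i * s)`. -/
lemma IsPeriodicLoewySeries.isPresentedBy_iff (hR : IndecomposablesUniserial R)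
    (hM : IsUniserial R M) (hW : IsPeriodicLoewySeries W s t) [Module.Finite R N]
    (hN : IsIndecomposableModule R N) :
    IsPresentedBy (R := R) M N ↔ Nonempty (N ≃ₗ[R] M) ∨
      ∃ i, 1 ≤ i ∧ i * s < t ∧ Nonempty (N ≃ₗ[R] M ⧸ W (i * s)) := by
  constructor
  · intro h
    obtain ⟨f, hf⟩ := (hR N hN).exists_surjective_of_isGeneratedBy h.isGeneratedBy_top
    obtain ⟨l, hl, hWl⟩ := hW.exists_eq hM (LinearMap.ker f)
    have e : (M ⧸ W l) ≃ₗ[R] N :=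
      (Submodule.quotEquivOfEq _ _ hWl).trans (f.quotKerEquivOfSurjective hf)
    rcases hl.lt_or_eq with hlt | rfl
    · rcases (hW.isPresentedBy_quotient_iff hR hM hl).1 (h.congr e.symm) with h1 | ⟨i, rfl⟩
      · omega
      · right
        refine ⟨i, ?_, by rwa [mul_comm], ⟨by rw [mul_comm]; exact e.symm⟩⟩
        rw [Nat.one_le_iff_ne_zero]
        rintro rfl
        have := hN.1
        have h2 := e.length_eq
        rw [hW.length_quotient hl, mul_zero, Nat.cast_zero] at h2
        exact (Module.length_pos (R := R) (M := N)).ne h2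
    · left
      exact ⟨(e.symm.trans (Submodule.quotEquivOfEqBot _ (hW.bot l le_rfl)))⟩
  · rintro (⟨⟨e⟩⟩ | ⟨i, _, hi, ⟨e⟩⟩)
    · exact isPresentedBy_self.congr e.symm
    · exact ((hW.isPresentedBy_quotient_iff hR hM hi.le).2
        (Or.inr (dvd_mul_left s i))).congr e.symm

end Indecomposable

/-! ### The endomorphism rings -/

section HomSubmodule

variable {R : Type u} [Ring R] {Q N : Type u} [AddCommGroup Q] [Module R Q]
  [AddCommGroup N] [Module R N]

lemma IsIndecomposableModule.congr {R : Type u} [Ring R] {N N' : Type u} [AddCommGroup N]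
    [Module R N] [AddCommGroup N'] [Module R N'] (h : IsIndecomposableModule R N)
    (e : N ≃ₗ[R] N') : IsIndecomposableModule R N' := by
  have := h.1
  refine ⟨e.symm.toEquiv.nontrivial, fun U V hUV => ?_⟩
  let E := Submodule.orderIsoMapComap e.symm
  refine (h.2 (E U) (E V) (hUV.map E)).imp (fun hU => ?_) fun hV => ?_
  · exact E.injective (hU.trans E.map_bot.symm)
  · exact E.injective (hV.trans E.map_bot.symm)

variable (Q) in
/-- The maps from `Q` to `N` with values in `A`. -/
def HomModule.valuesIn (A : Submodule R N) : Submodule (GammaRing R Q) (HomModule R Q N) where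
  carrier := {h | ∀ x, (h : Q →ₗ[R] N) x ∈ A}
  add_mem' hf hg x := A.add_mem (hf x) (hg x)
  zero_mem' _ := A.zero_mem
  smul_mem' γ _ hf x := hf (γ.unop x)

/-- If `N` is presented by `Q` and `Hom(Q, N)` is indecomposable, then `N` is indecomposable. -/
lemma HomModule.isIndecomposableModule (hN : IsGeneratedBy Q (⊤ : Submodule R N))
    (h : IsIndecomposableModule (GammaRing R Q) (HomModule R Q N)) :
    IsIndecomposableModule R N := by
  have hnt := h.1
  refine ⟨?_, fun U V hUV => ?_⟩
  · by_contra hN'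
    rw [not_nontrivial_iff_subsingleton] at hN'
    exact not_subsingleton (HomModule R Q N) ⟨fun f g => LinearMap.ext fun _ =>
      Subsingleton.elim _ _⟩
  · have key : ∀ U V : Submodule R N, IsCompl U V → HomModule.valuesIn Q U = ⊥ → U = ⊥ := by
      intro U V hUV hbot
      have hπ : U.subtype ∘ₗ U.projectionOnto V hUV = 0 := by
        apply HomModule.map_injective hN
        ext1 f
        have hmem : (HomModule.map (U.subtype ∘ₗ U.projectionOnto V hUV) f :
            HomModule R Q N) ∈ HomModule.valuesIn Q U := fun x => Subtype.prop _
        rw [hbot] at hmem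
        rw [(Submodule.mem_bot _).1 hmem]
        exact (LinearMap.zero_comp (f : Q →ₗ[R] N)).symm
      rw [eq_bot_iff]
      intro x hx
      have := LinearMap.congr_fun hπ x
      rw [LinearMap.comp_apply, Submodule.projectionOnto_apply_left hUV ⟨x, hx⟩] at this
      exact this
    have hcompl : IsCompl (HomModule.valuesIn Q U) (HomModule.valuesIn Q V) := by
      constructor
      · rw [Submodule.disjoint_def]
        intro f hf hf'
        refine LinearMap.ext fun x => ?_
        exact (Submodule.disjoint_def.1 hUV.disjoint) _ (hf x) (hf' x)
      · rw [codisjoint_iff, eq_top_iff]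
        intro f _
        have hsum : f = HomModule.map (U.subtype ∘ₗ U.projectionOnto V hUV) f +
            HomModule.map (V.subtype ∘ₗ V.projectionOnto U hUV.symm) f := by
          refine LinearMap.ext fun x => ?_
          exact (Submodule.projection_add_projection_eq_self hUV (f x)).symm
        rw [hsum]
        exact Submodule.add_mem_sup (fun x => Subtype.prop _) (fun x => Subtype.prop _)
    exact (h.2 _ _ hcompl).imp (key U V hUV) (key V U hUV.symm)

lemma HomModule.nontrivial [Nontrivial N] (hN : IsGeneratedBy Q (⊤ : Submodule R N)) :
    Nontrivial (HomModule R Q N) := by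
  by_contra h
  rw [not_nontrivial_iff_subsingleton] at h
  obtain ⟨x, hx⟩ := exists_ne (0 : N)
  refine hx (homTrace_induction (hN (Submodule.mem_top (x := x))) (p := fun x => x = 0)
    (fun f y _ => ?_) rfl fun x y hx hy => by rw [hx, hy, add_zero])
  exact LinearMap.congr_fun (Subsingleton.elim (f : HomModule R Q N) 0) y

/-- `Γ(Q)` is `Hom(Q, Q)` as a left module over itself. -/
def HomModule.selfEquiv : GammaRing R Q ≃ₗ[GammaRing R Q] HomModule R Q Q where
  toFun γ := γ.unop
  map_add' _ _ := rfl
  map_smul' _ _ := rfl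
  invFun h := MulOpposite.op h
  left_inv _ := rfl
  right_inv _ := rfl

lemma isLocalRing_gammaRing [IsArtinian R N] [Nontrivial N] (hN : IsUniserial R N) :
    IsLocalRing (GammaRing R N) where
  isUnit_or_isUnit_of_add_one {a b} hab := by
    have key : ∀ a : GammaRing R N, LinearMap.ker (a.unop : N →ₗ[R] N) = ⊥ → IsUnit a := by
      intro a ha
      rw [← isUnit_unop]
      exact (Module.End.isUnit_iff _).2
        (IsArtinian.bijective_of_injective_endomorphism _ (LinearMap.ker_eq_bot.1 ha))
    refine (hN.eq_bot_or_eq_bot ?_).imp (key a) (key b)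
    rw [eq_bot_iff]
    rintro x ⟨hx, hx'⟩
    have h1 : (a.unop + b.unop : Module.End R N) x = x := by
      have := congrArg MulOpposite.unop hab
      rw [MulOpposite.unop_add, MulOpposite.unop_one] at this
      rw [this, Module.End.one_apply]
    rw [LinearMap.add_apply, LinearMap.mem_ker.1 hx, LinearMap.mem_ker.1 hx', add_zero] at h1
    exact h1.symm

/-- `Γ(Q)` is a Nakayama algebra, since its modules are the `Hom(Q, N)` with `N` presented by `Q`,
and `Hom(Q, N)` is uniserial if `N` is. -/
lemma isNakayamaAlgebra_gammaRing {k : Type w} [Field k] [Algebra k R] [Module k Q]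
    [IsScalarTower k R Q] [Module.Finite k R] [Module.Finite R Q]
    (hR : IndecomposablesUniserial R) (hQ : IsQuasiProjective R Q) :
    IsNakayamaAlgebra k (GammaRing R Q) where
  finite := finite_gammaRing
  serial X _ _ _ hX := by
    have := finite_gammaRing (k := k) (R := R) (Q := Q)
    have : IsNoetherianRing (GammaRing R Q) := IsNoetherianRing.of_finite k _
    have : IsArtinianRing (GammaRing R Q) := IsArtinianRing.of_finite k _
    obtain ⟨m, K, hK, ⟨e⟩⟩ := HomModule.exists_equiv hQ X
    have : Module.Finite (GammaRing R Q) (HomModule R Q ((Fin m → Q) ⧸ K)) :=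
      Module.Finite.equiv e
    have hN : IsPresentedBy (R := R) Q ((Fin m → Q) ⧸ K) :=
      isPresentedBy_of_surjective K.mkQ K.mkQ_surjective (by rwa [Submodule.ker_mkQ])
    have hind : IsIndecomposableModule (GammaRing R Q) (HomModule R Q ((Fin m → Q) ⧸ K)) :=
      IsIndecomposableModule.congr hX e
    have hu := hR _ (HomModule.isIndecomposableModule hN.isGeneratedBy_top hind)
    have hXu : IsUniserial (GammaRing R Q) X :=
      IsUniserial.of_injective (HomModule.total hQ hu) e.toLinearMap e.injective
    exact hXu.isSerialModule

end HomSubmodule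

section Simples

variable {R : Type u} [Ring R] {M : Type u} [AddCommGroup M] [Module R M]
  {Q B : Type u} [AddCommGroup Q] [Module R Q] [AddCommGroup B] [Module R B]
  {W : ℕ → Submodule R M} {s t : ℕ}

/-- Over a ring which is uniserial as a left module there is at most one simple module. -/
lemma numSimples_le_one (hR : IsUniserial R R) : numSimples R ≤ 1 := by
  have : Subsingleton (Quotient (simpleModuleSetoid R)) := by
    refine ⟨fun a b => ?_⟩
    obtain ⟨T, _, _, _, rfl⟩ := exists_simpleClass_eq a
    obtain ⟨T', _, _, _, rfl⟩ := exists_simpleClass_eq b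
    have := IsSimpleModule.nontrivial R T
    have := IsSimpleModule.nontrivial R T'
    obtain ⟨x, hx⟩ := exists_ne (0 : T)
    obtain ⟨y, hy⟩ := exists_ne (0 : T')
    exact simpleClass_eq_iff.2 (nonempty_equiv_of_surjective_of_isUniserial hR _
      (IsSimpleModule.toSpanSingleton_surjective R hx) _
      (IsSimpleModule.toSpanSingleton_surjective R hy))
  exact Finite.card_le_one_iff_subsingleton.2 this

variable [IsArtinianRing R] [Module.Finite R M]

/-- A quotient `B` of `W j / W j'`, where `W j` and `W j'` are neighbouring terms of the Loewy
series among those with index congruent to `0` or `t` modulo `s`, has no proper nonzero submodules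
in the perpendicular category. -/
lemma IsPeriodicLoewySeries.eq_top_of_isPerpendicular (hR : IndecomposablesUniserial R)
    (hM : IsUniserial R M) (hW : IsPeriodicLoewySeries W s t) {j j' : ℕ} (hj' : j' ≤ s)
    (hjj' : ∀ i, j < i → i < j' → i ≠ t % s) (q : W j →ₗ[R] B) (hq : Function.Surjective q)
    (hker : ∀ x : W j, x.1 ∈ W j' → q x = 0) (A : Submodule R B) (hA0 : A ≠ ⊥)
    (hA : IsPerpendicular W s t A) : A = ⊤ := by
  have hst := hW.le
  have : Module.Finite R B := Module.Finite.of_surjective q hq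
  have hAfin : Module.Finite R A := Module.Finite.of_fg (IsNoetherian.noetherian A)
  obtain ⟨i, hi, hWi⟩ := hW.exists_eq hM ((A.comap q).map (W j).subtype)
  have hmem : ∀ x : W j, q x ∈ A ↔ x.1 ∈ W i := by
    intro x
    rw [hWi]
    constructor
    · intro h
      exact ⟨x, h, rfl⟩
    · rintro ⟨y, hy, hyx⟩
      rwa [← Subtype.ext hyx]
  have hij' : i < j' := by
    by_contra hlt
    refine hA0 (eq_bot_iff.2 fun y hy => ?_)
    obtain ⟨x, rfl⟩ := hq y
    exact hker x (hW.antitone (not_lt.1 hlt) ((hmem x).1 hy))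
  have hle : W i ≤ W j := by
    rw [hWi]
    exact Submodule.map_subtype_le _ _
  rcases ((hW.le_iff (by omega)).1 hle).lt_or_eq with hji | rfl
  · exfalso
    have : Nontrivial A := Submodule.nontrivial_iff_ne_bot.2 hA0
    obtain ⟨H, hH, -⟩ := (eq_top_or_exists_le_coatom (⊥ : Submodule R A)).resolve_left bot_ne_top
    have : IsSimpleModule R (A ⧸ H) := isSimpleModule_iff_isCoatom.2 hH
    let r : W i →ₗ[R] A := (q ∘ₗ Submodule.inclusion hle).codRestrict A
      fun x => (hmem _).2 x.2
    have hr : Function.Surjective r := by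
      rintro ⟨y, hy⟩
      obtain ⟨x, rfl⟩ := hq y
      exact ⟨⟨x.1, (hmem x).1 hy⟩, rfl⟩
    obtain ⟨e⟩ := hW.nonempty_equiv_of_surjective hM (by omega) (H.mkQ ∘ₗ r)
      (H.mkQ_surjective.comp hr)
    rcases hA.eq_of_surjective hR hM hW H.mkQ H.mkQ_surjective (by omega) e with h | h
    · omega
    · exact hjj' i hji hij' h
  · rw [eq_top_iff]
    intro y _
    obtain ⟨x, rfl⟩ := hq y
    exact (hmem x).2 x.2

/-- If `B` has no proper nonzero submodules in the perpendicular category, then `Hom(Q, B)` is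
simple. -/
lemma IsPerpGenerator.isSimpleModule (hR : IndecomposablesUniserial R) (hM : IsUniserial R M)
    (hW : IsPeriodicLoewySeries W s t) (hQ : IsPerpGenerator W s t Q) [Module.Finite R Q]
    [Module.Finite R B] [Nontrivial B] (hB : IsPerpendicular W s t B)
    (hmin : ∀ A : Submodule R B, A ≠ ⊥ → IsPerpendicular W s t A → A = ⊤) :
    IsSimpleModule (GammaRing R Q) (HomModule R Q B) := by
  rw [isSimpleModule_iff_toSpanSingleton_surjective]
  refine ⟨HomModule.nontrivial (hQ.isGeneratedBy_top hR hM hW hB), fun f hf g => ?_⟩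
  have hr : LinearMap.range (f : Q →ₗ[R] B) = ⊤ :=
    hmin _ (fun h => hf (LinearMap.range_eq_bot.1 h))
      (IsPerpendicular.range hR hM hW hQ.isPerpendicular hB f)
  obtain ⟨h, hh⟩ := hQ.annProjective _ _ hQ.isPerpendicular.ann (f : Q →ₗ[R] B)
    (LinearMap.range_eq_top.1 hr) g
  exact ⟨MulOpposite.op h, hh⟩

/-- If `s ∤ t` the simple `Γ(Q)`-modules are `Hom(Q, M / W (t % s))` and
`Hom(Q, W (t % s) / W s)`. -/
lemma IsPerpGenerator.numSimples_eq_two (hR : IndecomposablesUniserial R) (hM : IsUniserial R M)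
    (hW : IsPeriodicLoewySeries W s t) (hQ : IsPerpGenerator W s t Q) [Module.Finite R Q]
    [IsNoetherianRing (GammaRing R Q)] (hst : t % s ≠ 0) : numSimples (GammaRing R Q) = 2 := by
  have hst' := hW.le
  have hmod := Nat.mod_lt t hW.pos
  have hqp := hQ.isQuasiProjective
  have h0 := hW.isPerpendicular hR hM (Nat.zero_le t) (Or.inl (Nat.zero_mod s))
  have h1 := hW.isPerpendicular hR hM (Nat.mod_le t s) (Or.inr (Nat.mod_mod t s))
  have h2 := hW.isPerpendicular hR hM hst' (Or.inl (Nat.mod_self s))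
  let B₁ := M ⧸ W (t % s)
  let B₂ := W (t % s) ⧸ (W s).submoduleOf (W (t % s))
  have hB₁ : IsPerpendicular W s t B₁ := (hW.isPerpendicular_self hR hM).quotient hR hM hW h1
  have hB₂ : IsPerpendicular W s t B₂ := h1.quotient hR hM hW
    (h2.congr (Submodule.submoduleOfEquivOfLe (hW.antitone hmod.le)).symm)
  have : Nontrivial B₁ := by
    refine Submodule.Quotient.nontrivial_iff.2 fun h => ?_
    have := hW.lt_of_lt (Nat.pos_of_ne_zero hst) (by omega)
    rw [h] at this
    exact not_top_lt this
  have : Nontrivial B₂ := by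
    refine Submodule.Quotient.nontrivial_iff.2 fun h => ?_
    exact (hW.lt_of_lt hmod (by omega)).not_ge (Submodule.submoduleOf_eq_top.1 h)
  let q₁ : W 0 →ₗ[R] B₁ := (W (t % s)).mkQ ∘ₗ hW.equivZero.symm.toLinearMap
  have hq₁ : Function.Surjective q₁ := (Submodule.mkQ_surjective _).comp hW.equivZero.symm.surjective
  let q₂ : W (t % s) →ₗ[R] B₂ := Submodule.mkQ _
  have hq₂ : Function.Surjective q₂ := Submodule.mkQ_surjective _
  have hmin₁ := hW.eq_top_of_isPerpendicular hR hM hmod.le (fun i _ hi => hi.ne) q₁ hq₁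
    fun x hx => (Submodule.Quotient.mk_eq_zero _).2 hx
  have hmin₂ := hW.eq_top_of_isPerpendicular hR hM le_rfl (fun i hi _ => hi.ne') q₂ hq₂
    fun x hx => (Submodule.Quotient.mk_eq_zero _).2 hx
  have hs₁ := hQ.isSimpleModule hR hM hW hB₁ hmin₁
  have hs₂ := hQ.isSimpleModule hR hM hW hB₂ hmin₂
  rw [numSimples, Nat.card_eq_two_iff]
  refine ⟨simpleClass _ (HomModule R Q B₁), simpleClass _ (HomModule R Q B₂), ?_, ?_⟩
  · intro heq
    obtain ⟨e⟩ := simpleClass_eq_iff.1 heq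
    obtain ⟨f, hf⟩ := HomModule.map_surjective hqp
      ((hQ.isPerpendicular_iff hR hM hW).1 hB₁) e.toLinearMap
    have hf0 : f ≠ 0 := by
      rintro rfl
      have := IsSimpleModule.nontrivial (GammaRing R Q) (HomModule R Q B₁)
      obtain ⟨x, hx⟩ := exists_ne (0 : HomModule R Q B₁)
      apply hx
      apply e.injective
      rw [map_zero]
      exact (LinearMap.congr_fun hf x).symm.trans (LinearMap.zero_comp (x : Q →ₗ[R] B₁))
    have hfs : LinearMap.range f = ⊤ := hmin₂ _ (fun h => hf0 (LinearMap.range_eq_bot.1 h))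
      (IsPerpendicular.range hR hM hW hB₁ hB₂ f)
    obtain ⟨H, hH, -⟩ :=
      (eq_top_or_exists_le_coatom (⊥ : Submodule R B₂)).resolve_left bot_ne_top
    have : IsSimpleModule R (B₂ ⧸ H) := isSimpleModule_iff_isCoatom.2 hH
    obtain ⟨e₁⟩ := hW.nonempty_equiv_of_surjective hM (i := 0) (by omega) (H.mkQ ∘ₗ f ∘ₗ q₁)
      (H.mkQ_surjective.comp ((LinearMap.range_eq_top.1 hfs).comp hq₁))
    obtain ⟨e₂⟩ := hW.nonempty_equiv_of_surjective hM (i := t % s) (by omega) (H.mkQ ∘ₗ q₂)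
      (H.mkQ_surjective.comp hq₂)
    have := (hW.nonempty_equiv_iff 0 (by omega) (t % s) (by omega)).1 ⟨e₁.symm.trans e₂⟩
    rw [Nat.zero_mod, Nat.mod_mod] at this
    exact hst this.symm
  · rw [Set.eq_univ_iff_forall]
    intro c
    obtain ⟨X, _, _, _, rfl⟩ := exists_simpleClass_eq c
    have := IsSimpleModule.nontrivial (GammaRing R Q) X
    obtain ⟨m, K, hK, ⟨e⟩⟩ := HomModule.exists_equiv hqp X
    let N := (Fin m → Q) ⧸ K
    have hN : IsPerpendicular W s t N := (hQ.isPerpendicular_iff hR hM hW).2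
      (isPresentedBy_of_surjective K.mkQ K.mkQ_surjective (by rwa [Submodule.ker_mkQ]))
    have : IsSimpleModule (GammaRing R Q) (HomModule R Q N) := IsSimpleModule.congr e.symm
    have : Nontrivial N := by
      by_contra hN'
      rw [not_nontrivial_iff_subsingleton] at hN'
      have := IsSimpleModule.nontrivial (GammaRing R Q) (HomModule R Q N)
      exact not_subsingleton (HomModule R Q N) ⟨fun f g => LinearMap.ext fun _ =>
        Subsingleton.elim _ _⟩
    obtain ⟨I, hI0, hI, -⟩ := hN.exists_submodule hR hM hW hst
    have key : ∀ (B : Type u) [AddCommGroup B] [Module R B]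
        [IsSimpleModule (GammaRing R Q) (HomModule R Q B)], Nonempty (I ≃ₗ[R] B) →
        Nonempty (X ≃ₗ[GammaRing R Q] HomModule R Q B) := by
      rintro B _ _ _ ⟨f⟩
      have hφ : (HomModule.map (I.subtype ∘ₗ f.symm.toLinearMap) :
          HomModule R Q B →ₗ[GammaRing R Q] HomModule R Q N) ≠ 0 := by
        intro h
        have := IsSimpleModule.nontrivial (GammaRing R Q) (HomModule R Q B)
        obtain ⟨x, hx⟩ := exists_ne (0 : HomModule R Q B)
        refine hx (LinearMap.ext fun y => ?_)
        have h3 : I.subtype (f.symm ((x : Q →ₗ[R] B) y)) = 0 :=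
          LinearMap.congr_fun (LinearMap.congr_fun h x :
            ((I.subtype ∘ₗ f.symm.toLinearMap) ∘ₗ (x : Q →ₗ[R] B) : Q →ₗ[R] N) = 0) y
        exact f.symm.injective ((Subtype.ext h3).trans (map_zero f.symm).symm)
      exact ⟨e.trans (LinearEquiv.ofBijective _ (LinearMap.bijective_of_ne_zero hφ)).symm⟩
    exact hI.imp (fun h => simpleClass_eq_iff.2 (key B₁ h))
      fun h => simpleClass_eq_iff.2 (key B₂ h)

end Simples

section Length

variable {R : Type u} [Ring R] {M : Type u} [AddCommGroup M] [Module R M]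
  {W : ℕ → Submodule R M} {s t e : ℕ} [IsArtinianRing R] [Module.Finite R M]

/-- The endomorphisms of `M` with image in `W (i * s)` form the Loewy series of `Γ(M)`. -/
lemma IsPeriodicLoewySeries.length_gammaRing (hR : IndecomposablesUniserial R)
    (hM : IsUniserial R M) (hW : IsPeriodicLoewySeries W s t)
    [IsNoetherianRing (GammaRing R M)] (he : ∀ i, i < e ↔ i * s < t) :
    Module.length (GammaRing R M) (GammaRing R M) = e := by
  have hQ := hW.isQuasiProjective_self hR hM
  have hnoeth : IsNoetherian (GammaRing R M) (HomModule R M M) :=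
    isNoetherian_of_linearEquiv HomModule.selfEquiv
  have hV : IsLoewySeries (fun i => HomModule.valuesIn M (W (i * s))) e := by
    refine ⟨?_, fun i hi => ⟨?_, fun Z hZ hZ' => ?_⟩, fun i hi => ?_⟩
    · rw [eq_top_iff]
      intro f _ x
      rw [zero_mul, hW.zero]
      trivial
    · rw [he] at hi
      have hlt : W ((i + 1) * s) < W (i * s) := hW.lt_of_lt (by
        rw [add_one_mul]
        exact Nat.lt_add_of_pos_right hW.pos) hi
      obtain ⟨φ, hφ⟩ := hW.exists_end_range_eq hR hM (Nat.mul_mod_left i s)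
      refine SetLike.lt_iff_le_and_exists.2 ⟨fun f hf x => hlt.le (hf x), φ, fun x => ?_,
        fun h => ?_⟩
      · exact hφ ▸ LinearMap.mem_range_self φ x
      · refine hlt.not_ge ?_
        rw [← hφ]
        rintro _ ⟨x, rfl⟩
        exact h x
    · -- a map in `Z` with image not in the smaller term has image exactly `W (i * s)`
      rw [he] at hi
      obtain ⟨f, hf, hf'⟩ := SetLike.exists_of_lt hZ
      refine hZ'.not_ge fun g hg => ?_
      refine HomModule.mem_of_range_le hQ Z (IsNoetherian.noetherian Z) g ?_
      refine le_trans ?_ (le_iSup (fun v : Z => LinearMap.range (v.1 : M →ₗ[R] M)) ⟨f, hf⟩)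
      obtain ⟨l, hl, hWl⟩ := hW.exists_eq hM (LinearMap.range (f : M →ₗ[R] M))
      have hgen : IsGeneratedBy M (W l) := hWl ▸ isGeneratedBy_range_one (f : M →ₗ[R] M)
      have hle : ¬ W l ≤ W ((i + 1) * s) := fun h => hf' fun x => h (hWl ▸ ⟨x, rfl⟩)
      have hlt : l < (i + 1) * s := by
        by_contra hge
        exact hle (hW.antitone (not_lt.1 hge))
      have hli : l ≤ i * s := by
        rcases hl.lt_or_eq with h | rfl
        · obtain ⟨j, rfl⟩ := (hW.isGeneratedBy_iff hR hM h).1 hgen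
          rw [mul_comm] at hlt ⊢
          exact Nat.mul_le_mul_right s (Nat.lt_succ_iff.1 (lt_of_mul_lt_mul_right' hlt))
        · exact absurd (by rw [hW.bot l le_rfl]; exact bot_le) hle
      rw [← hWl]
      refine le_trans ?_ (hW.antitone hli)
      rintro _ ⟨x, rfl⟩
      exact hg x
    · rw [eq_bot_iff]
      intro f hf
      refine LinearMap.ext fun x => ?_
      have h1 := hf x
      rw [hW.bot (i * s) (not_lt.1 fun h => absurd ((he i).2 h) (not_lt.2 hi))] at h1
      exact h1
  rw [HomModule.selfEquiv.length_eq]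
  exact hV.length_eq

end Length

/-! ### The projective-injective module -/

section ProjectiveInjective

variable {R : Type u} [Ring R] {M : Type u} [AddCommGroup M] [Module R M]
  {Q N P : Type u} [AddCommGroup Q] [Module R Q] [AddCommGroup N] [Module R N]
  [AddCommGroup P] [Module R P] {W : ℕ → Submodule R M} {s t : ℕ}

lemma HomModule.projective_of_retract (i : N →ₗ[R] Q) (r : Q →ₗ[R] N)
    (h : r ∘ₗ i = LinearMap.id) : Module.Projective (GammaRing R Q) (HomModule R Q N) := by
  have : Module.Projective (GammaRing R Q) (HomModule R Q Q) :=
    Module.Projective.of_equiv HomModule.selfEquiv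
  refine Module.Projective.of_split (HomModule.map i :
    HomModule R Q N →ₗ[GammaRing R Q] HomModule R Q Q) (HomModule.map r) ?_
  refine LinearMap.ext fun f => ?_
  change (r ∘ₗ i ∘ₗ (f : Q →ₗ[R] N) : Q →ₗ[R] N) = f
  rw [← LinearMap.comp_assoc, h]
  rfl

/-- If `Hom(Q, N)` is projective and `p : P → N` induces an epimorphism on `Hom(Q, -)`, then `p`
splits; if moreover `P` is uniserial and `N` nonzero, then `p` is injective. -/
lemma HomModule.injective_of_projective (hQ : IsQuasiProjective R Q)
    (hN : IsPresentedBy (R := R) Q N) [Nontrivial N] (hP : IsUniserial R P)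
    [Module.Projective (GammaRing R Q) (HomModule R Q N)] (p : P →ₗ[R] N)
    (hp : ∀ g : Q →ₗ[R] N, ∃ h : Q →ₗ[R] P, p ∘ₗ h = g) : Function.Injective p := by
  obtain ⟨σ, hσ⟩ := Module.projective_lifting_property (HomModule.map p :
    HomModule R Q P →ₗ[GammaRing R Q] HomModule R Q N) LinearMap.id hp
  obtain ⟨j, rfl⟩ := HomModule.map_surjective hQ hN σ
  have hpj : p ∘ₗ j = LinearMap.id := HomModule.map_injective hN.isGeneratedBy_top hσ
  have hpj' : ∀ x, p (j x) = x := LinearMap.congr_fun hpj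
  refine LinearMap.ker_eq_bot.1 ((hP.eq_bot_or_eq_bot (B := LinearMap.range j) ?_).resolve_right ?_)
  · rw [eq_bot_iff]
    rintro _ ⟨hx, ⟨y, rfl⟩⟩
    have h0 : y = 0 := (hpj' y).symm.trans hx
    rw [h0, map_zero]
    exact zero_mem _
  · intro h
    obtain ⟨x, hx⟩ := exists_ne (0 : N)
    apply hx
    rw [← hpj' x, LinearMap.range_eq_bot.1 h, LinearMap.zero_apply, map_zero]

/-- If `Hom(Q, N)` is injective, monomorphisms from `N` to a uniserial module are bijective. -/
lemma HomModule.surjective_of_injective (hQ : IsQuasiProjective R Q)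
    (hN : IsPresentedBy (R := R) Q N) [Nontrivial N] (hP : IsUniserial R P)
    (hPQ : IsPresentedBy (R := R) Q P)
    [Module.Injective (GammaRing R Q) (HomModule R Q N)] (i : N →ₗ[R] P)
    (hi : Function.Injective i) : Function.Surjective i := by
  obtain ⟨ρ, hρ⟩ := Module.Injective.out (HomModule.map i :
    HomModule R Q N →ₗ[GammaRing R Q] HomModule R Q P)
    (fun f g hfg => LinearMap.ext fun x => hi (LinearMap.congr_fun hfg x)) LinearMap.id
  obtain ⟨r, rfl⟩ := HomModule.map_surjective hQ hPQ ρ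
  have hri : r ∘ₗ i = LinearMap.id := HomModule.map_injective hN.isGeneratedBy_top
    (LinearMap.ext hρ)
  have hri' : ∀ x, r (i x) = x := LinearMap.congr_fun hri
  have hker : LinearMap.ker r = ⊥ := by
    refine (hP.eq_bot_or_eq_bot (B := LinearMap.range i) ?_).resolve_right ?_
    · rw [eq_bot_iff]
      rintro _ ⟨hx, ⟨y, rfl⟩⟩
      have h0 : y = 0 := (hri' y).symm.trans hx
      rw [h0, map_zero]
      exact zero_mem _
    · intro h
      obtain ⟨x, hx⟩ := exists_ne (0 : N)
      exact hx (hi (by rw [LinearMap.range_eq_bot.1 h]; rfl))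
  intro y
  exact ⟨r y, LinearMap.ker_eq_bot.1 hker (hri' (r y))⟩

variable [IsArtinianRing R] [Module.Finite R M]

/-- `Hom(Q, M)` is injective, by Baer's criterion: a left ideal of `Γ(Q)` is `Hom(Q, N)` for a
submodule `N` of `Q` in the perpendicular category, and maps from `N` to `M` extend to `Q`. -/
lemma IsPerpGenerator.injective_homModule (hR : IndecomposablesUniserial R) (hM : IsUniserial R M)
    (hW : IsPeriodicLoewySeries W s t) (hQ : IsPerpGenerator W s t Q) [Module.Finite R Q]
    [IsNoetherianRing (GammaRing R Q)] :
    Module.Injective (GammaRing R Q) (HomModule R Q M) := by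
  have hqp := hQ.isQuasiProjective
  apply Module.Baer.injective
  intro I g
  obtain ⟨m, K, hK, ⟨e⟩⟩ := HomModule.exists_equiv hqp I
  let N := (Fin m → Q) ⧸ K
  have hNp : IsPresentedBy (R := R) Q N :=
    isPresentedBy_of_surjective K.mkQ K.mkQ_surjective (by rwa [Submodule.ker_mkQ])
  have hN := (hQ.isPerpendicular_iff hR hM hW).2 hNp
  obtain ⟨j, hj⟩ := HomModule.map_surjective hqp hNp
    (HomModule.selfEquiv.toLinearMap ∘ₗ I.subtype ∘ₗ e.symm.toLinearMap)
  obtain ⟨f, hf⟩ := HomModule.map_surjective hqp hNp (g ∘ₗ e.symm.toLinearMap)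
  have hjinj : Function.Injective j := by
    rw [← LinearMap.ker_eq_bot, eq_bot_iff]
    intro x hx
    have hgen := hQ.isGeneratedBy hR hM hW (hN.ker hQ.isPerpendicular j)
    refine homTrace_induction (hgen hx) (p := fun x => x = 0) (fun h y hh => ?_) rfl
      fun x y hx hy => by rw [hx, hy, add_zero]
    have h0 : HomModule.map j (h : HomModule R Q N) = 0 := LinearMap.ext hh
    rw [hj] at h0
    have h1 : e.symm (h : HomModule R Q N) = 0 :=
      Subtype.ext (HomModule.selfEquiv.injective h0)
    have h2 : (h : HomModule R Q N) = 0 := e.symm.injective (h1.trans (map_zero e.symm).symm)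
    exact LinearMap.congr_fun h2 y
  obtain ⟨h, hh⟩ := hW.exists_extension hR hM hQ.isPerpendicular.ann j hjinj f
  refine ⟨HomModule.map h ∘ₗ HomModule.selfEquiv.toLinearMap, fun x hx => ?_⟩
  have h1 : HomModule.map j (e ⟨x, hx⟩) = HomModule.selfEquiv x := by
    rw [hj]
    simp
  have h2 : HomModule.map f (e ⟨x, hx⟩) = g ⟨x, hx⟩ := by
    rw [hf]
    simp
  rw [← h2, ← hh, LinearMap.comp_apply]
  exact (congrArg (HomModule.map h) h1).symm

/-- `Hom(Q, M)` is the only indecomposable module which is both projective and injective. -/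
lemma IsPerpGenerator.projective_injective_iff (hR : IndecomposablesUniserial R)
    (hM : IsUniserial R M) (hW : IsPeriodicLoewySeries W s t) (hQ : IsPerpGenerator W s t Q)
    [Module.Finite R Q] [IsNoetherianRing (GammaRing R Q)] (X : Type u) [AddCommGroup X]
    [Module (GammaRing R Q) X] [Module.Finite (GammaRing R Q) X] :
    (IsIndecomposableModule (GammaRing R Q) X ∧ Module.Projective (GammaRing R Q) X ∧
      Module.Injective (GammaRing R Q) X) ↔ Nonempty (X ≃ₗ[GammaRing R Q] HomModule R Q M) := by
  have hst := hW.le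
  have hpos := hW.pos
  have hmod := Nat.mod_lt t hpos
  have hqp := hQ.isQuasiProjective
  have hMp := (hQ.isPerpendicular_iff hR hM hW).1 (hW.isPerpendicular_self hR hM)
  have hMnt : Nontrivial M := by
    rw [← Module.length_pos_iff (R := R), hW.length_eq]
    exact_mod_cast hpos.trans_le hst
  constructor
  · rintro ⟨hXi, hXp, hXinj⟩
    obtain ⟨m, K, hK, ⟨e⟩⟩ := HomModule.exists_equiv hqp X
    let N := (Fin m → Q) ⧸ K
    have hNp : IsPresentedBy (R := R) Q N :=
      isPresentedBy_of_surjective K.mkQ K.mkQ_surjective (by rwa [Submodule.ker_mkQ])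
    have hN := (hQ.isPerpendicular_iff hR hM hW).2 hNp
    have hNi : IsIndecomposableModule R N :=
      HomModule.isIndecomposableModule hNp.isGeneratedBy_top (hXi.congr e)
    have hNnt := hNi.1
    have hNu := hR N hNi
    have : Module.Projective (GammaRing R Q) (HomModule R Q N) := Module.Projective.of_equiv e
    have : Module.Injective (GammaRing R Q) (HomModule R Q N) := (Module.Baer.of_equiv e (.of_injective hXinj)).injective
    suffices h : Nonempty (N ≃ₗ[R] M) by
      obtain ⟨f⟩ := h
      refine ⟨e.trans (LinearEquiv.ofBijective (HomModule.map f.toLinearMap) ⟨?_, ?_⟩)⟩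
      · exact fun a b hab => LinearMap.ext fun x => f.injective (LinearMap.congr_fun hab x)
      · intro b
        exact ⟨(f.symm.toLinearMap ∘ₗ (b : Q →ₗ[R] M) : Q →ₗ[R] N),
          LinearMap.ext fun x => f.apply_symm_apply _⟩
    obtain ⟨H, hH, -⟩ := (eq_top_or_exists_le_coatom (⊥ : Submodule R N)).resolve_left bot_ne_top
    have : IsSimpleModule R (N ⧸ H) := isSimpleModule_iff_isCoatom.2 hH
    obtain ⟨i, hi, ⟨eH⟩⟩ := hW.exists_equiv (N ⧸ H)
    obtain ⟨g, hg⟩ := hW.exists_surjective_of_top hR hM hNu hN.ann hi H.mkQ H.mkQ_surjective eH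
    have hWi : IsPerpendicular W s t (W i) := by
      rcases hN.eq_of_surjective hR hM hW H.mkQ H.mkQ_surjective hi eH with rfl | rfl
      · exact hW.isPerpendicular hR hM (Nat.zero_le t) (Or.inl (Nat.zero_mod s))
      · exact hW.isPerpendicular hR hM (Nat.mod_le t s) (Or.inr (Nat.mod_mod t s))
    have hginj := HomModule.injective_of_projective hqp hNp (hM.submodule (W i)) g
      fun f => hQ.annProjective _ _ hWi.ann g hg f
    let eN := LinearEquiv.ofBijective g ⟨hginj, hg⟩
    let ι : N →ₗ[R] M := (W i).subtype ∘ₗ eN.symm.toLinearMap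
    have hι : Function.Injective ι := (W i).subtype_injective.comp eN.symm.injective
    exact ⟨LinearEquiv.ofBijective ι
      ⟨hι, HomModule.surjective_of_injective hqp hNp hM hMp ι hι⟩⟩
  · rintro ⟨e⟩
    have hfin : Module.Finite (GammaRing R Q) (HomModule R Q M) := Module.Finite.equiv e
    have h1 : IsIndecomposableModule (GammaRing R Q) (HomModule R Q M) := by
      have := HomModule.nontrivial hMp.isGeneratedBy_top
      have hu : IsUniserial (GammaRing R Q) (HomModule R Q M) := HomModule.total hqp hM
      exact hu.isIndecomposableModule
    obtain ⟨p, hp⟩ := hQ.exists_zero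
    obtain ⟨i, hi⟩ := (hW.isAnnProjective hR hM hpos).congr hW.equivZero.symm _ _
      hQ.isPerpendicular.ann (hW.equivZero.symm.toLinearMap ∘ₗ p)
      (hW.equivZero.symm.surjective.comp hp) LinearMap.id
    have h2 := HomModule.projective_of_retract i _ hi
    have h3 := hQ.injective_homModule hR hM hW
    exact ⟨h1.congr e.symm, Module.Projective.of_equiv e.symm,
      (Module.Baer.of_equiv e.symm (.of_injective h3)).injective⟩

end ProjectiveInjective

/-! ### Kernels, cokernels and products of finitely generated modules -/

section Concrete

variable {R : Type u} [Ring R]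

/-- An injective linear map onto the kernel of `f` is a categorical kernel of `f`. -/
def fgKernelIsLimit {K N N' : FGModuleCat.{u} R} (f : N ⟶ N') (j : K ⟶ N)
    (hj : Function.Injective j.hom.hom)
    (hjf : LinearMap.range j.hom.hom = LinearMap.ker f.hom.hom) :
    IsLimit (KernelFork.ofι (f := f) j (FGModuleCat.hom_ext
      (LinearMap.range_le_ker_iff.1 hjf.le))) :=
  have lift (c : KernelFork f) : ∃ g, j.hom.hom ∘ₗ g = c.ι.hom.hom :=
    exists_comp_eq_of_range_le j.hom.hom hj c.ι.hom.hom (hjf ▸ LinearMap.range_le_ker_iff.2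
      (congrArg (fun g => g.hom.hom) (KernelFork.condition c)))
  Fork.IsLimit.mk _
    (fun c => FGModuleCat.ofHom (lift c).choose)
    (fun c => FGModuleCat.hom_ext (lift c).choose_spec)
    (fun c _ hm => FGModuleCat.hom_ext (LinearMap.ext fun x => hj
      ((LinearMap.congr_fun (congrArg (fun g => g.hom.hom) hm) x).trans
        (LinearMap.congr_fun (lift c).choose_spec x).symm)))

/-- The quotient by the range of a linear map is a categorical cokernel. -/
def fgCokernelIsColimit {N N' : FGModuleCat.{u} R} (f : N ⟶ N') :
    IsColimit (CokernelCofork.ofπ (f := f)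
      (FGModuleCat.ofHom (LinearMap.range f.hom.hom).mkQ : N' ⟶ FGModuleCat.of R _)
      (FGModuleCat.hom_ext (LinearMap.range_mkQ_comp _))) :=
  Cofork.IsColimit.mk _
    (fun c => FGModuleCat.ofHom ((LinearMap.range f.hom.hom).liftQ c.π.hom.hom
      (LinearMap.range_le_ker_iff.2
        (congrArg (fun g => g.hom.hom) (CokernelCofork.condition c)))))
    (fun _ => FGModuleCat.hom_ext (Submodule.liftQ_mkQ _ _ _))
    (fun c m hm => FGModuleCat.hom_ext (by
      refine Submodule.linearMap_qext _ ?_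
      refine (congrArg (fun g => g.hom.hom) hm).trans ?_
      exact (Submodule.liftQ_mkQ _ _ _).symm))

/-- The product of a finite family of modules is a categorical product. -/
def fgProductIsLimit {J : Type} [Finite J] (N : J → FGModuleCat.{u} R) :
    IsLimit (Fan.mk (FGModuleCat.of R (Π j, N j))
      fun j => (FGModuleCat.ofHom (LinearMap.proj j) : _ ⟶ N j)) :=
  Fan.IsLimit.mk _
    (fun c => FGModuleCat.ofHom (LinearMap.pi fun j => (c.proj j).hom.hom))
    (fun _ _ => FGModuleCat.hom_ext rfl)
    (fun _ _ hm => FGModuleCat.hom_ext (LinearMap.ext fun x => funext fun j =>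
      LinearMap.congr_fun (congrArg (fun g => g.hom.hom) (hm j)) x))

variable {P : ObjectProperty (FGModuleCat.{u} R)}

lemma isClosedUnderKernels_of_ker [IsNoetherianRing R]
    (hcongr : ∀ X Y : FGModuleCat.{u} R, (X ≃ₗ[R] Y) → P X → P Y)
    (h : ∀ (X Y : FGModuleCat.{u} R) (f : X →ₗ[R] Y), P X → P Y →
      P (FGModuleCat.of R (LinearMap.ker f))) : P.IsClosedUnderKernels where
  kernels_le := by
    rintro _ ⟨f, c, hc, hf⟩
    exact hcongr _ _ (FGModuleCat.isoToLinearEquiv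
      ((fgKernelIsLimit f (FGModuleCat.ofHom (LinearMap.ker f.hom.hom).subtype)
        (Submodule.subtype_injective _) (Submodule.range_subtype _)).conePointUniqueUpToIso hc)) (h _ _ _ hf.1 hf.2)

lemma isClosedUnderCokernels_of_quotient
    (hcongr : ∀ X Y : FGModuleCat.{u} R, (X ≃ₗ[R] Y) → P X → P Y)
    (h : ∀ (X Y : FGModuleCat.{u} R) (f : X →ₗ[R] Y), P X → P Y →
      P (FGModuleCat.of R (Y ⧸ LinearMap.range f))) : P.IsClosedUnderCokernels where
  cokernels_le := by
    rintro _ ⟨f, c, hc, hf⟩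
    exact hcongr _ _ (FGModuleCat.isoToLinearEquiv
      ((fgCokernelIsColimit f).coconePointUniqueUpToIso hc)) (h _ _ _ hf.1 hf.2)

lemma isClosedUnderFiniteProducts_of_pi
    (hcongr : ∀ X Y : FGModuleCat.{u} R, (X ≃ₗ[R] Y) → P X → P Y)
    (h : ∀ (J : Type) [Finite J] (X : J → FGModuleCat.{u} R), (∀ j, P (X j)) →
      P (FGModuleCat.of R (Π j, X j))) : P.IsClosedUnderFiniteProducts where
  isClosedUnderLimitsOfShape J _ :=
    { limitsOfShape_le := by
        rintro X ⟨p⟩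
        exact hcongr _ _ (FGModuleCat.isoToLinearEquiv
          ((fgProductIsLimit fun j => p.diag.obj ⟨j⟩).conePointsIsoOfNatIso p.isLimit
            Discrete.natIsoFunctor.symm)) (h J _ fun j => p.prop_diag_obj ⟨j⟩) }

namespace IsExactAbelianSubcategory

lemma prop_of_ker (hP : IsExactAbelianSubcategory R P) {K X Y : FGModuleCat.{u} R} (hX : P X)
    (hY : P Y) (f : X →ₗ[R] Y) (j : K →ₗ[R] X) (hj : Function.Injective j)
    (hjf : LinearMap.range j = LinearMap.ker f) : P K :=
  have := hP.kernels
  P.prop_of_isLimit_kernelFork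
    (fgKernelIsLimit (FGModuleCat.ofHom f) (FGModuleCat.ofHom j) hj hjf) hX hY

lemma congr (hP : IsExactAbelianSubcategory R P) {X Y : FGModuleCat.{u} R} (hX : P X)
    (e : X ≃ₗ[R] Y) : P Y :=
  hP.prop_of_ker hX hX 0 e.symm.toLinearMap e.symm.injective
    ((LinearMap.range_eq_top.2 e.symm.surjective).trans LinearMap.ker_zero.symm)

lemma prop_pi (hP : IsExactAbelianSubcategory R P) {J : Type} [Finite J]
    {X : J → FGModuleCat.{u} R} (hX : ∀ j, P (X j)) : P (FGModuleCat.of R (Π j, X j)) :=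
  have := hP.directSums
  P.prop_of_isLimit_fan (fgProductIsLimit X) hX

lemma prop_of_coker (hP : IsExactAbelianSubcategory R P) {C X Y : FGModuleCat.{u} R} (hX : P X)
    (hY : P Y) (f : X →ₗ[R] Y) (c : Y →ₗ[R] C) (hc : Function.Surjective c)
    (hfc : LinearMap.range f = LinearMap.ker c) : P C :=
  have := hP.cokernels
  hP.congr (P.prop_of_isColimit_cokernelCofork
    (fgCokernelIsColimit (FGModuleCat.ofHom f : X ⟶ Y)) hX hY)
    ((Submodule.quotEquivOfEq _ _ hfc).trans (c.quotKerEquivOfSurjective hc))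

lemma prop_prod (hP : IsExactAbelianSubcategory R P) {X Y : FGModuleCat.{u} R} (hX : P X)
    (hY : P Y) : P (FGModuleCat.of R (X × Y)) := by
  let Z : Bool → FGModuleCat.{u} R := fun b => if b then X else Y
  have hZ : ∀ b, P (Z b) := by
    rintro (_ | _)
    · exact hY
    · exact hX
  refine hP.congr (hP.prop_pi hZ)
    { toFun := fun x => (x true, x false)
      map_add' := fun _ _ => rfl
      map_smul' := fun _ _ => rfl
      invFun := fun x b => match b with
        | true => x.1
        | false => x.2
      left_inv := fun x => funext fun b => by cases b <;> rfl
      right_inv := fun _ => rfl }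

end IsExactAbelianSubcategory

end Concrete

/-! ### The categories `ab M` and `stat M` -/

section Subcategories

variable {R : Type u} [Ring R] [IsArtinianRing R] {M : Type u} [AddCommGroup M] [Module R M]
  [Module.Finite R M] {Q : Type u} [AddCommGroup Q] [Module R Q] {W : ℕ → Submodule R M} {s t : ℕ}

lemma IsPeriodicLoewySeries.isExactAbelianSubcategory (hR : IndecomposablesUniserial R)
    (hM : IsUniserial R M) (hW : IsPeriodicLoewySeries W s t) :
    IsExactAbelianSubcategory R (fun N => IsPerpendicular W s t N) where
  kernels := isClosedUnderKernels_of_ker (fun _ _ e h => h.congr e)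
    fun _ _ f hX hY => hX.ker hY f
  cokernels := isClosedUnderCokernels_of_quotient (fun _ _ e h => h.congr e)
    fun _ _ f hX hY => hY.quotient hR hM hW (IsPerpendicular.range hR hM hW hX hY f)
  directSums := isClosedUnderFiniteProducts_of_pi (fun _ _ e h => h.congr e)
    fun _ _ _ hX => IsPerpendicular.pi hX

/-- The category `ab M` is the perpendicular category: both are presented by `M × W (t % s)`, and
`W (t % s)` is the kernel of an endomorphism of `M`. -/
lemma IsPeriodicLoewySeries.abCat_iff (hR : IndecomposablesUniserial R)
    (hM : IsUniserial R M) (hW : IsPeriodicLoewySeries W s t) (N : FGModuleCat.{u} R) :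
    abCat R M N ↔ IsPerpendicular W s t N := by
  constructor
  · intro h
    exact h _ (hW.isExactAbelianSubcategory hR hM) (hW.isPerpendicular_self hR hM)
  · intro h P hP hPM
    have hQ := hW.isPerpGenerator_prod hR hM
    obtain ⟨n, p, hp, hK⟩ := (hQ.isPerpendicular_iff hR hM hW).1 h
    obtain ⟨m, q, hq⟩ := hK.exists_range_eq (IsNoetherian.noetherian _)
    have hmod := Nat.mod_le t s
    have hWP : P (FGModuleCat.of R (W (t % s))) := by
      obtain ⟨φ, hφ⟩ := hW.exists_end_range_eq hR hM (l := t - t % s)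
        (Nat.sub_mod_eq_zero_of_mod_eq (Nat.mod_mod t s).symm)
      refine hP.prop_of_ker hPM hPM φ (W (t % s)).subtype (Submodule.subtype_injective _) ?_
      rw [Submodule.range_subtype, hW.ker_eq_of_range_eq hM (φ := φ)]
      rw [hφ, hW.length_add (by omega), Nat.sub_sub_self hmod]
    have hQP : P (FGModuleCat.of R (M × W (t % s))) := hP.prop_prod hPM hWP
    exact hP.prop_of_coker (hP.prop_pi (J := Fin m) fun _ => hQP)
      (hP.prop_pi (J := Fin n) fun _ => hQP) q p hp hq

lemma IsPeriodicLoewySeries.statCat_iff (hR : IndecomposablesUniserial R)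
    (hM : IsUniserial R M) (hW : IsPeriodicLoewySeries W s t) (N : FGModuleCat.{u} R) :
    statCat R M N ↔ IsPresentedBy (R := R) M N :=
  isStatic_iff_isPresentedBy (hW.isQuasiProjective_self hR hM)

lemma IsPeriodicLoewySeries.statCat_le_abCat (hR : IndecomposablesUniserial R)
    (hM : IsUniserial R M) (hW : IsPeriodicLoewySeries W s t) : statCat R M ≤ abCat R M := by
  intro N hN
  rw [hW.abCat_iff hR hM]
  have hMp := hW.isPerpendicular_self hR hM
  obtain ⟨n, p, hp, hK⟩ := (hW.statCat_iff hR hM N).1 hN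
  obtain ⟨m, q, hq⟩ := hK.exists_range_eq (IsNoetherian.noetherian _)
  exact IsPerpendicular.of_coker hR hM hW (IsPerpendicular.pi fun _ => hMp)
    (IsPerpendicular.pi fun _ => hMp) q p hp hq

lemma IsPeriodicLoewySeries.statCat_eq_abCat (hR : IndecomposablesUniserial R)
    (hM : IsUniserial R M) (hW : IsPeriodicLoewySeries W s t) (hst : s ∣ t) :
    statCat R M = abCat R M := by
  ext N
  rw [hW.statCat_iff hR hM, hW.abCat_iff hR hM,
    (hW.isPerpGenerator_self hR hM hst).isPerpendicular_iff hR hM hW]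

lemma IsPeriodicLoewySeries.isClosedUnderCokernels_statCat (hR : IndecomposablesUniserial R)
    (hM : IsUniserial R M) (hW : IsPeriodicLoewySeries W s t) :
    (statCat R M).IsClosedUnderCokernels := by
  refine isClosedUnderCokernels_of_quotient (fun X Y e h => ?_) fun X Y f hX hY => ?_
  · rw [hW.statCat_iff hR hM] at h ⊢
    exact h.congr e
  · rw [hW.statCat_iff hR hM] at hX hY ⊢
    exact (hW.isQuasiProjective_self hR hM).isPresentedBy_coker hX hY f
      (LinearMap.range f).mkQ (Submodule.mkQ_surjective _) (Submodule.ker_mkQ _).symm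

end Subcategories

section Exactness

variable {R : Type u} [Ring R] [IsArtinianRing R] {M : Type u} [AddCommGroup M] [Module R M]
  [Module.Finite R M] [IsNoetherianRing (GammaRing R M)] {W : ℕ → Submodule R M} {s t : ℕ}

/-- `stat M` is abelian, being equivalent to `mod Γ(M)`. -/
lemma IsPeriodicLoewySeries.exists_abelian_statCat (hR : IndecomposablesUniserial R)
    (hM : IsUniserial R M) (hW : IsPeriodicLoewySeries W s t) :
    ∃ A : Abelian (statCat R M).FullSubcategory,
      A.toPreadditive = Preadditive.fullSubcategory (statCat R M) := by
  have hQ := hW.isQuasiProjective_self hR hM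
  have hP : ∀ N, statCat R M N → IsPresentedBy (R := R) M N := fun N =>
    (hW.statCat_iff hR hM N).1
  have : (homFunctor (statCat R M) hQ hP).IsEquivalence :=
    homFunctor_isEquivalence hQ hP fun N => (hW.statCat_iff hR hM N).2
  have : HasFiniteProducts (statCat R M).FullSubcategory :=
    ⟨fun n => Adjunction.hasLimitsOfShape_of_equivalence (homFunctor (statCat R M) hQ hP)⟩
  exact ⟨abelianOfEquivalence (homFunctor (statCat R M) hQ hP), rfl⟩

lemma IsPeriodicLoewySeries.preservesFiniteColimits_statCat (hR : IndecomposablesUniserial R)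
    (hM : IsUniserial R M) (hW : IsPeriodicLoewySeries W s t) :
    PreservesFiniteColimits (statCat R M).ι := by
  obtain ⟨A, hA⟩ := hW.exists_abelian_statCat hR hM
  have h1 : HasFiniteCoproducts (statCat R M).FullSubcategory := inferInstance
  have h2 : HasCoequalizers (statCat R M).FullSubcategory := inferInstance
  have h3 : HasZeroObject (statCat R M).FullSubcategory := inferInstance
  clear hA A
  have := hW.isClosedUnderCokernels_statCat hR hM
  have := (statCat R M).preservesCokernels_ι
  have := HasBinaryBiproducts.of_hasBinaryCoproducts (C := (statCat R M).FullSubcategory)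
  exact Functor.preservesFiniteColimits_of_preservesCokernels _

/-- The embedding of `stat M` is left exact if and only if `s ∣ t`: otherwise the kernel `W s` of
`M → M / W s` in `mod R` does not belong to `stat M`. -/
lemma IsPeriodicLoewySeries.preservesFiniteLimits_statCat_iff (hR : IndecomposablesUniserial R)
    (hM : IsUniserial R M) (hW : IsPeriodicLoewySeries W s t) :
    PreservesFiniteLimits (statCat R M).ι ↔ s ∣ t := by
  obtain ⟨A, hA⟩ := hW.exists_abelian_statCat hR hM
  have h1 : HasFiniteProducts (statCat R M).FullSubcategory := inferInstance
  have h2 : HasFiniteLimits (statCat R M).FullSubcategory := inferInstance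
  have h3 : HasZeroObject (statCat R M).FullSubcategory := inferInstance
  clear hA A
  constructor
  · intro hlim
    by_contra hst
    have hlt : s < t := lt_of_le_of_ne hW.le fun h => hst (h ▸ dvd_rfl)
    let X : (statCat R M).FullSubcategory :=
      ⟨FGModuleCat.of R M, (hW.statCat_iff hR hM _).2 isPresentedBy_self⟩
    let Y : (statCat R M).FullSubcategory :=
      ⟨FGModuleCat.of R (M ⧸ W s), (hW.statCat_iff hR hM _).2
        ((hW.isPresentedBy_quotient_iff hR hM hlt.le).2 (Or.inr dvd_rfl))⟩
    let f : X ⟶ Y := ⟨FGModuleCat.ofHom (W s).mkQ⟩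
    let K : FGModuleCat.{u} R := FGModuleCat.of R (W s)
    let i : K ⟶ (statCat R M).ι.obj X := FGModuleCat.ofHom (W s).subtype
    have hi : IsLimit _ := fgKernelIsLimit ((statCat R M).ι.map f) i (W s).subtype_injective
      ((W s).range_subtype.trans (W s).ker_mkQ.symm)
    let E : (kernel f).obj ≅ K := (PreservesKernel.iso (statCat R M).ι f).trans
      ((kernelIsKernel _).conePointUniqueUpToIso hi)
    have hK : IsPresentedBy (R := R) M (W s) :=
      ((hW.statCat_iff hR hM _).1 (kernel f).property).congr (FGModuleCat.isoToLinearEquiv E)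
    have hlen := hW.length_add hlt.le
    have : Nontrivial (W s) := by
      rw [← Module.length_pos_iff (R := R), hlen]
      exact_mod_cast Nat.sub_pos_of_lt hlt
    have hpos := hW.pos
    rcases (hW.isPresentedBy_iff hR hM (hM.submodule (W s)).isIndecomposableModule).1 hK with
      ⟨⟨e⟩⟩ | ⟨j, -, hj, ⟨e⟩⟩
    · have h := e.length_eq
      rw [hlen, hW.length_eq, Nat.cast_inj] at h
      omega
    · have h := e.length_eq
      rw [hlen, hW.length_quotient hj.le, Nat.cast_inj] at h
      exact hst ((Nat.dvd_sub_self_right).1 (h ▸ dvd_mul_left s j) |>.resolve_right (by omega))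
  · intro hst
    have : (statCat R M).IsClosedUnderKernels := by
      rw [hW.statCat_eq_abCat hR hM hst]
      have h := (hW.isExactAbelianSubcategory hR hM).kernels
      have heq : abCat R M = fun N : FGModuleCat.{u} R => IsPerpendicular W s t N :=
        funext fun N => propext (hW.abCat_iff hR hM N)
      rwa [heq]
    have := (statCat R M).preservesKernels_ι
    have := HasBinaryBiproducts.of_hasBinaryProducts (C := (statCat R M).FullSubcategory)
    exact Functor.preservesFiniteLimits_of_preservesKernels _

end Exactness

section Equivalence

variable {k : Type w} [Field k] {R : Type u} [Ring R] [Algebra k R] [Module.Finite k R]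
  [IsArtinianRing R] {M : Type u} [AddCommGroup M] [Module R M]
  [Module.Finite R M] {W : ℕ → Submodule R M} {s t : ℕ}
  {Q : Type u} [AddCommGroup Q] [Module k Q] [Module R Q] [IsScalarTower k R Q] [Module.Finite R Q]

variable (k) in
/-- A projective generator `Q` of `ab M` gives an equivalence between `ab M` and `mod Γ(Q)`. -/
lemma IsPerpGenerator.exists_equivalence (hR : IndecomposablesUniserial R)
    (hM : IsUniserial R M) (hW : IsPeriodicLoewySeries W s t) (hQ : IsPerpGenerator W s t Q) :
    ∃ η : (abCat R M).FullSubcategory ≌ FGModuleCat.{u} (GammaRing R Q),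
      η.functor.Additive ∧ η.functor.Linear k ∧
      ∀ X : FGModuleCat.{u} (GammaRing R Q),
        (IsIndecomposableModule (GammaRing R Q) X ∧ Module.Projective (GammaRing R Q) X ∧
          Module.Injective (GammaRing R Q) X) ↔
        Nonempty (X ≃ₗ[GammaRing R Q] η.functor.obj (abCatSelf R M)) := by
  have := finite_gammaRing (k := k) (R := R) (Q := Q)
  have : IsNoetherianRing (GammaRing R Q) := IsNoetherianRing.of_finite k _
  have hqp := hQ.isQuasiProjective
  have hiff : ∀ N, abCat R M N ↔ IsPresentedBy (R := R) Q N := fun N =>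
    (hW.abCat_iff hR hM N).trans (hQ.isPerpendicular_iff hR hM hW)
  have hP := fun N => (hiff N).1
  have : (homFunctor (abCat R M) hqp hP).IsEquivalence :=
    homFunctor_isEquivalence hqp hP fun N => (hiff N).2
  refine ⟨(homFunctor (abCat R M) hqp hP).asEquivalence,
    inferInstanceAs (homFunctor (abCat R M) hqp hP).Additive,
    inferInstanceAs ((homFunctor (abCat R M) hqp hP).Linear k), fun X => ?_⟩
  exact hQ.projective_injective_iff hR hM hW X

end Equivalence

end

theorem proposition8 {k : Type w} [Field k] {Λ : Type u} [Ring Λ] [Algebra k Λ]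
    (hΛ : IsNakayamaAlgebra k Λ) (hconn : IsConnectedRing Λ)
    (s : ℕ) (hs : numSimples Λ = s)
    (M : Type u) [AddCommGroup M] [Module k M] [Module Λ M] [IsScalarTower k Λ M]
    [Module.Finite Λ M] (hM : IsIndecomposableModule Λ M)
    (S : Type u) [AddCommGroup S] [Module Λ S] (hS : Nonempty (ModuleTop Λ M ≃ₗ[Λ] S))
    (t : ℕ) (ht : Module.length Λ M = t) (hst : s ≤ t)
    (e : ℕ) (he : e = ⌈(t : ℚ) / (s : ℚ)⌉₊) :
    -- the modules `[i]S` with `1 ≤ i ≤ t` exist and are unique up to isomorphism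
    (∀ i : ℕ, 1 ≤ i → i ≤ t → ∃ X : FGModuleCat.{u} Λ, IsBracket Λ S i X ∧
      ∀ Y : FGModuleCat.{u} Λ, IsBracket Λ S i Y → Nonempty (Y ≃ₗ[Λ] X)) ∧
    -- `Γ(M)` is a local Nakayama algebra of length `e`
    (IsLocalRing (GammaRing Λ M) ∧ IsNakayamaAlgebra k (GammaRing Λ M) ∧
      Module.length (GammaRing Λ M) (GammaRing Λ M) = e) ∧
    -- (a), the case `s ∣ t`
    (s ∣ t →
      statCat Λ M = abCat Λ M ∧
      LinearlyEquivalent k (abCat Λ M).FullSubcategory (FGModuleCat.{u} (GammaRing Λ M)) ∧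
      ∀ N : FGModuleCat.{u} Λ, IsIndecomposableModule Λ N →
        (abCat Λ M N ↔ ∃ i : ℕ, 1 ≤ i ∧ i ≤ e ∧ IsBracket Λ S (i * s) N)) ∧
    -- (a), the case `s ∤ t`
    (¬ s ∣ t → ∀ s₁ : ℕ, 1 ≤ s₁ → s₁ < s → t = (e - 1) * s + s₁ →
      (∃ (Γ' : Type u) (_ : Ring Γ') (_ : Algebra k Γ'),
        IsNakayamaAlgebra k Γ' ∧ numSimples Γ' = 2 ∧
        LinearlyEquivalent k (abCat Λ M).FullSubcategory (FGModuleCat.{u} Γ')) ∧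
      (∃ (X B₁ : FGModuleCat.{u} Λ) (p : X →ₗ[Λ] B₁),
        IsBracket Λ S s X ∧ IsBracket Λ S s₁ B₁ ∧ Function.Surjective p ∧
        ∀ N : FGModuleCat.{u} Λ, abCat Λ M N → HasFiltration Λ B₁ (LinearMap.ker p) N) ∧
      statCat Λ M ≤ abCat Λ M ∧
      ∀ N : FGModuleCat.{u} Λ, IsIndecomposableModule Λ N →
        (statCat Λ M N ↔
          (Nonempty (N ≃ₗ[Λ] M) ∨ ∃ i : ℕ, 1 ≤ i ∧ i < e ∧ IsBracket Λ S (i * s) N))) ∧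
    -- (b)
    (∃ (Γ' : Type u) (_ : Ring Γ') (_ : Algebra k Γ')
        (η : (abCat Λ M).FullSubcategory ≌ FGModuleCat.{u} Γ'),
      IsNakayamaAlgebra k Γ' ∧ numSimples Γ' ≤ 2 ∧
      η.functor.Additive ∧ η.functor.Linear k ∧
      ∀ X : FGModuleCat.{u} Γ',
        (IsIndecomposableModule Γ' X ∧ Module.Projective Γ' X ∧ Module.Injective Γ' X) ↔
          Nonempty (X ≃ₗ[Γ'] η.functor.obj (abCatSelf Λ M))) ∧
    -- (c)
    ((∃ A : Abelian (statCat Λ M).FullSubcategory,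
        A.toPreadditive = Preadditive.fullSubcategory (statCat Λ M)) ∧
      PreservesFiniteColimits (statCat Λ M).ι ∧
      ((PreservesFiniteLimits (statCat Λ M).ι ∧ PreservesFiniteColimits (statCat Λ M).ι) ↔
        s ∣ t)) := by
  have hfin := hΛ.finite
  have hart : IsArtinianRing Λ := IsArtinianRing.of_finite k _
  have hR := hΛ.indecomposablesUniserial
  have hMu := hR M hM
  have hMnt := hM.1
  obtain ⟨W, t', hW'⟩ := exists_isLoewySeries Λ M
  obtain rfl : t' = t := by
    have := hW'.length_eq
    rw [ht, Nat.cast_inj] at this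
    exact this.symm
  have htpos : 0 < t' := by
    have := Module.length_pos (R := Λ) (M := M)
    rw [ht] at this
    exact_mod_cast this
  have hW := hR.isPeriodicLoewySeries hconn hs hMu hW' htpos hst
  have hspos := hW.pos
  have hlt : ∀ i, i < e ↔ i * s < t' := by
    intro i
    rw [he, Nat.lt_ceil, lt_div_iff₀ (by exact_mod_cast hspos)]
    exact_mod_cast Iff.rfl
  have hbr : ∀ {i : ℕ} (N : FGModuleCat.{u} Λ), 1 ≤ i → i ≤ t' →
      (IsBracket Λ S i N ↔ Nonempty (N ≃ₗ[Λ] M ⧸ W i)) := fun N h1 h2 =>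
    hW'.isBracket_iff hR hMu hS h1 h2
  have hmul : ∀ {i : ℕ}, 1 ≤ i → 1 ≤ i * s := fun h => Nat.mul_pos h hspos
  have hΓ : IsNakayamaAlgebra k (GammaRing Λ M) :=
    isNakayamaAlgebra_gammaRing hR (hW.isQuasiProjective_self hR hMu)
  have hΓfin := hΓ.finite
  have hΓn : IsNoetherianRing (GammaRing Λ M) := IsNoetherianRing.of_finite k _
  have hΓ₂ : IsNakayamaAlgebra k (GammaRing Λ (M × W (t' % s))) :=
    isNakayamaAlgebra_gammaRing hR (hW.isPerpGenerator_prod hR hMu).isQuasiProjective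
  have hΓ₂fin := hΓ₂.finite
  have hΓ₂n : IsNoetherianRing (GammaRing Λ (M × W (t' % s))) := IsNoetherianRing.of_finite k _
  obtain ⟨η₂, hη₂, hη₂', hη₂''⟩ :=
    (hW.isPerpGenerator_prod hR hMu).exists_equivalence k hR hMu hW
  have hlim := hW.preservesFiniteLimits_statCat_iff hR hMu
  have hcolim := hW.preservesFiniteColimits_statCat hR hMu
  refine ⟨fun i hi hit => ?_, ⟨isLocalRing_gammaRing hMu, hΓ, hW.length_gammaRing hR hMu hlt⟩,
    fun hdvd => ⟨hW.statCat_eq_abCat hR hMu hdvd, ?_, fun N hN => ?_⟩,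
    fun hdvd s₁ hs₁ hs₁s hts₁ => ⟨?_, ?_, hW.statCat_le_abCat hR hMu, fun N hN => ?_⟩, ?_,
    hW.exists_abelian_statCat hR hMu, hcolim,
    ⟨fun h => hlim.1 h.1, fun h => ⟨hlim.2 h, hcolim⟩⟩⟩
  · refine ⟨FGModuleCat.of Λ (M ⧸ W i), (hbr _ hi hit).2 ⟨LinearEquiv.refl _ _⟩, fun Y hY => ?_⟩
    exact (hbr _ hi hit).1 hY
  · obtain ⟨η, h1, h2, -⟩ :=
      (hW.isPerpGenerator_self hR hMu hdvd).exists_equivalence k hR hMu hW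
    exact ⟨η, h1, h2⟩
  · rw [← hW.statCat_eq_abCat hR hMu hdvd, hW.statCat_iff hR hMu, hW.isPresentedBy_iff hR hMu hN]
    have hes : e * s = t' := by
      obtain ⟨c, rfl⟩ := hdvd
      have hce : ∀ i, i < e ↔ i < c := fun i => by
        rw [hlt i, mul_comm i s, Nat.mul_lt_mul_left hspos]
      have h1 := hce e
      have h2 := hce c
      rw [mul_comm s c]
      congr 1
      omega
    have hepos : 0 < e := (hlt 0).2 (by rwa [zero_mul])
    constructor
    · rintro (⟨⟨f⟩⟩ | ⟨i, hi, hit, hf⟩)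
      · refine ⟨e, hepos, le_rfl, ?_⟩
        rw [hes, hbr N htpos le_rfl]
        exact ⟨f.trans (Submodule.quotEquivOfEqBot _ (hW'.bot _ le_rfl)).symm⟩
      · exact ⟨i, hi, ((hlt i).2 hit).le, (hbr N (hmul hi) hit.le).2 hf⟩
    · rintro ⟨i, hi, hie, hN'⟩
      rcases hie.lt_or_eq with h | rfl
      · have hit := (hlt i).1 h
        exact Or.inr ⟨i, hi, hit, (hbr N (hmul hi) hit.le).1 hN'⟩
      · rw [hes, hbr N htpos le_rfl] at hN'
        obtain ⟨f⟩ := hN'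
        exact Or.inl ⟨f.trans (Submodule.quotEquivOfEqBot _ (hW'.bot _ le_rfl))⟩
  · refine ⟨GammaRing Λ (M × W (t' % s)), inferInstance, inferInstance, hΓ₂,
      (hW.isPerpGenerator_prod hR hMu).numSimples_eq_two hR hMu hW
        fun h => hdvd (Nat.dvd_of_mod_eq_zero h), η₂, hη₂, hη₂'⟩
  · have hmod : t' % s = s₁ := by
      rw [hts₁, mul_comm, Nat.mul_add_mod, Nat.mod_eq_of_lt hs₁s]
    have hle : W s ≤ W s₁ := hW'.antitone hs₁s.le
    let p : (M ⧸ W s) →ₗ[Λ] (M ⧸ W s₁) := Submodule.factor hle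
    refine ⟨FGModuleCat.of Λ (M ⧸ W s), FGModuleCat.of Λ (M ⧸ W s₁), p,
      (hbr _ hspos hst).2 ⟨LinearEquiv.refl _ _⟩,
      (hbr _ hs₁ (by omega)).2 ⟨LinearEquiv.refl _ _⟩, Submodule.factor_surjective hle,
      fun N hN => ?_⟩
    rw [hW.abCat_iff hR hMu] at hN
    -- the kernel of `M / W s → M / W s₁` is `W s₁ / W s`
    have eB : (W s₁ ⧸ (W s).submoduleOf (W s₁)) ≃ₗ[Λ] LinearMap.ker p := by
      have hmem : ∀ x : W s₁, ((W s).mkQ ∘ₗ (W s₁).subtype) x ∈ LinearMap.ker p := fun x =>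
        (Submodule.Quotient.mk_eq_zero (W s₁)).2 x.2
      let g := ((W s).mkQ ∘ₗ (W s₁).subtype).codRestrict (LinearMap.ker p) hmem
      have hg : Function.Surjective g := by
        rintro ⟨y, hy⟩
        obtain ⟨x, rfl⟩ := (W s).mkQ_surjective y
        exact ⟨⟨x, (Submodule.Quotient.mk_eq_zero (W s₁)).1 hy⟩, rfl⟩
      have hker : LinearMap.ker g = (W s).submoduleOf (W s₁) := by
        refine (LinearMap.ker_codRestrict _ _ _).trans ?_
        rw [LinearMap.ker_comp, Submodule.ker_mkQ]
        rfl
      exact (Submodule.quotEquivOfEq _ _ hker.symm).trans (g.quotKerEquivOfSurjective hg)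
    refine hasFiltration_of_exists_submodule (C := fun X _ _ => IsPerpendicular W s t' X)
      (fun X Y _ _ _ _ f h => h.congr f) (fun X _ _ _ _ hX => ?_) hN
    obtain ⟨I, hI, hB, hXI⟩ := hX.exists_submodule hR hMu hW (by omega)
    rw [hmod] at hB
    exact ⟨I, hI, hB.imp id fun ⟨f⟩ => ⟨f.trans eB⟩, hXI⟩
  · rw [hW.statCat_iff hR hMu, hW.isPresentedBy_iff hR hMu hN]
    refine or_congr_right (exists_congr fun i => and_congr_right fun hi => ?_)
    rw [hlt i]
    exact and_congr_right fun hit => (hbr N (hmul hi) hit.le).symm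
  · by_cases hdvd : s ∣ t'
    · obtain ⟨η, h1, h2, h3⟩ :=
        (hW.isPerpGenerator_self hR hMu hdvd).exists_equivalence k hR hMu hW
      have hunis : IsUniserial (GammaRing Λ M) (GammaRing Λ M) := by
        have : Module.Finite (GammaRing Λ M) (HomModule Λ M M) :=
          Module.Finite.equiv HomModule.selfEquiv
        exact IsUniserial.of_injective
          (HomModule.total (hW.isQuasiProjective_self hR hMu) hMu)
          HomModule.selfEquiv.toLinearMap HomModule.selfEquiv.injective
      exact ⟨GammaRing Λ M, inferInstance, inferInstance, η, hΓ,
        (numSimples_le_one hunis).trans one_le_two, h1, h2, h3⟩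
    · exact ⟨GammaRing Λ (M × W (t' % s)), inferInstance, inferInstance, η₂, hΓ₂,
        ((hW.isPerpGenerator_prod hR hMu).numSimples_eq_two hR hMu hW
          fun h => hdvd (Nat.dvd_of_mod_eq_zero h)).le, hη₂, hη₂', hη₂''⟩
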